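/- Let $\mathsf k$ be a unital commutative Noetherian ring, $Q$ a finite acyclic quiver, and let $S$ be a choice, for each pair of vertices, of a collection of disjoint sets of parallel paths. Let $I_S\subset \mathsf kQ$ be the two-sided ideal generated by the differences $p-p'$ of paths in a common set of $S$, and let $A=\mathsf kQ/I_S$ be a homotopy path algebra: for paths $r,p,p'$, if $rp-rp'\in I_S$ is nonzero then $p-p'\in I_S$, and if $pr-p'r\in I_S$ is nonzero then $p-p'\in I_S$. (Products are concatenations, $pr$ meaning first $p$, then $r$; $t(p)$ and $h(p)$ are the starting and end point of $p$.) A path of $A$ is a class of paths $p$ of $Q$ modulo $p\sim p'\Leftrightarrow p-p'\in I_S$. The paths of $A$ starting at a vertex $v$ are ordered by $p\le q\Leftrightarrow q=pr$ for some $r$; the constant path $e_v$ is the least one. For a nonconstant path $p$ let $K((e_{t(p)},p))$ be the order complex of the open interval $(e_{t(p)},p)$, and let $\widetilde H_i$ denote reduced homology with coefficients in $\mathsf k$ (so $\widetilde H_{-1}(\emptyset)=\mathsf k$). The $n$-cells of the geometric realization $X_A$ (the classifying space of the category of paths of $A$) are the chains $\eta=[e_v<p_1<\dots<p_n]$; put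 $t(\eta)=v$, $h(\eta)=h(p_n)$ (or $v$ if $n=0$) and $P_\eta=Ae_{t(\eta)}\otimes_{\mathsf k}e_{h(\eta)}A$. The $0$-th facet of $\eta$ is $[e_{h(p_1)}<p_2/p_1<\dots<p_n/p_1]$, which splits off $p_1$ on the left; the $n$-th facet omits $p_n$ and splits off $p_n/p_{n-1}$ on the right (with $p_0=e_v$); the $i$-th facet omits $p_i$ and splits off nothing if $0<i<n$. The $i$-th facet has incidence number $(-1)^i$. *Babson–Hersh matching.* For each nonconstant $p$ choose a lexicographic order on the maximal chains of $(e_{t(p)},p)$: a strict total order in which the order of two maximal chains is decided by their initial segments up to and including the first elements in which they differ. For a maximal chain $F$, the minimal skipped intervals of $F$ are the inclusion-minimal sets among $F\setminus G$, for $G$ a maximal chain preceding $F$. The truncated intervals $J_1,J_2,\dots$ are obtained by repeatedly taking the lowest interval, removing its elements from the others, and keeping only the inclusion-minimal ones of these. A nonempty simplex $\sigma$ of the order complex whose first maximal chain is $F\supseteq\sigma$ is matched by adding or removing the following element of $F$, unless removing it would leave the empty set: if the minimal skipped intervals do not cover $F$, the lowest element not covered; otherwise $\min J_i$ for the least $i$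 with $\sigma\cap J_i\ne\{\min J_i\}$, if there is such an $i$; otherwise the lowest element of $F$ in no $J_i$. If there is no such element either, $\sigma$ is unmatched. Match $[e_{t(p)}<\tau<p]$ with $[e_{t(p)}<\sigma<p]$ whenever $\tau$ and $\sigma$ are matched, and, if $(e_{t(p)},p)\neq\emptyset$, match $[e_{t(p)}<t<p]$ with $[e_{t(p)}<p]$ for a chosen unmatched vertex $t$. The cells of $X_A$ left unmatched are called critical; a critical cell $[e_{t(p)}<\sigma<p]$ with $\sigma$ a simplex of dimension $i$ is called a critical $i$-cell of $K((e_{t(p)},p))$ (for $i=-1$ this is $[e_{t(p)}<p]$). *Morse complex.* An alternating path is a sequence of steps in the face poset of $X_A$, each going down from a cell to a facet along an unmatched edge and then up along a matched edge; a gradient path $\gamma$ is an alternating path followed by one step down along an unmatched edge. If $\gamma$ runs through $\rho_0,\tau_0,\rho_1,\tau_1,\dots,\rho_m,\tau_m$ (down from $\rho_i$ to $\tau_i$, up from $\tau_i$ to $\rho_{i+1}$), its multiplicity is $\epsilon(\gamma)=\prod_{i<m}\bigl(-[\rho_i:\tau_i][\rho_{i+1}:\tau_i]\bigr)\cdot[\rho_m:\tau_m]$,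 and $l(\gamma)$, $r(\gamma)$ are the products of the paths split off on the left and on the right (the multiplicity of an alternating path is defined in the same way, without the last factor). The Morse complex $\mathfrak C_\bullet$ of $A$-bimodules has $\mathfrak C_n=\bigoplus_{\eta}P_\eta$ over the critical $n$-cells and differential $1\otimes[\eta]\otimes1\mapsto\sum_{\omega}\sum_{\gamma:\eta\to\omega}\epsilon(\gamma)\,l(\gamma)\otimes[\omega]\otimes r(\gamma)$, the sums over critical $(n-1)$-cells $\omega$ and gradient paths $\gamma$; it is augmented to $A$ by multiplication. **Theorem.** Fix any such choices. (1) Suppose that for every nonconstant path $p$ and every $i\ge-1$ the $\mathsf k$-module $\widetilde H_i(K((e_{t(p)},p)))$ is free with a basis indexed by the critical $i$-cells of $K((e_{t(p)},p))$. Then $\mathfrak C_\bullet\to A$ is a projective resolution of $A$ as an $A\otimes_{\mathsf k}A^{\mathrm{op}}$-module, and it is minimal: all components of its differential lie in the two-sided ideal of $A\otimes_{\mathsf k}A^{\mathrm{op}}$ generated by the elements $a\otimes1$ and $1\otimes a$, $a$ an arrow. Moreover it is cellular, in the following sense: its terms are indexed by the critical cells, its differential attaches to each gradient path $\gamma:\eta\to\omega$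 the bimodule map $P_\eta\to P_\omega$ given by $l(\gamma)$, $r(\gamma)$ with multiplicity $\epsilon(\gamma)$, and the free $\mathbb Z$-modules on the critical cells with the incidence numbers $[\eta:\omega]=\sum_{\gamma:\eta\to\omega}\epsilon(\gamma)$ form a chain complex that is chain homotopy equivalent to the cellular chain complex of $X_A$. (2) Conversely, suppose that $A$ is graded by path length, i.e. $A=\bigoplus_n A_n$ with $A_n$ spanned by the classes of the paths of length $n$, and that $\mathfrak C_\bullet\to A$ is a minimal projective resolution. Then for every nonconstant path $p$ and every $i\ge-1$ the module $\widetilde H_i(K((e_{t(p)},p)))$ is free and the critical $i$-cells form a basis of it: for each critical $i$-cell $\sigma$ the chain $\sum_\tau\sum_{z:\sigma\to\tau}\epsilon(z)\,\tau$ (the sum over all alternating paths $z$ from $[e_{t(p)}<\sigma<p]$ to cells $[e_{t(p)}<\tau<p]$ of the same dimension) is a cycle, and the classes of these cycles are a basis. -/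

import Mathlib

set_option maxSynthPendingDepth 3

open scoped TensorProduct DirectSum

/-! ### Order complexes, reduced homology, and the matching of Babson and Hersh -/

namespace OrderComplex

open scoped Classical in
section

variable {P : Type*} [PartialOrder P]

/-- The simplices of the order complex `K(P)`: finite chains, with the empty chain included. -/
def Simplex (P : Type*) [PartialOrder P] : Type _ :=
  {σ : Finset P // IsChain (· ≤ ·) (σ : Set P)}

/-- The facets of `K(P)`: the (finite) maximal chains of `P`. -/
def Facet (P : Type*) [PartialOrder P] : Type _ :=
  {F : Finset P // IsMaxChain (· ≤ ·) (F : Set P)}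

end

noncomputable section

open scoped Classical

variable {P : Type*} [PartialOrder P]

/-- The face of a simplex obtained by deleting a vertex. -/
def Simplex.erase (σ : Simplex P) (q : P) : Simplex P :=
  ⟨σ.1.erase q, σ.2.mono (by simp)⟩

/-- The reduced simplicial chains of `K(P)` on simplices with `n` vertices, i.e. in degree
`n - 1`. For `n = 0` this is `k`, spanned by the empty simplex. -/
abbrev RedChain (k : Type*) [CommRing k] (P : Type*) [PartialOrder P] (n : ℕ) : Type _ :=
  {σ : Simplex P // σ.1.card = n} →₀ k

/-- The simplicial boundary map from degree `n` to degree `n - 1`. -/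
def redBoundary (k : Type*) [CommRing k] (P : Type*) [PartialOrder P] (n : ℕ) :
    RedChain k P (n + 1) →ₗ[k] RedChain k P n :=
  Finsupp.linearCombination k fun σ => ∑ q ∈ σ.1.1.attach,
    Finsupp.single
      (⟨σ.1.erase q.1, by
        have h := Finset.card_erase_of_mem q.2
        simp only [Simplex.erase]
        rw [h, σ.2]; rfl⟩ : {σ : Simplex P // σ.1.card = n})
      ((-1 : k) ^ (σ.1.1.filter (· < q.1)).card)

/-- The reduced cycles in degree `n - 1`. -/
def redCycles (k : Type*) [CommRing k] (P : Type*) [PartialOrder P] :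
    ∀ n : ℕ, Submodule k (RedChain k P n)
  | 0 => ⊤
  | n + 1 => LinearMap.ker (redBoundary k P n)

/-- The reduced homology of `K(P)` in degree `n - 1`, with coefficients in `k`. In particular
`RedHomology k P 0` is the homology in degree `-1`; it is `k` when `P` is empty. -/
abbrev RedHomology (k : Type*) [CommRing k] (P : Type*) [PartialOrder P] (n : ℕ) : Type _ :=
  redCycles k P n ⧸ (LinearMap.range (redBoundary k P n)).submoduleOf (redCycles k P n)

/-- A lexicographic order on the maximal chains of `P`: a strict total order such that, if `F` and
`G` agree up to some point and continue there with distinct elements `x` and `y`, then the order of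
`F` and `G` is decided by their initial segments ending in `x` and `y`. -/
structure LexOrder (P : Type*) [PartialOrder P] where
  lt : Facet P → Facet P → Prop
  isStrictTotalOrder : IsStrictTotalOrder (Facet P) lt
  lex : ∀ (F F' G G' : Facet P) (x y : P), x ≠ y →
    x ∈ F.1 → x ∈ F'.1 → y ∈ G.1 → y ∈ G'.1 →
    F.1.filter (· < x) = G.1.filter (· < y) →
    F'.1.filter (· < x) = F.1.filter (· < x) →
    G'.1.filter (· < y) = G.1.filter (· < y) →
    lt F G → lt F' G'

/-- The least element of a finite set, if there is one. -/
def least (X : Finset P) : Option P :=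
  if h : ∃ x, IsLeast (X : Set P) x then some h.choose else none

/-- The minimal skipped intervals of a maximal chain `F`: the inclusion-minimal sets among
`F \ G`, for `G` a maximal chain that precedes `F`. -/
def LexOrder.skipped (o : LexOrder P) (F : Facet P) : Finset (Finset P) :=
  F.1.powerset.filter fun X => Minimal (fun Y => ∃ G, o.lt G F ∧ Y = F.1 \ G.1) X

/-- The member of a family of sets that contains the least element of their union. -/
def lowestInterval (I : Finset (Finset P)) : Finset P :=
  if h : ∃ X ∈ I, ∃ x ∈ X, ∀ Y ∈ I, ∀ y ∈ Y, x ≤ y then h.choose else ∅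

/-- The truncation procedure: take the lowest interval, remove its elements from the other
intervals, keep of these only the inclusion-minimal ones, and repeat. The first argument bounds the
number of rounds. -/
def truncation : ℕ → Finset (Finset P) → List (Finset P)
  | 0, _ => []
  | n + 1, I =>
    if I = ∅ then []
    else
      let X := lowestInterval I
      let I' := (I.erase X).image (· \ X)
      X :: truncation n (I'.filter fun Y => Minimal (· ∈ I') Y)

/-- The non-overlapping intervals obtained by truncating the minimal skipped intervals, listed from
the lowest to the highest. (Each round uses up at least one interval.) -/
def LexOrder.truncated (o : LexOrder P) (F : Facet P) : List (Finset P) :=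
  truncation (o.skipped F).card (o.skipped F)

/-- The element of `F` which is added to or removed from a face `σ` of `F` not contained in any
earlier maximal chain. If the minimal skipped intervals do not cover `F`, it is the lowest element
not covered. Otherwise it is the lowest element of the first truncated interval whose intersection
with `σ` is not just its lowest element, if there is one; and otherwise the lowest element of `F`
that lies in no truncated interval. If there is no such element either, then `σ` is critical. -/
def LexOrder.pivot (o : LexOrder P) (F : Facet P) (σ : Finset P) : Option P :=
  if ∃ x ∈ F.1, ∀ X ∈ o.skipped F, x ∉ X then
    least (F.1.filter fun x => ∀ X ∈ o.skipped F, x ∉ X)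
  else
    match (o.truncated F).find? (fun X : Finset P => decide (¬ ∃ x, IsLeast (X : Set P) x ∧ σ ∩ X = {x})) with
    | some X => least X
    | none => least (F.1.filter fun x => ∀ X ∈ o.truncated F, x ∉ X)

/-- The Babson-Hersh matching on the nonempty simplices of `K(P)` for a lexicographic order on the
maximal chains: `σ` is matched with the larger simplex `τ`. -/
def LexOrder.Matched (o : LexOrder P) (τ σ : Simplex P) : Prop :=
  σ.1.Nonempty ∧ ∃ F : Facet P, σ.1 ⊆ F.1 ∧ (∀ G, o.lt G F → ¬ σ.1 ⊆ G.1) ∧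
    ∃ x, x ∉ σ.1 ∧ o.pivot F σ.1 = some x ∧ τ.1 = insert x σ.1

/-- The vertex `t` of `K(P)`, as a simplex. -/
def vertex (t : P) : Simplex P := ⟨{t}, by simp⟩

/-- The vertex `t` is not matched by the Babson-Hersh matching. -/
def LexOrder.Unmatched (o : LexOrder P) (t : P) : Prop :=
  ∀ σ : Simplex P, ¬ o.Matched σ (vertex t) ∧ ¬ o.Matched (vertex t) σ

end

end OrderComplex

/-! ### Path algebras -/

/-- The paths of a quiver `V`. -/
abbrev PathOf (V : Type*) [Quiver V] : Type _ := Σ v w : V, Quiver.Path v w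

/-- The path algebra `kQ`: the free `k`-module on the paths. -/
def PathAlgebra (k V : Type*) [CommRing k] [Quiver V] : Type _ := PathOf V →₀ k

namespace PathAlgebra

noncomputable section

open scoped Classical

variable {k V : Type*} [CommRing k] [Quiver V]

instance : AddCommGroup (PathAlgebra k V) := inferInstanceAs (AddCommGroup (PathOf V →₀ k))
instance : Module k (PathAlgebra k V) := inferInstanceAs (Module k (PathOf V →₀ k))

/-- The basis of the path algebra given by the paths. -/
def basis (k V : Type*) [CommRing k] [Quiver V] : Module.Basis (PathOf V) k (PathAlgebra k V) :=
  ⟨LinearEquiv.refl k (PathOf V →₀ k)⟩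

/-- A path, as an element of the path algebra. -/
def of (p : PathOf V) : PathAlgebra k V := basis k V p

/-- The product of two paths is their concatenation (first `p`, then `q`), and zero if `p` does not
end where `q` starts. -/
def concat (k : Type*) [CommRing k] (p q : PathOf V) : PathAlgebra k V :=
  if h : p.2.1 = q.1 then of ⟨p.1, q.2.1, p.2.2.comp (q.2.2.cast h.symm rfl)⟩ else 0

/-- The bilinear extension of the concatenation. -/
def mulHom : PathAlgebra k V →ₗ[k] PathAlgebra k V →ₗ[k] PathAlgebra k V :=
  (basis k V).constr k fun p => (basis k V).constr k fun q => concat k p q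

instance : Mul (PathAlgebra k V) := ⟨fun f g => mulHom f g⟩

theorem mul_def (f g : PathAlgebra k V) : f * g = mulHom f g := rfl

theorem of_mul_of (p q : PathOf V) : (of p * of q : PathAlgebra k V) = concat k p q := by
  rw [mul_def, mulHom, of, of, Module.Basis.constr_basis, Module.Basis.constr_basis]

theorem of_mul_of' {u v w : V} (p : Quiver.Path u v) (q : Quiver.Path v w) :
    (of ⟨u, v, p⟩ * of ⟨v, w, q⟩ : PathAlgebra k V) = of ⟨u, w, p.comp q⟩ := by
  rw [of_mul_of]; simp [concat]

theorem of_mul_of_ne {p q : PathOf V} (h : p.2.1 ≠ q.1) :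
    (of p * of q : PathAlgebra k V) = 0 := by
  rw [of_mul_of]; simp [concat, h]

theorem ext_of {M : Type*} [AddCommMonoid M] [Module k M] {f g : PathAlgebra k V →ₗ[k] M}
    (h : ∀ p, f (of p) = g (of p)) : f = g :=
  (basis k V).ext h

theorem of_assoc (p q r : PathOf V) :
    (of p * of q * of r : PathAlgebra k V) = of p * (of q * of r) := by
  obtain ⟨p1, p2, p⟩ := p
  obtain ⟨q1, q2, q⟩ := q
  obtain ⟨r1, r2, r⟩ := r
  by_cases h1 : p2 = q1
  · subst h1
    by_cases h2 : q2 = r1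
    · subst h2
      simp [of_mul_of', Quiver.Path.comp_assoc]
    · rw [of_mul_of', of_mul_of_ne h2, of_mul_of_ne h2]; simp [mul_def]
  · rw [of_mul_of_ne h1]
    by_cases h2 : q2 = r1
    · subst h2
      rw [of_mul_of', of_mul_of_ne h1]; simp [mul_def]
    · rw [of_mul_of_ne h2]; simp [mul_def]

variable [Fintype V]

/-- The unit is the sum of the constant paths. -/
instance : One (PathAlgebra k V) := ⟨∑ v : V, of ⟨v, v, Quiver.Path.nil⟩⟩

theorem one_def : (1 : PathAlgebra k V) = ∑ v : V, of ⟨v, v, Quiver.Path.nil⟩ := rfl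

instance : Ring (PathAlgebra k V) :=
  { (inferInstance : AddCommGroup (PathAlgebra k V)) with
    left_distrib := fun f g h => by simp [mul_def]
    right_distrib := fun f g h => by simp [mul_def]
    zero_mul := fun f => by simp [mul_def]
    mul_zero := fun f => by simp [mul_def]
    mul_assoc := fun f g h => by
      have h1 (p q : PathOf V) : mulHom (mulHom (of p) (of q)) =
          mulHom (of p) ∘ₗ mulHom (k := k) (of q) := ext_of fun r => of_assoc p q r
      have h2 (p : PathOf V) (h : PathAlgebra k V) : mulHom.flip h ∘ₗ mulHom (of p) =
          mulHom (of p) ∘ₗ mulHom.flip h := ext_of fun q => LinearMap.congr_fun (h1 p q) h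
      have h3 : mulHom.flip h ∘ₗ mulHom.flip g = mulHom.flip (mulHom (k := k) g h) :=
        ext_of fun p => LinearMap.congr_fun (h2 p h) g
      exact LinearMap.congr_fun h3 f
    one_mul := fun f => by
      have key : mulHom (1 : PathAlgebra k V) = LinearMap.id := ext_of fun p => by
        obtain ⟨p1, p2, p⟩ := p
        rw [one_def, map_sum, LinearMap.sum_apply, Finset.sum_eq_single p1]
        · rw [← mul_def, of_mul_of', Quiver.Path.nil_comp]; rfl
        · intro v _ hv; rw [← mul_def, of_mul_of_ne hv]
        · simp
      rw [mul_def, key]; rfl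
    mul_one := fun f => by
      have key : mulHom.flip (1 : PathAlgebra k V) = LinearMap.id := ext_of fun p => by
        obtain ⟨p1, p2, p⟩ := p
        rw [LinearMap.flip_apply, one_def, map_sum, Finset.sum_eq_single p2]
        · rw [← mul_def, of_mul_of', Quiver.Path.comp_nil]; rfl
        · intro v _ hv; rw [← mul_def, of_mul_of_ne (Ne.symm hv)]
        · simp
      rw [mul_def, ← LinearMap.flip_apply, key]; rfl }

instance : Algebra k (PathAlgebra k V) :=
  Algebra.ofModule (fun r x y => by simp [mul_def]) (fun r x y => by simp [mul_def])

end

end PathAlgebra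

/-! ### Homotopy path algebras -/

noncomputable section

/-- The two-sided ideal `I_S` of `kQ` generated by the differences of any two paths that lie in a
common member of the given collection of sets of parallel paths. -/
def relIdeal (k : Type*) {V : Type*} [CommRing k] [Quiver V] [Fintype V]
    (rel : ∀ v w : V, Set (Set (Quiver.Path v w))) : TwoSidedIdeal (PathAlgebra k V) :=
  TwoSidedIdeal.span {x | ∃ v w, ∃ s ∈ rel v w, ∃ p ∈ s, ∃ p' ∈ s,
    x = PathAlgebra.of ⟨v, w, p⟩ - PathAlgebra.of ⟨v, w, p'⟩}

end

/-- A homotopy path algebra over `k`: an acyclic quiver `V` with a collection of disjoint sets of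
parallel paths, such that common factors on the left and on the right can be cancelled modulo the
ideal `I_S`. -/
structure HPA (k V : Type*) [CommRing k] [Quiver V] [Fintype V] where
  acyclic : ∀ (v : V) (p : Quiver.Path v v), p.length = 0
  rel : ∀ v w : V, Set (Set (Quiver.Path v w))
  rel_disjoint : ∀ v w : V, (rel v w).PairwiseDisjoint id
  cancel_left : ∀ r p p' : PathOf V,
    (PathAlgebra.of r * PathAlgebra.of p - PathAlgebra.of r * PathAlgebra.of p' :
      PathAlgebra k V) ≠ 0 →
    PathAlgebra.of r * PathAlgebra.of p - PathAlgebra.of r * PathAlgebra.of p' ∈ relIdeal k rel →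
    PathAlgebra.of p - PathAlgebra.of p' ∈ relIdeal k rel
  cancel_right : ∀ r p p' : PathOf V,
    (PathAlgebra.of p * PathAlgebra.of r - PathAlgebra.of p' * PathAlgebra.of r :
      PathAlgebra k V) ≠ 0 →
    PathAlgebra.of p * PathAlgebra.of r - PathAlgebra.of p' * PathAlgebra.of r ∈ relIdeal k rel →
    PathAlgebra.of p - PathAlgebra.of p' ∈ relIdeal k rel

namespace HPA

noncomputable section

open scoped Classical
open PathAlgebra OrderComplex MulOpposite

variable {k V : Type*} [CommRing k] [Quiver V] [Fintype V] (A : HPA k V)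

/-- The ideal of relations. -/
def ideal : TwoSidedIdeal (PathAlgebra k V) := relIdeal k A.rel

/-- The algebra `A = kQ / I_S`. -/
def Alg : Type _ := A.ideal.ringCon.Quotient

instance : Ring A.Alg := inferInstanceAs (Ring A.ideal.ringCon.Quotient)
instance : Algebra k A.Alg := inferInstanceAs (Algebra k A.ideal.ringCon.Quotient)

/-- The class in `A` of a path of the quiver. -/
def ofPath (p : PathOf V) : A.Alg := A.ideal.ringCon.mk' (PathAlgebra.of p)

/-- Two parallel paths are equivalent if their difference lies in the ideal of relations. -/
def pathSetoid (v w : V) : Setoid (Quiver.Path v w) where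
  r p q := (of ⟨v, w, p⟩ - of ⟨v, w, q⟩ : PathAlgebra k V) ∈ A.ideal
  iseqv :=
    { refl := fun p => by simp [A.ideal.zero_mem]
      symm := fun {p q} h => by simpa using A.ideal.neg_mem h
      trans := fun {p q r} h h' => by simpa using A.ideal.add_mem h h' }

/-- The paths of `A` from `v` to `w`: the classes of paths of the quiver. These are the morphisms of
the category `C_A`. -/
def Hom (v w : V) : Type _ := Quotient (A.pathSetoid v w)

variable {A}

/-- The constant path. -/
def Hom.id (v : V) : A.Hom v v := Quotient.mk _ Quiver.Path.nil

/-- Concatenation of paths of `A`. -/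
def Hom.comp {u v w : V} (p : A.Hom u v) (q : A.Hom v w) : A.Hom u w :=
  Quotient.map₂ Quiver.Path.comp (fun p p' hp q q' hq => by
    have h1 : (of ⟨u, v, p⟩ - of ⟨u, v, p'⟩ : PathAlgebra k V) * of ⟨v, w, q⟩ ∈ A.ideal :=
      A.ideal.mul_mem_right _ _ hp
    have h2 : (of ⟨u, v, p'⟩ : PathAlgebra k V) * (of ⟨v, w, q⟩ - of ⟨v, w, q'⟩) ∈ A.ideal :=
      A.ideal.mul_mem_left _ _ hq
    have h3 := A.ideal.add_mem h1 h2
    rw [sub_mul, mul_sub, of_mul_of', of_mul_of', of_mul_of'] at h3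
    change (of ⟨u, w, p.comp q⟩ - of ⟨u, w, p'.comp q'⟩ : PathAlgebra k V) ∈ A.ideal
    simpa using h3) p q

/-- A path of `A`, as an element of the algebra. -/
def Hom.toAlg {v w : V} (p : A.Hom v w) : A.Alg :=
  Quotient.lift (fun p => A.ofPath ⟨v, w, p⟩) (fun p q h => by
    refine (RingCon.eq _).2 ?_
    have h' : (of ⟨v, w, p⟩ - of ⟨v, w, q⟩ : PathAlgebra k V) ∈ A.ideal := h
    exact (TwoSidedIdeal.rel_iff _ _ _).2 h') p

theorem Hom.comp_assoc {t u v w : V} (p : A.Hom t u) (q : A.Hom u v) (r : A.Hom v w) :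
    (p.comp q).comp r = p.comp (q.comp r) := by
  induction p using Quotient.inductionOn
  induction q using Quotient.inductionOn
  induction r using Quotient.inductionOn
  exact congrArg (Quotient.mk _) (Quiver.Path.comp_assoc _ _ _)

theorem Hom.id_comp {v w : V} (p : A.Hom v w) : (Hom.id v).comp p = p := by
  induction p using Quotient.inductionOn
  exact congrArg (Quotient.mk _) (Quiver.Path.nil_comp _)

theorem Hom.comp_id {v w : V} (p : A.Hom v w) : p.comp (Hom.id w) = p := by
  induction p using Quotient.inductionOn
  exact congrArg (Quotient.mk _) (Quiver.Path.comp_nil _)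

theorem Hom.cancel {u v w : V} (p : A.Hom u v) (q r : A.Hom v w)
    (h : p.comp q = p.comp r) : q = r := by
  induction p using Quotient.inductionOn with | h p
  induction q using Quotient.inductionOn with | h q
  induction r using Quotient.inductionOn with | h r
  have h' : (of ⟨u, w, p.comp q⟩ - of ⟨u, w, p.comp r⟩ : PathAlgebra k V) ∈ A.ideal :=
    Quotient.exact h
  refine Quotient.sound ?_
  change (of ⟨v, w, q⟩ - of ⟨v, w, r⟩ : PathAlgebra k V) ∈ A.ideal
  rw [← of_mul_of', ← of_mul_of'] at h'
  by_cases h0 : (of ⟨u, v, p⟩ * of ⟨v, w, q⟩ - of ⟨u, v, p⟩ * of ⟨v, w, r⟩ : PathAlgebra k V) = 0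
  · rw [of_mul_of', of_mul_of', sub_eq_zero] at h0
    rcases subsingleton_or_nontrivial k with hk | hk
    · have := Module.subsingleton k (PathAlgebra k V)
      rw [Subsingleton.elim (of ⟨v, w, q⟩ - of ⟨v, w, r⟩ : PathAlgebra k V) 0]
      exact A.ideal.zero_mem
    · have h1 := (basis k V).injective h0
      simp only [Sigma.mk.injEq, heq_eq_eq, true_and] at h1
      rw [Quiver.Path.comp_inj_right.1 h1, sub_self]
      exact A.ideal.zero_mem
  · exact A.cancel_left _ _ _ h0 h'

theorem Hom.eq_id (v : V) (p : A.Hom v v) : p = Hom.id v := by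
  induction p using Quotient.inductionOn with | h p
  rw [Quiver.Path.eq_nil_of_length_zero p (A.acyclic v p)]; rfl

theorem Hom.eq_of_comp {v w : V} (p : A.Hom v w) (q : A.Hom w v) : v = w := by
  induction p using Quotient.inductionOn with | h p
  induction q using Quotient.inductionOn with | h q
  have h := A.acyclic v (p.comp q)
  rw [Quiver.Path.length_comp] at h
  exact Quiver.Path.eq_of_length_zero p (by omega)

variable (A) in
/-- The paths of `A` that start at `v`. -/
def Under (v : V) : Type _ := Σ w, A.Hom v w

/-- The end point `h(p)` of a path. -/
def Under.head {v : V} (p : A.Under v) : V := p.1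

/-- Concatenation of a path with a path starting at its end point. -/
def Under.comp {v : V} (p : A.Under v) (r : A.Under p.head) : A.Under v :=
  ⟨r.1, Hom.comp p.2 r.2⟩

/-- The path poset: `p ≤ q` if `q = p r` for some path `r`. -/
instance (v : V) : PartialOrder (A.Under v) where
  le p q := ∃ r : A.Under p.head, p.comp r = q
  le_refl p := ⟨⟨p.1, Hom.id p.1⟩, congrArg (Sigma.mk _) (Hom.comp_id p.2)⟩
  le_trans p q s := by
    rintro ⟨r, rfl⟩ ⟨r', rfl⟩
    exact ⟨⟨r'.1, Hom.comp r.2 r'.2⟩,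
      congrArg (Sigma.mk _) (Hom.comp_assoc p.2 r.2 r'.2).symm⟩
  le_antisymm p q := by
    rintro ⟨⟨w, r⟩, rfl⟩ ⟨⟨w', r'⟩, h⟩
    obtain ⟨x, p⟩ := p
    have hx : w' = x := congrArg Sigma.fst h
    subst hx
    have hw : w' = w := Hom.eq_of_comp (A := A) r r'
    subst hw
    have hr : r = Hom.id w' := Hom.eq_id _ _
    subst hr
    exact congrArg (Sigma.mk _) (Hom.comp_id p).symm

theorem Under.le_iff {v : V} {p q : A.Under v} :
    p ≤ q ↔ ∃ r : A.Under p.head, p.comp r = q := Iff.rfl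

/-- The constant path `e_v` is the least path starting at `v`. -/
instance (v : V) : OrderBot (A.Under v) where
  bot := ⟨v, Hom.id v⟩
  bot_le p := ⟨p, congrArg (Sigma.mk _) (Hom.id_comp p.2)⟩

theorem Under.comp_le_comp_iff {v : V} (p : A.Under v) (r r' : A.Under p.head) :
    p.comp r ≤ p.comp r' ↔ r ≤ r' := by
  obtain ⟨w, p⟩ := p
  obtain ⟨x, r⟩ := r
  obtain ⟨y, r'⟩ := r'
  simp only [Under.le_iff]
  constructor
  · rintro ⟨⟨z, s⟩, h⟩
    have hz : z = y := congrArg Sigma.fst h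
    subst hz
    refine ⟨⟨z, s⟩, ?_⟩
    have h' := eq_of_heq (Sigma.mk.inj h).2
    exact congrArg (Sigma.mk z) (Hom.cancel p _ _ ((Hom.comp_assoc p r s).symm.trans h'))
  · rintro ⟨⟨z, s⟩, h⟩
    have hz : z = y := congrArg Sigma.fst h
    subst hz
    have h' := eq_of_heq (Sigma.mk.inj h).2
    refine ⟨⟨z, s⟩, ?_⟩
    exact congrArg (Sigma.mk z) ((Hom.comp_assoc p r s).trans (congrArg (Hom.comp p) h'))

/-- A path starting at `v`, as an element of the algebra. -/
def Under.toAlg {v : V} (p : A.Under v) : A.Alg := Hom.toAlg p.2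

/-- For `q ≤ p`, the path `p / q` with `p = q (p / q)`, as an element of the algebra. -/
def Under.quot {v : V} (p q : A.Under v) : A.Alg :=
  if h : ∃ r : A.Under q.head, q.comp r = p then Under.toAlg h.choose else 1

theorem vertices_nodup (A : HPA k V) {v w : V} (p : Quiver.Path v w) : p.vertices.Nodup := by
  induction p with
  | nil => simp
  | cons p e ih =>
    rw [Quiver.Path.vertices_cons, List.concat_eq_append, List.nodup_append]
    refine ⟨ih, by simp, ?_⟩
    rintro a ha b hb rfl
    rw [List.mem_singleton] at hb
    subst hb
    obtain ⟨p1, p2, -⟩ := Quiver.Path.exists_eq_comp_of_mem_vertices p ha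
    have := A.acyclic _ (p2.cons e)
    simp at this

section Finite

variable [∀ v w : V, Finite (v ⟶ w)]

theorem finite_length_le (n : ℕ) (v w : V) : Finite {p : Quiver.Path v w // p.length ≤ n} := by
  induction n generalizing w with
  | zero =>
    refine Finite.of_injective (β := Unit) (fun _ => ()) ?_
    rintro ⟨p, hp⟩ ⟨q, hq⟩ -
    obtain rfl := Quiver.Path.eq_of_length_zero p (by omega)
    rw [Subtype.mk.injEq, Quiver.Path.eq_nil_of_length_zero p (by omega),
      Quiver.Path.eq_nil_of_length_zero q (by omega)]
  | succ n ih =>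
    refine Finite.of_surjective (α := {p : Quiver.Path v w // p.length ≤ n} ⊕
      (Σ u : V, {p : Quiver.Path v u // p.length ≤ n} × (u ⟶ w)))
      (Sum.elim (fun p => ⟨p.1, by have := p.2; omega⟩)
        (fun x => ⟨x.2.1.1.cons x.2.2, by
          have := x.2.1.2; rw [Quiver.Path.length_cons]; omega⟩)) ?_
    rintro ⟨p, hp⟩
    cases p with
    | nil => exact ⟨Sum.inl ⟨Quiver.Path.nil, by simp⟩, rfl⟩
    | cons p e =>
      rw [Quiver.Path.length_cons] at hp
      exact ⟨Sum.inr ⟨_, ⟨p, by omega⟩, e⟩, rfl⟩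

theorem finite_path (A : HPA k V) (v w : V) : Finite (Quiver.Path v w) := by
  have := finite_length_le (V := V) (Fintype.card V) v w
  refine Finite.of_injective (β := {p : Quiver.Path v w // p.length ≤ Fintype.card V})
    (fun p => ⟨p, ?_⟩) (fun p q h => by simpa using h)
  have h := (vertices_nodup A p).length_le_card
  rw [Quiver.Path.vertices_length] at h
  omega

instance (v w : V) : Finite (A.Hom v w) :=
  haveI := finite_path A v w
  inferInstanceAs (Finite (Quotient (A.pathSetoid v w)))

instance (v : V) : Finite (A.Under v) := inferInstanceAs (Finite (Σ w, A.Hom v w))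

end Finite

/-! ### The cells of the geometric realization -/

/-- A cell of the geometric realization `X_A` of `A`, given by its canonical representative
`[e_v < p_1 < ... < p_n]`: a starting vertex `v` and a finite chain of nonconstant paths starting at
`v`. -/
structure Cell (A : HPA k V) where
  /-- the vertex `v`, which is the starting point `t(η)` of the cell -/
  tail : V
  /-- the set `{p_1, ..., p_n}` -/
  chain : Finset (A.Under tail)
  isChain : IsChain (· ≤ ·) (chain : Set (A.Under tail))
  bot_notMem : ⊥ ∉ chain

namespace Cell

/-- The dimension of a cell. -/
def dim (η : A.Cell) : ℕ := η.chain.card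

/-- The path `p_1` (the constant path if `n = 0`). -/
def low (η : A.Cell) : A.Under η.tail :=
  if h : ∃ x, IsLeast (η.chain : Set (A.Under η.tail)) x then h.choose else ⊥

/-- The path `p_n` (the constant path if `n = 0`). -/
def top (η : A.Cell) : A.Under η.tail :=
  if h : ∃ x, IsGreatest (η.chain : Set (A.Under η.tail)) x then h.choose else ⊥

/-- The end point `h(η)` of the cell, i.e. the end point of `p_n`. -/
def head (η : A.Cell) : V := η.top.head

/-- The face `[e_v < ... < p_{i-1} < p_{i+1} < ...]`, for `p_i = q`. -/
def erase (η : A.Cell) (q : A.Under η.tail) : A.Cell where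
  tail := η.tail
  chain := η.chain.erase q
  isChain := η.isChain.mono (by simp)
  bot_notMem h := η.bot_notMem (Finset.mem_of_mem_erase h)

/-- The terminal facet `[e_v < p_1 < ... < p_{n-1}]`. -/
def terminalFacet (η : A.Cell) : A.Cell := η.erase η.top

/-- The path `p_n / p_{n-1}` (or `p_1`, if `n = 1`), as an element of the algebra. -/
def lastStep (η : A.Cell) : A.Alg := Under.quot η.top η.terminalFacet.top

variable [∀ v w : V, Finite (v ⟶ w)]

/-- The initial facet `[e_w < p_2 / p_1 < ... < p_n / p_1]`, where `w` is the end point of `p_1`. -/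
def initialFacet (η : A.Cell) : A.Cell where
  tail := η.low.head
  chain := (Set.toFinite {r : A.Under η.low.head | r ≠ ⊥ ∧ η.low.comp r ∈ η.chain}).toFinset
  isChain := by
    intro r hr r' hr' hne
    rw [Set.Finite.coe_toFinset] at hr hr'
    change r ≤ r' ∨ r' ≤ r
    rw [← Under.comp_le_comp_iff η.low r r', ← Under.comp_le_comp_iff η.low r' r]
    exact η.isChain.total hr.2 hr'.2
  bot_notMem := by simp

/-- `τ` is a facet of `η`. -/
def IsFacet (τ η : A.Cell) : Prop :=
  η.chain.Nonempty ∧ (τ = η.initialFacet ∨ ∃ q ∈ η.chain, τ = η.erase q)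

/-- The incidence number `[η : τ]`: the facet omitting the `i`-th vertex has the sign `(-1)^i`. -/
def incidence (η τ : A.Cell) : ℤ :=
  (if η.chain.Nonempty ∧ τ = η.initialFacet then 1 else 0) +
    ∑ q ∈ η.chain, if τ = η.erase q then (-1 : ℤ) ^ (η.chain.filter (· ≤ q)).card else 0

/-- The path which is split off on the left when passing from `η` to the facet `τ`: it is `p_1` for
the initial facet, and otherwise there is none. -/
def left (η τ : A.Cell) : A.Alg := if τ = η.initialFacet then η.low.toAlg else 1

/-- The path which is split off on the right when passing from `η` to the facet `τ`: it is
`p_n / p_{n-1}` for the terminal facet, and otherwise there is none. -/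
def right (η τ : A.Cell) : A.Alg := if τ = η.terminalFacet then η.lastStep else 1

end Cell

variable [∀ v w : V, Finite (v ⟶ w)]

instance : Finite A.Cell :=
  Finite.of_injective (β := Σ v, Finset (A.Under v)) (fun η => ⟨η.tail, η.chain⟩) (by
    rintro ⟨v, c, _, _⟩ ⟨w, d, _, _⟩ h
    obtain rfl : v = w := congrArg Sigma.fst h
    obtain rfl : c = d := eq_of_heq (Sigma.mk.inj h).2
    rfl)

/-! ### Matchings and gradient paths -/

/-- A cell is critical for a matching, given as a set of pairs (larger cell, smaller cell), if it is
unmatched. -/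
def IsCritical (M : Set (A.Cell × A.Cell)) (η : A.Cell) : Prop :=
  ∀ ρ, (η, ρ) ∉ M ∧ (ρ, η) ∉ M

/-- Alternating paths in the Hasse diagram from one cell to another cell of the same dimension: each
step goes down to a facet along an unmatched edge and then up along a matched edge. -/
inductive ZigZag (M : Set (A.Cell × A.Cell)) : A.Cell → A.Cell → Type _
  | nil (η : A.Cell) : ZigZag M η η
  | cons {η ω : A.Cell} (τ ρ : A.Cell) (facet : Cell.IsFacet τ η) (down : (η, τ) ∉ M)
      (up : (ρ, τ) ∈ M) (z : ZigZag M ρ ω) : ZigZag M η ω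

namespace ZigZag

variable {M : Set (A.Cell × A.Cell)}

/-- The multiplicity of an alternating path. -/
def sign : ∀ {η ω : A.Cell}, ZigZag M η ω → ℤ
  | _, _, nil _ => 1
  | η, _, cons τ ρ _ _ _ z => -(η.incidence τ * ρ.incidence τ) * z.sign

/-- The product of the paths split off on the left. -/
def left : ∀ {η ω : A.Cell}, ZigZag M η ω → A.Alg
  | _, _, nil _ => 1
  | η, _, cons τ _ _ _ _ z => η.left τ * z.left

/-- The product of the paths split off on the right. -/
def right : ∀ {η ω : A.Cell}, ZigZag M η ω → A.Alg
  | _, _, nil _ => 1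
  | η, _, cons τ _ _ _ _ z => z.right * η.right τ

end ZigZag

/-- A gradient path from `η` to a cell `ω` of dimension one less: an alternating path followed by a
step down along an unmatched edge. -/
structure GradientPath (M : Set (A.Cell × A.Cell)) (η ω : A.Cell) where
  mid : A.Cell
  zigzag : ZigZag M η mid
  facet : Cell.IsFacet ω mid
  down : (mid, ω) ∉ M

namespace GradientPath

variable {M : Set (A.Cell × A.Cell)} {η ω : A.Cell}

/-- The multiplicity `ε(γ)`. -/
def sign (γ : GradientPath M η ω) : ℤ := γ.zigzag.sign * γ.mid.incidence ω

/-- The left coefficient `l(γ)`. -/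
def left (γ : GradientPath M η ω) : A.Alg := γ.zigzag.left * γ.mid.left ω

/-- The right coefficient `r(γ)`. -/
def right (γ : GradientPath M η ω) : A.Alg := γ.mid.right ω * γ.zigzag.right

end GradientPath

/-! ### The Morse complex of bimodules -/

variable (A) in
/-- The enveloping algebra; its left modules are the `A`-bimodules. -/
abbrev Env : Type _ := A.Alg ⊗[k] A.Algᵐᵒᵖ

/-- The bimodule structure of `A`: `(a ⊗ b) • x = a x b`. -/
instance : Module A.Env A.Alg := TensorProduct.Algebra.module

variable (A) in
/-- The idempotent `e_v`. -/
def idem (v : V) : A.Alg := (Hom.id v : A.Hom v v).toAlg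

/-- The element `e_{t(η)} ⊗ e_{h(η)}`. -/
def gen (η : A.Cell) : A.Env := A.idem η.tail ⊗ₜ[k] op (A.idem η.head)

/-- The projective bimodule `P_η = A e_{t(η)} ⊗ e_{h(η)} A`, as the left ideal of the enveloping
algebra generated by the idempotent `e_{t(η)} ⊗ e_{h(η)}`. -/
def proj (η : A.Cell) : Submodule A.Env A.Env := Submodule.span A.Env {gen η}

/-- The bimodule map `P_η → P_ω` sending the generator `1 ⊗ [η] ⊗ 1` to `l ⊗ [ω] ⊗ r`. -/
def projMap (η ω : A.Cell) (l r : A.Alg) : proj η →ₗ[A.Env] proj ω :=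
  LinearMap.codRestrict (proj ω)
    ((LinearMap.toSpanSingleton A.Env A.Env ((l ⊗ₜ[k] op r) * gen ω)).comp (proj η).subtype)
    (fun _ => Submodule.smul_mem _ _
      (Submodule.smul_mem _ _ (Submodule.subset_span (Set.mem_singleton _))))

/-- The critical cells of dimension `n`. -/
def CritCell (M : Set (A.Cell × A.Cell)) (n : ℕ) : Type _ :=
  {η : A.Cell // η.dim = n ∧ IsCritical M η}

instance (M : Set (A.Cell × A.Cell)) (n : ℕ) : Fintype (CritCell M n) :=
  haveI : Finite (CritCell M n) :=
    inferInstanceAs (Finite {η : A.Cell // η.dim = n ∧ IsCritical M η})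
  Fintype.ofFinite _

/-- The terms of the Morse complex of bimodules: the sum of `P_η` over the critical `n`-cells. -/
abbrev MorseModule (M : Set (A.Cell × A.Cell)) (n : ℕ) : Type _ :=
  ⨁ η : CritCell M n, proj η.1

/-- The differential of the Morse complex of bimodules:
`1 ⊗ [η] ⊗ 1 ↦ ∑_ω ∑_γ ε(γ) l(γ) ⊗ [ω] ⊗ r(γ)`, where `ω` runs through the critical cells and `γ`
through the (finitely many, if the matching is acyclic) gradient paths from `η` to `ω`. -/
def morseDiff (M : Set (A.Cell × A.Cell)) (n : ℕ) :
    MorseModule M (n + 1) →ₗ[A.Env] MorseModule M n :=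
  DirectSum.toModule A.Env _ _ fun η => ∑ ω : CritCell M n,
    (DirectSum.lof A.Env (CritCell M n) (fun ω => proj ω.1) ω).comp
      (∑ᶠ γ : GradientPath M η.1 ω.1, γ.sign • projMap η.1 ω.1 γ.left γ.right)

/-- The augmentation to `A`, given by multiplication: `a ⊗ [e_v] ⊗ b ↦ a b`. -/
def augmentation (M : Set (A.Cell × A.Cell)) : MorseModule M 0 →ₗ[A.Env] A.Alg :=
  DirectSum.toModule A.Env _ _ fun η =>
    (LinearMap.toSpanSingleton A.Env A.Alg 1).comp (proj η.1).subtype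

/-- The Morse complex with its augmentation is a projective resolution of the bimodule `A`. -/
structure IsProjectiveResolution (M : Set (A.Cell × A.Cell)) : Prop where
  projective : ∀ n, Module.Projective A.Env (MorseModule M n)
  exact : ∀ n, Function.Exact (morseDiff M (n + 1)) (morseDiff M n)
  exact_zero : Function.Exact (morseDiff M 0) (augmentation M)
  surjective : Function.Surjective (augmentation M)

variable (A) in
/-- The two-sided ideal of the enveloping algebra generated by the arrows, acting on either side. -/
def arrowIdeal : TwoSidedIdeal A.Env :=
  TwoSidedIdeal.span {x | ∃ (v w : V) (a : v ⟶ w),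
    x = A.ofPath ⟨v, w, a.toPath⟩ ⊗ₜ[k] 1 ∨ x = 1 ⊗ₜ[k] op (A.ofPath ⟨v, w, a.toPath⟩)}

/-- The Morse complex is minimal: all components of its differential lie in the ideal generated by
the arrows. -/
def IsMinimal (M : Set (A.Cell × A.Cell)) : Prop :=
  ∀ (n : ℕ) (x : MorseModule M (n + 1)) (ω : CritCell M n),
    ((morseDiff M n x ω : proj ω.1) : A.Env) ∈ A.arrowIdeal

/-! ### Cellularity -/

variable (A) in
/-- The cells of dimension `n`. -/
def CellOfDim (n : ℕ) : Type _ := {η : A.Cell // η.dim = n}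

instance (n : ℕ) : Fintype (A.CellOfDim n) :=
  haveI : Finite (A.CellOfDim n) := inferInstanceAs (Finite {η : A.Cell // η.dim = n})
  Fintype.ofFinite _

variable (A) in
/-- The boundary map of the cellular chain complex of `X_A`. -/
def cellDiff (n : ℕ) : (A.CellOfDim (n + 1) →₀ ℤ) →ₗ[ℤ] (A.CellOfDim n →₀ ℤ) :=
  Finsupp.linearCombination ℤ fun η => ∑ τ : A.CellOfDim n,
    Finsupp.single τ (η.1.incidence τ.1)

/-- The boundary map of the discrete Morse complex on the critical cells, i.e. of the cellular chain
complex of the CW complex obtained from `X_A` by collapsing the matched cells: each gradient path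
from `η` to `ω` contributes its multiplicity to the incidence number of `η` and `ω`. -/
def critDiff (M : Set (A.Cell × A.Cell)) (n : ℕ) :
    (CritCell M (n + 1) →₀ ℤ) →ₗ[ℤ] (CritCell M n →₀ ℤ) :=
  Finsupp.linearCombination ℤ fun η => ∑ ω : CritCell M n,
    Finsupp.single ω (∑ᶠ γ : GradientPath M η.1 ω.1, γ.sign)

open CategoryTheory in
/-- The Morse complex of bimodules is cellular, supported on the collapsed complex: its terms are the
sums of the bimodules `P_η` over the cells of the collapsed complex and its differential is
obtained by attaching to each gradient path `γ` from `η` to `ω` the bimodule map `P_η → P_ω` given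
by `l(γ)` and `r(γ)`, with the multiplicity `ε(γ)` (this holds by construction); and the same cells
with the same multiplicities form a chain complex over `ℤ`, which is chain homotopy equivalent to
the cellular chain complex of `X_A`. -/
def IsCellular (M : Set (A.Cell × A.Cell)) : Prop :=
  ∃ (h : ∀ n, ModuleCat.ofHom (critDiff M (n + 1)) ≫ ModuleCat.ofHom (critDiff M n) = 0)
    (h' : ∀ n, ModuleCat.ofHom (A.cellDiff (n + 1)) ≫ ModuleCat.ofHom (A.cellDiff n) = 0),
    Nonempty (HomotopyEquiv
      (ChainComplex.of (fun n => ModuleCat.of ℤ (CritCell M n →₀ ℤ))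
        (fun n => ModuleCat.ofHom (critDiff M n)) h)
      (ChainComplex.of (fun n => ModuleCat.of ℤ (A.CellOfDim n →₀ ℤ))
        (fun n => ModuleCat.ofHom (A.cellDiff n)) h'))

/-! ### The Babson-Hersh matching on the geometric realization -/

/-- The open interval `(e_v, p)` in the path poset, for a path `p` starting at `v`. -/
abbrev Interval {v : V} (p : A.Under v) : Type _ := Set.Ioo (⊥ : A.Under v) p

/-- The cell `[e_v < σ < p]` for a simplex `σ` of the order complex of `(e_v, p)`. -/
def cellOf {v : V} (p : A.Under v) (hp : p ≠ ⊥) (σ : Simplex (Interval p)) : A.Cell where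
  tail := v
  chain := insert p (σ.1.map (Function.Embedding.subtype _))
  isChain := by
    rw [Finset.coe_insert]
    refine IsChain.insert ?_ ?_
    · intro x hx y hy hne
      simp only [Finset.coe_map, Set.mem_image] at hx hy
      obtain ⟨x, hx, rfl⟩ := hx
      obtain ⟨y, hy, rfl⟩ := hy
      exact σ.2 hx hy fun h => hne (congrArg _ h)
    · intro y hy _
      simp only [Finset.coe_map, Set.mem_image] at hy
      obtain ⟨y, hy, rfl⟩ := hy
      exact Or.inr y.2.2.le
  bot_notMem h := by
    rw [Finset.mem_insert, Finset.mem_map] at h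
    rcases h with h | ⟨y, _, h⟩
    · exact hp h.symm
    · exact absurd h (ne_of_gt y.2.1)

variable (A) in
/-- The choices on which the Babson-Hersh matching depends: for each path `p` a lexicographic order
on the maximal chains of `(e_{t(p)}, p)` and, if this interval is nonempty, a vertex of its order
complex that is not matched by the matching of Babson and Hersh. -/
structure BabsonHersh where
  order : ∀ {v : V} (p : A.Under v), LexOrder (Interval p)
  base : ∀ {v : V} (p : A.Under v), Nonempty (Interval p) → Interval p
  base_unmatched : ∀ {v : V} (p : A.Under v) (h : Nonempty (Interval p)),
    (order p).Unmatched (base p h)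

/-- The Babson-Hersh matching on the cells of `X_A`: it matches `[e < τ < p]` with `[e < σ < p]` if
`τ` and `σ` are matched in the order complex of `(e, p)`, and it matches `[e < t < p]` with
`[e < p]` for the chosen unmatched vertex `t`. -/
def BabsonHersh.matching (B : A.BabsonHersh) : Set (A.Cell × A.Cell) :=
  {x | ∃ (v : V) (p : A.Under v) (hp : p ≠ ⊥) (τ σ : Simplex (Interval p)),
    x = (cellOf p hp τ, cellOf p hp σ) ∧
    ((B.order p).Matched τ σ ∨
      ∃ h : Nonempty (Interval p), τ = vertex (B.base p h) ∧ σ.1 = ∅)}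

/-- The simplices `σ` with `n` vertices of the order complex of `(e, p)` such that `[e < σ < p]` is
critical for the Babson-Hersh matching. (The empty simplex, of degree `-1`, corresponds to
`[e < p]`.) -/
def BabsonHersh.CritSimplex (B : A.BabsonHersh) {v : V} (p : A.Under v) (hp : p ≠ ⊥) (n : ℕ) :
    Type _ :=
  {σ : {σ : Simplex (Interval p) // σ.1.card = n} // IsCritical B.matching (cellOf p hp σ.1)}

/-- For all nonconstant paths `p`, the reduced homology modules of the order complex of
`(e_{t(p)}, p)` are free over `k`, with bases that are indexed by the critical cells. -/
def BabsonHersh.HomologyFreeOnCriticalCells (B : A.BabsonHersh) : Prop :=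
  ∀ (v : V) (p : A.Under v) (hp : p ≠ ⊥) (n : ℕ),
    Nonempty (Module.Basis (B.CritSimplex p hp n) k (RedHomology k (Interval p) n))

instance {v : V} (p : A.Under v) (n : ℕ) :
    Fintype {σ : Simplex (Interval p) // σ.1.card = n} :=
  haveI : Finite (Simplex (Interval p)) :=
    inferInstanceAs (Finite {σ : Finset (Interval p) // IsChain (· ≤ ·) (σ : Set (Interval p))})
  Fintype.ofFinite _

/-- The chain which discrete Morse theory associates to a critical simplex `σ`: the sum of the
endpoints of all alternating paths starting at `σ`, with their multiplicities. -/
def BabsonHersh.morseChain (B : A.BabsonHersh) {v : V} (p : A.Under v) (hp : p ≠ ⊥) (n : ℕ)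
    (σ : B.CritSimplex p hp n) : RedChain k (Interval p) n :=
  ∑ τ : {τ : Simplex (Interval p) // τ.1.card = n},
    Finsupp.single τ
      ((∑ᶠ z : ZigZag B.matching (cellOf p hp σ.1.1) (cellOf p hp τ.1), z.sign : ℤ) : k)

/-- For all nonconstant paths `p`, the reduced homology modules of the order complex of
`(e_{t(p)}, p)` are free over `k`, and the critical cells form a basis of them: the chains associated
to the critical cells are cycles, and their homology classes form a basis. -/
def BabsonHersh.CriticalCellsFormBasis (B : A.BabsonHersh) : Prop :=
  ∀ (v : V) (p : A.Under v) (hp : p ≠ ⊥) (n : ℕ),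
    Module.Free k (RedHomology k (Interval p) n) ∧
    ∃ (hc : ∀ σ : B.CritSimplex p hp n, B.morseChain p hp n σ ∈ redCycles k (Interval p) n)
      (b : Module.Basis (B.CritSimplex p hp n) k (RedHomology k (Interval p) n)),
      ∀ σ, b σ = Submodule.Quotient.mk ⟨B.morseChain p hp n σ, hc σ⟩

variable (A) in
/-- `A` is graded by path length: `A` is the direct sum of its submodules `A_n`, where `A_n` is
spanned by the classes of the paths of length `n`. -/
def IsGradedByLength : Prop :=
  DirectSum.IsInternal fun n : ℕ =>
    Submodule.span k {x : A.Alg | ∃ p : PathOf V, p.2.2.length = n ∧ x = A.ofPath p}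

end

end HPA

/-! ### The matching of Babson and Hersh is acyclic -/

namespace OrderComplex

noncomputable section

open scoped Classical

variable {P : Type*} [PartialOrder P]

/-! Matched pairs of cells differ by an inner element of the chain, so a matched edge splits off no
path and carries the coefficient 1 or -1. The matched part of the bimodule differential is therefore
invertible on the matched cells, and algebraic discrete Morse theory applies to the bar-type complex
on all cells of `X_A`. It is carried out as a calculus in an arbitrary ring (`MorseDatum`): a
differential `d`, the inverse `v` of its matched part `dM` and the inverse `Z` of `1 + v (d - dM)`
yield an inclusion, a projection and a homotopy relating the big complex to the Morse complex.
Acyclicity of the matching makes the sum over alternating paths such a `Z` (`ZigZag.total_eq`,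
`zigzagSum_eq`, `mul_zigzagSum`). The same construction is used for three systems of weights on the
facets.

Acyclicity is `BabsonHersh.isMorseMatching`. Along an alternating path either the set of paths below
the top of the cell shrinks, or the path stays in one interval; there the first maximal chain
containing the simplex moves to an earlier one or, for a fixed chain, more of the lowest truncated
intervals are met in just their least elements (`LexOrder.height_lt`, `LexOrder.IsFirst.level_lt`).

With weights in the enveloping algebra, the big complex is exact by the contraction of the bar
resolution, which turns the left coefficient into a new first path (`contraction_spec`); exactness
passes to the Morse complex through inclusion and projection (`exists_morseDiff_eq`). With constant
weight 1 over the integers, the same data give the homotopy equivalence with the cellular complex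
(`IsMorseMatching.isCellular`).

With weights in `k` that vanish on the facets splitting off a path and are 1 on the inner ones, the
cells `[e < σ < p]` of a fixed `p` span, up to sign, the reduced simplicial chain complex of the
interval (`boundary_redToCells`). The Morse complex of bimodules is minimal if the Morse
differential with these weights vanishes, and minimality forces this vanishing within each interval.
If the homology is free on the critical cells, then the map from critical cells to homology is a
surjection between free modules of equal finite rank, hence injective over a Noetherian ring; as the
Morse differential maps to boundaries, it vanishes. Each degree needs the previous one, so this is
an induction (`diffZero_of_basis`). Conversely, once the Morse differential vanishes, the inclusion
sends the critical cells to cycles whose classes are a basis (`homMap_injective`,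
`homMap_surjective`). -/

theorem isLeast_of_least_eq_some {X : Finset P} {x : P} (h : least X = some x) :
    IsLeast (X : Set P) x := by
  unfold least at h
  split_ifs at h with h'
  obtain rfl := Option.some.inj h
  exact h'.choose_spec

/-- `F` is the first maximal chain that contains `σ`. -/
def LexOrder.IsFirst (o : LexOrder P) (F : Facet P) (σ : Finset P) : Prop :=
  σ ⊆ F.1 ∧ ∀ G, o.lt G F → ¬ σ ⊆ G.1

theorem LexOrder.trichotomy (o : LexOrder P) (F G : Facet P) : o.lt F G ∨ F = G ∨ o.lt G F := by
  have := o.isStrictTotalOrder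
  exact trichotomous_of o.lt F G

theorem LexOrder.irrefl (o : LexOrder P) (F : Facet P) : ¬ o.lt F F := by
  have := o.isStrictTotalOrder
  exact irrefl_of o.lt F

theorem LexOrder.trans (o : LexOrder P) {F G H : Facet P} (h : o.lt F G) (h' : o.lt G H) :
    o.lt F H := by
  have := o.isStrictTotalOrder
  exact trans_of o.lt h h'

theorem LexOrder.IsFirst.unique {o : LexOrder P} {F G : Facet P} {σ : Finset P}
    (hF : o.IsFirst F σ) (hG : o.IsFirst G σ) : F = G := by
  rcases o.trichotomy F G with h | h | h
  · exact absurd hF.1 (hG.2 F h)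
  · exact h
  · exact absurd hG.1 (hF.2 G h)

theorem LexOrder.IsFirst.mono {o : LexOrder P} {F : Facet P} {σ τ : Finset P}
    (hF : o.IsFirst F σ) (h : σ ⊆ τ) (h' : τ ⊆ F.1) : o.IsFirst F τ :=
  ⟨h', fun G hG hτ => hF.2 G hG (h.trans hτ)⟩

theorem Facet.total (F : Facet P) {x y : P} (hx : x ∈ F.1) (hy : y ∈ F.1) : x ≤ y ∨ y ≤ x :=
  F.2.isChain.total hx hy

theorem Facet.mem_of_comparable (F : Facet P) {x : P} (h : ∀ y ∈ F.1, x ≤ y ∨ y ≤ x) :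
    x ∈ F.1 := by
  have h1 : IsChain (· ≤ ·) (insert x (F.1 : Set P)) :=
    F.2.isChain.insert fun y hy _ => h y hy
  have h2 := F.2.2 h1 (Set.subset_insert _ _)
  have h3 : x ∈ (F.1 : Set P) := h2 ▸ Set.mem_insert _ _
  exact h3

theorem Facet.eq_of_subset {F G : Facet P} (h : F.1 ⊆ G.1) : F = G :=
  Subtype.ext (Finset.coe_injective (F.2.2 G.2.isChain (Finset.coe_subset.2 h)))

theorem LexOrder.mem_skipped {o : LexOrder P} {F : Facet P} {X : Finset P} :
    X ∈ o.skipped F ↔ Minimal (fun Y => ∃ G, o.lt G F ∧ Y = F.1 \ G.1) X := by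
  unfold LexOrder.skipped
  rw [Finset.mem_filter, Finset.mem_powerset, and_iff_right_iff_imp]
  rintro ⟨⟨G, -, rfl⟩, -⟩
  exact Finset.sdiff_subset

/-- A simplex missing `F \ G` would lie in the earlier chain `G`, and `F` would not be the first
chain containing it. -/
theorem LexOrder.IsFirst.inter_nonempty {o : LexOrder P} {F : Facet P} {σ X : Finset P}
    (hF : o.IsFirst F σ) (hX : X ∈ o.skipped F) : (σ ∩ X).Nonempty := by
  obtain ⟨⟨G, hG, rfl⟩, -⟩ := LexOrder.mem_skipped.1 hX
  obtain ⟨x, hx, hx'⟩ := Finset.not_subset.1 (hF.2 G hG)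
  exact ⟨x, by simp [hx, hx', hF.1 hx]⟩

/-- A chain that is interpolated from `G` below `z` and from `F` above `z`. -/
theorem Facet.splice (F G : Facet P) {z : P} (hzF : z ∈ F.1) (hzG : z ∈ G.1) :
    IsMaxChain (· ≤ ·) ((G.1.filter (· < z) ∪ F.1.filter (z ≤ ·) : Finset P) : Set P) := by
  have hchain : IsChain (· ≤ ·)
      ((G.1.filter (· < z) ∪ F.1.filter (z ≤ ·) : Finset P) : Set P) := by
    intro x hx y hy _
    simp only [Finset.coe_union, Finset.coe_filter, Set.mem_union, Set.mem_ofPred_eq] at hx hy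
    rcases hx with ⟨hx, hx'⟩ | ⟨hx, hx'⟩ <;> rcases hy with ⟨hy, hy'⟩ | ⟨hy, hy'⟩
    · exact G.total hx hy
    · exact Or.inl (hx'.le.trans hy')
    · exact Or.inr (hy'.le.trans hx')
    · exact F.total hx hy
  -- For maximality, an element comparable with the whole splice is comparable with all of `F` if it
  -- lies above `z`, and with all of `G` if it lies below: the missing part of that chain is on the
  -- other side of `z`.
  refine ⟨hchain, fun t ht hsub => hsub.antisymm fun x hx => ?_⟩
  have hz : z ∈ t := hsub (by simp [hzF])
  simp only [Finset.coe_union, Finset.coe_filter, Set.mem_union, Set.mem_ofPred_eq]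
  by_cases hxz : z ≤ x
  · refine Or.inr ⟨F.mem_of_comparable fun y hy => ?_, hxz⟩
    by_cases hyz : z ≤ y
    · exact ht.total hx (hsub (by simp [hy, hyz]))
    · exact Or.inr (((F.total hy hzF).resolve_right hyz).trans hxz)
  · have hxz' : x ≤ z := (ht.total hx hz).resolve_right hxz
    refine Or.inl ⟨G.mem_of_comparable fun y hy => ?_, lt_of_le_not_ge hxz' hxz⟩
    by_cases hyz : z ≤ y
    · exact Or.inl (hxz'.trans hyz)
    · have hyz' := (G.total hy hzG).resolve_right hyz
      exact ht.total hx (hsub (by simp [hy, lt_of_le_not_ge hyz' hyz]))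

/-- This is where the order has to be lexicographic. If `G` returned to `F` at `c` between two
skipped elements, one could follow `G` only up to its first return `z` and then stay in `F`. The new
chain leaves `F` in the same way as `G`, so it still precedes `F`, but it skips fewer elements,
against minimality. -/
theorem LexOrder.skipped_convex {o : LexOrder P} {F : Facet P} {X : Finset P}
    (hX : X ∈ o.skipped F) {a b c : P} (ha : a ∈ X) (hb : b ∈ X) (hc : c ∈ F.1)
    (hac : a ≤ c) (hcb : c ≤ b) : c ∈ X := by
  obtain ⟨⟨G, hG, rfl⟩, hmin⟩ := LexOrder.mem_skipped.1 hX
  rw [Finset.mem_sdiff] at ha hb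
  by_contra hcX
  have hcG : c ∈ G.1 := by simpa [hc] using hcX
  -- the lowest element of `F \ G`
  obtain ⟨x, hx, hxmin⟩ := Finset.exists_minimal (s := F.1 \ G.1) ⟨a, by simp [ha]⟩
  rw [Finset.mem_sdiff] at hx
  have hxle : ∀ y ∈ F.1, y ∉ G.1 → x ≤ y := fun y hy hy' =>
    (F.total hx.1 hy).elim id fun h => hxmin (by simp [hy, hy']) h
  have hbelow : ∀ y ∈ F.1, y < x → y ∈ G.1 := fun y hy hlt => by
    by_contra h
    exact absurd (hxle y hy h) hlt.not_ge
  have hxc : x ≤ c := (hxle a ha.1 ha.2).trans hac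
  have hxc' : x ≠ c := fun h => hx.2 (h ▸ hcG)
  -- the lowest common element above `x`
  obtain ⟨z, hz, hzmin⟩ := Finset.exists_minimal (s := (F.1 ∩ G.1).filter (x ≤ ·))
    ⟨c, by simp [hc, hcG, hxc]⟩
  simp only [Finset.mem_filter, Finset.mem_inter] at hz
  have hzle : ∀ y ∈ F.1, y ∈ G.1 → x ≤ y → z ≤ y := fun y hy hy' h =>
    (F.total hz.1.1 hy).elim id fun h' => hzmin (by simp [hy, hy', h]) h'
  have hxz : x < z := lt_of_le_of_ne hz.2 fun h => hx.2 (h ▸ hz.1.2)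
  -- the lowest element of `G \ F`
  obtain ⟨y, hy, hymin⟩ := Finset.exists_minimal (s := G.1 \ F.1)
    (Finset.sdiff_nonempty.2 fun h => o.irrefl F (by rwa [Facet.eq_of_subset h] at hG))
  rw [Finset.mem_sdiff] at hy
  have hyle : ∀ w ∈ G.1, w ∉ F.1 → y ≤ w := fun w hw hw' =>
    (G.total hy.1 hw).elim id fun h => hymin (by simp [hw, hw']) h
  -- elements of `G \ F` lie above the elements of `F` below `x`
  have hfy : ∀ f ∈ F.1, f < x → f < y := fun f hf hfx => by
    rcases G.total (hbelow f hf hfx) hy.1 with h | h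
    · exact lt_of_le_of_ne h fun h' => hy.2 (h' ▸ hf)
    · exact absurd (F.mem_of_comparable fun f' hf' => by
        by_cases hf'x : f' < x
        · exact G.total hy.1 (hbelow f' hf' hf'x)
        · exact Or.inl (h.trans (hfx.le.trans
            ((F.total hx.1 hf').elim id fun h' => by
              rcases h'.eq_or_lt with h' | h'
              · exact h'.ge
              · exact absurd h' hf'x)))) hy.2
  have hyz : y < z := by
    by_contra h
    have hzy : z ≤ y := (G.total hz.1.2 hy.1).elim id fun h' => by
      rcases h'.eq_or_lt with h' | h'
      · exact h'.ge
      · exact absurd h' h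
    refine hx.2 (G.mem_of_comparable fun w hw => ?_)
    by_cases hwF : w ∈ F.1
    · exact F.total hx.1 hwF
    · exact Or.inl (hxz.le.trans (hzy.trans (hyle w hw hwF)))
  have hfilter : F.1.filter (· < x) = G.1.filter (· < y) := by
    ext f
    simp only [Finset.mem_filter]
    constructor
    · rintro ⟨hf, hfx⟩
      exact ⟨hbelow f hf hfx, hfy f hf hfx⟩
    · rintro ⟨hf, hlt⟩
      have hfF : f ∈ F.1 := by
        by_contra h
        exact absurd (hyle f hf h) hlt.not_ge
      refine ⟨hfF, ?_⟩
      by_contra h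
      have hxf : x ≤ f := (F.total hx.1 hfF).elim id fun h' => by
        rcases h'.eq_or_lt with h' | h'
        · exact h'.ge
        · exact absurd h' h
      exact absurd ((hzle f hfF hf hxf).trans hlt.le) hyz.not_ge
  let G' : Facet P := ⟨_, F.splice G hz.1.1 hz.1.2⟩
  -- The chains first differ in `y` and `x`, and `G'` agrees with `G` up to `y` because `y < z`.
  have hlt : o.lt G' F := by
    refine o.lex G G' F F y x (fun h => hy.2 (h ▸ hx.1)) hy.1 ?_ hx.1 hx.1 hfilter.symm ?_ rfl hG
    · simp [G', hy.1, hyz]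
    · ext f
      simp only [G', Finset.mem_filter, Finset.mem_union]
      constructor
      · rintro ⟨⟨hf, -⟩ | ⟨-, hzf⟩, hfy⟩
        · exact ⟨hf, hfy⟩
        · exact absurd (hzf.trans hfy.le) hyz.not_ge
      · rintro ⟨hf, hfy⟩
        exact ⟨Or.inl ⟨hf, hfy.trans hyz⟩, hfy⟩
  have hsub : F.1 \ G'.1 ⊆ F.1 \ G.1 := by
    intro f hf
    simp only [G', Finset.mem_sdiff, Finset.mem_union, Finset.mem_filter, not_or, not_and] at hf ⊢
    refine ⟨hf.1, fun hfG => hf.1 |> fun hfF => ?_⟩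
    exact hf.2.2 hfF ((F.total hz.1.1 hfF).elim id fun h => by
      rcases h.eq_or_lt with h | h
      · exact h.ge
      · exact absurd h (hf.2.1 hfG))
  -- The element `b` lies above the return point `z`, hence in `G'`, although minimality would put
  -- it into `F \ G'`.
  have hbmem := hmin ⟨G', hlt, rfl⟩ hsub (Finset.mem_sdiff.2 hb)
  have hzb : z ≤ b := (hzle c hc hcG hxc).trans hcb
  simp [G', hb.1, hzb] at hbmem

/-- An antichain of nonempty convex subsets of a chain. -/
structure IsIntervalFamily (F : Finset P) (I : Finset (Finset P)) : Prop where
  subset : ∀ X ∈ I, X ⊆ F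
  nonempty : ∀ X ∈ I, X.Nonempty
  convex : ∀ X ∈ I, ∀ a ∈ X, ∀ b ∈ X, ∀ c ∈ F, a ≤ c → c ≤ b → c ∈ X
  antichain : ∀ X ∈ I, ∀ Y ∈ I, X ⊆ Y → X = Y

theorem LexOrder.isIntervalFamily_skipped (o : LexOrder P) (F : Facet P) :
    IsIntervalFamily F.1 (o.skipped F) where
  subset X hX := by
    obtain ⟨⟨G, hG, rfl⟩, -⟩ := LexOrder.mem_skipped.1 hX
    exact Finset.sdiff_subset
  nonempty X hX := by
    obtain ⟨⟨G, hG, rfl⟩, -⟩ := LexOrder.mem_skipped.1 hX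
    exact Finset.sdiff_nonempty.2 fun h => o.irrefl F (by rwa [← Facet.eq_of_subset h] at hG)
  convex X hX a ha b hb c hc hac hcb := LexOrder.skipped_convex hX ha hb hc hac hcb
  antichain X hX Y hY h :=
    h.antisymm ((LexOrder.mem_skipped.1 hY).2 (LexOrder.mem_skipped.1 hX).1 h)

/-! ### Truncation of families of intervals. -/

theorem lowestInterval_spec {F : Finset P} (hF : IsChain (· ≤ ·) (F : Set P))
    {I : Finset (Finset P)} (hI : IsIntervalFamily F I) (hne : I ≠ ∅) :
    lowestInterval I ∈ I ∧ ∃ x ∈ lowestInterval I, ∀ Y ∈ I, ∀ y ∈ Y, x ≤ y := by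
  have h : ∃ X ∈ I, ∃ x ∈ X, ∀ Y ∈ I, ∀ y ∈ Y, x ≤ y := by
    obtain ⟨X₀, hX₀⟩ := Finset.nonempty_iff_ne_empty.2 hne
    obtain ⟨x₀, hx₀⟩ := hI.nonempty X₀ hX₀
    obtain ⟨x, hx, hmin⟩ := Finset.exists_minimal (s := I.biUnion id)
      ⟨x₀, Finset.mem_biUnion.2 ⟨X₀, hX₀, hx₀⟩⟩
    obtain ⟨X, hX, hxX⟩ := Finset.mem_biUnion.1 hx
    refine ⟨X, hX, x, hxX, fun Y hY y hy => ?_⟩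
    exact (hF.total (hI.subset X hX hxX) (hI.subset Y hY hy)).elim id fun h =>
      hmin (Finset.mem_biUnion.2 ⟨Y, hY, hy⟩) h
  unfold lowestInterval
  rw [dif_pos h]
  exact h.choose_spec

/-- Two convex sets of a chain with the same least element are nested, which an antichain excludes.
-/
theorem notMem_of_ne_lowestInterval {F : Finset P} (hF : IsChain (· ≤ ·) (F : Set P))
    {I : Finset (Finset P)} (hI : IsIntervalFamily F I) {X Y : Finset P} (hX : X ∈ I) (hY : Y ∈ I)
    (hne : Y ≠ X) {x : P} (hx : x ∈ X) (hmin : ∀ Y ∈ I, ∀ y ∈ Y, x ≤ y) : x ∉ Y := by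
  intro hxY
  have h1 : ¬ X ⊆ Y := fun h => hne (hI.antichain X hX Y hY h).symm
  have h2 : ¬ Y ⊆ X := fun h => hne (hI.antichain Y hY X hX h)
  obtain ⟨a, ha, ha'⟩ := Finset.not_subset.1 h1
  obtain ⟨b, hb, hb'⟩ := Finset.not_subset.1 h2
  rcases hF.total (hI.subset X hX ha) (hI.subset Y hY hb) with h | h
  · exact ha' (hI.convex Y hY x hxY b hb a (hI.subset X hX ha) (hmin X hX a ha) h)
  · exact hb' (hI.convex X hX x hx a ha b (hI.subset Y hY hb) (hmin Y hY b hb) h)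

/-- The family that remains after a round of the truncation. -/
theorem IsIntervalFamily.truncate {F : Finset P} (hF : IsChain (· ≤ ·) (F : Set P))
    {I : Finset (Finset P)} (hI : IsIntervalFamily F I) (hne : I ≠ ∅) :
    IsIntervalFamily F (((I.erase (lowestInterval I)).image (· \ lowestInterval I)).filter
      fun Y => Minimal (· ∈ (I.erase (lowestInterval I)).image (· \ lowestInterval I)) Y) := by
  obtain ⟨hX, x, hx, hmin⟩ := lowestInterval_spec hF hI hne
  constructor
  · intro Z hZ
    obtain ⟨Y, hY, rfl⟩ := Finset.mem_image.1 (Finset.mem_filter.1 hZ).1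
    exact Finset.sdiff_subset.trans (hI.subset Y (Finset.mem_of_mem_erase hY))
  · intro Z hZ
    obtain ⟨Y, hY, rfl⟩ := Finset.mem_image.1 (Finset.mem_filter.1 hZ).1
    exact Finset.sdiff_nonempty.2 fun h =>
      (Finset.mem_erase.1 hY).1 (hI.antichain Y (Finset.mem_of_mem_erase hY) _ hX h)
  · intro Z hZ a ha b hb c hc hac hcb
    obtain ⟨Y, hY, rfl⟩ := Finset.mem_image.1 (Finset.mem_filter.1 hZ).1
    have hY' := Finset.mem_of_mem_erase hY
    simp only [Finset.mem_sdiff] at ha hb ⊢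
    -- Only an initial part of `Y` is removed: if `c` were in the lowest interval, so would be `a`,
    -- which lies between its least element and `c`.
    refine ⟨hI.convex Y hY' a ha.1 b hb.1 c hc hac hcb, fun hcX => ha.2 ?_⟩
    exact hI.convex _ hX x hx c hcX a (hI.subset Y hY' ha.1) (hmin Y hY' a ha.1) hac
  · intro Y hY Z hZ h
    exact h.antisymm ((Finset.mem_filter.1 hZ).2.2 (Finset.mem_filter.1 hY).1 h)

theorem subset_of_mem_truncation {F : Finset P} (hF : IsChain (· ≤ ·) (F : Set P)) (n : ℕ) :
    ∀ {I : Finset (Finset P)}, IsIntervalFamily F I → ∀ J ∈ truncation n I,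
      ∃ X ∈ I, J ⊆ X := by
  induction n with
  | zero => intro I _ J hJ; simp [truncation] at hJ
  | succ n ih =>
    intro I hI J hJ
    rw [truncation] at hJ
    split_ifs at hJ with hne
    · simp at hJ
    · rcases List.mem_cons.1 hJ with rfl | hJ
      · exact ⟨_, (lowestInterval_spec hF hI hne).1, subset_rfl⟩
      · obtain ⟨Z, hZ, hJZ⟩ := ih (hI.truncate hF hne) J hJ
        obtain ⟨Y, hY, rfl⟩ := Finset.mem_image.1 (Finset.mem_filter.1 hZ).1
        exact ⟨Y, Finset.mem_of_mem_erase hY, hJZ.trans Finset.sdiff_subset⟩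

theorem pairwise_disjoint_truncation {F : Finset P} (hF : IsChain (· ≤ ·) (F : Set P)) (n : ℕ) :
    ∀ {I : Finset (Finset P)}, IsIntervalFamily F I → (truncation n I).Pairwise Disjoint := by
  induction n with
  | zero => intro I _; simp [truncation]
  | succ n ih =>
    intro I hI
    rw [truncation]
    split_ifs with hne
    · simp
    · refine List.pairwise_cons.2 ⟨fun J hJ => ?_, ih (hI.truncate hF hne)⟩
      obtain ⟨Z, hZ, hJZ⟩ := subset_of_mem_truncation hF n (hI.truncate hF hne) J hJ
      obtain ⟨Y, hY, rfl⟩ := Finset.mem_image.1 (Finset.mem_filter.1 hZ).1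
      exact (Finset.sdiff_disjoint.mono_left hJZ).symm

/-- If `σ` meets the lowest interval only in its least element, then, as this element is in no other
interval, what `σ` has in common with another interval survives the truncation. Thus the first
truncated interval that is not met in just its least element is still met, and it contains an
element of `σ` other than its least one. -/
theorem inter_nonempty_of_truncation {F : Finset P} (hF : IsChain (· ≤ ·) (F : Set P))
    (σ : Finset P) (n : ℕ) :
    ∀ {I : Finset (Finset P)}, IsIntervalFamily F I → (∀ X ∈ I, (σ ∩ X).Nonempty) →
      ∀ {as bs : List (Finset P)} {J : Finset P}, truncation n I = as ++ J :: bs →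
        (∀ a ∈ as, ∃ x, IsLeast (a : Set P) x ∧ σ ∩ a = {x}) → (σ ∩ J).Nonempty := by
  induction n with
  | zero => intro I _ _ as bs J h; simp [truncation] at h
  | succ n ih =>
    intro I hI hσ as bs J h has
    rw [truncation] at h
    split_ifs at h with hne
    · simp at h
    obtain ⟨hX, x, hx, hmin⟩ := lowestInterval_spec hF hI hne
    cases as with
    | nil =>
      rw [List.nil_append, List.cons.injEq] at h
      exact h.1 ▸ hσ _ hX
    | cons a as =>
      rw [List.cons_append, List.cons.injEq] at h
      obtain ⟨rfl, h⟩ := h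
      refine ih (hI.truncate hF hne) ?_ h fun a ha => has a (List.mem_cons_of_mem _ ha)
      intro Z hZ
      obtain ⟨Y, hY, rfl⟩ := Finset.mem_image.1 (Finset.mem_filter.1 hZ).1
      rw [Finset.mem_erase] at hY
      obtain ⟨x', hx', hσx⟩ := has _ List.mem_cons_self
      obtain rfl : x = x' := le_antisymm (hmin _ hX x' hx'.1) (hx'.2 hx)
      obtain ⟨y, hy⟩ := hσ Y hY.2
      rw [Finset.mem_inter] at hy
      refine ⟨y, Finset.mem_inter.2 ⟨hy.1, Finset.mem_sdiff.2 ⟨hy.2, fun hyX => ?_⟩⟩⟩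
      have hyx : y ∈ ({x} : Finset P) := hσx ▸ Finset.mem_inter.2 ⟨hy.1, hyX⟩
      rw [Finset.mem_singleton] at hyx
      exact notMem_of_ne_lowestInterval hF hI hX hY.2 hY.1 hx hmin (hyx ▸ hy.2)

/-- `σ` meets `J` in just the lowest element of `J`. -/
def MeetsInLeast (σ J : Finset P) : Prop := ∃ x, IsLeast (J : Set P) x ∧ σ ∩ J = {x}

theorem meetsInLeast_of_inter_eq {σ σ' J : Finset P} (h : σ ∩ J = σ' ∩ J) :
    MeetsInLeast σ J ↔ MeetsInLeast σ' J := by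
  unfold MeetsInLeast; rw [h]

/-- The number of truncated intervals, from the lowest one on, that `σ` meets in just their least
element. -/
def LexOrder.level (o : LexOrder P) (F : Facet P) (σ : Finset P) : ℕ :=
  (o.truncated F).findIdx fun J => decide (¬ MeetsInLeast σ J)

theorem LexOrder.level_le (o : LexOrder P) (F : Facet P) (σ : Finset P) :
    o.level F σ ≤ (o.truncated F).length := List.findIdx_le_length

/-! ### The pivot and the level of a simplex. -/

theorem LexOrder.pivot_of_not_covered (o : LexOrder P) (F : Facet P) (σ : Finset P)
    (h : ∃ x ∈ F.1, ∀ X ∈ o.skipped F, x ∉ X) :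
    o.pivot F σ = least (F.1.filter fun x => ∀ X ∈ o.skipped F, x ∉ X) := by
  unfold LexOrder.pivot
  rw [if_pos h]

theorem LexOrder.pivot_of_append (o : LexOrder P) (F : Facet P) (σ : Finset P)
    (h : ¬ ∃ x ∈ F.1, ∀ X ∈ o.skipped F, x ∉ X) {as bs : List (Finset P)} {J : Finset P}
    (hJ : o.truncated F = as ++ J :: bs) (has : ∀ a ∈ as, MeetsInLeast σ a)
    (hb : ¬ MeetsInLeast σ J) : o.pivot F σ = least J := by
  unfold LexOrder.pivot
  rw [if_neg h]
  have : (o.truncated F).find?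
      (fun X : Finset P => decide (¬ ∃ x, IsLeast (X : Set P) x ∧ σ ∩ X = {x})) = some J := by
    rw [List.find?_eq_some_iff_append]
    refine ⟨by simpa [MeetsInLeast] using hb, as, bs, hJ, fun a ha => ?_⟩
    simpa [MeetsInLeast] using has a ha
  rw [this]

theorem LexOrder.pivot_of_forall (o : LexOrder P) (F : Facet P) (σ : Finset P)
    (h : ¬ ∃ x ∈ F.1, ∀ X ∈ o.skipped F, x ∉ X)
    (has : ∀ a ∈ o.truncated F, MeetsInLeast σ a) :
    o.pivot F σ = least (F.1.filter fun x => ∀ X ∈ o.truncated F, x ∉ X) := by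
  unfold LexOrder.pivot
  rw [if_neg h]
  have : (o.truncated F).find?
      (fun X : Finset P => decide (¬ ∃ x, IsLeast (X : Set P) x ∧ σ ∩ X = {x})) = none := by
    rw [List.find?_eq_none]
    intro a ha
    simpa [MeetsInLeast] using has a ha
  rw [this]

/-- Either all members of the list have the property, or there is a first one without it. -/
theorem forall_or_exists_first {α : Type*} (p : α → Prop) (l : List α) :
    (∀ a ∈ l, p a) ∨ ∃ as b bs, l = as ++ b :: bs ∧ (∀ a ∈ as, p a) ∧ ¬ p b := by
  induction l with
  | nil => simp
  | cons c l ih =>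
    by_cases hc : p c
    · rcases ih with h | ⟨as, b, bs, rfl, has, hb⟩
      · left; simpa [hc] using h
      · exact Or.inr ⟨c :: as, b, bs, rfl, by simpa [hc] using has, hb⟩
    · exact Or.inr ⟨[], c, l, rfl, by simp, hc⟩

theorem LexOrder.level_of_append (o : LexOrder P) (F : Facet P) (σ : Finset P)
    {as bs : List (Finset P)} {J : Finset P}
    (hJ : o.truncated F = as ++ J :: bs) (has : ∀ a ∈ as, MeetsInLeast σ a)
    (hb : ¬ MeetsInLeast σ J) : o.level F σ = as.length := by
  unfold LexOrder.level
  rw [hJ, List.findIdx_append, if_neg]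
  · simp [List.findIdx_cons, hb]
  · rw [List.findIdx_lt_length]
    rintro ⟨a, ha, h⟩
    simp [has a ha] at h

theorem LexOrder.lt_level_of_append (o : LexOrder P) (F : Facet P) (σ : Finset P)
    {as bs : List (Finset P)} {J : Finset P}
    (hJ : o.truncated F = as ++ J :: bs) (has : ∀ a ∈ as, MeetsInLeast σ a)
    (hb : MeetsInLeast σ J) : as.length < o.level F σ := by
  unfold LexOrder.level
  rw [hJ, List.findIdx_append, if_neg]
  · simp [List.findIdx_cons, hb]
  · rw [List.findIdx_lt_length]
    rintro ⟨a, ha, h⟩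
    simp [has a ha] at h

section First

variable {o : LexOrder P} {F : Facet P} {σ : Finset P}

theorem LexOrder.IsFirst.truncated_inter (hF : o.IsFirst F σ) {as bs : List (Finset P)}
    {J : Finset P} (hJ : o.truncated F = as ++ J :: bs) (has : ∀ a ∈ as, MeetsInLeast σ a) :
    (σ ∩ J).Nonempty :=
  inter_nonempty_of_truncation F.2.isChain σ _ (o.isIntervalFamily_skipped F)
    (fun _ hX => hF.inter_nonempty hX) hJ has

theorem LexOrder.disjoint_of_append {as bs : List (Finset P)} {J : Finset P}
    (hJ : o.truncated F = as ++ J :: bs) {a : Finset P} (ha : a ∈ as) : Disjoint a J := by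
  have h := pairwise_disjoint_truncation F.2.isChain (o.skipped F).card
    (o.isIntervalFamily_skipped F)
  change (o.truncated F).Pairwise _ at h
  rw [hJ, List.pairwise_append] at h
  exact h.2.2 a ha J List.mem_cons_self

theorem inter_insert_of_disjoint {α : Type*} {a J : Finset α} (h : Disjoint a J) {x : α}
    (hx : x ∈ J) (σ : Finset α) : σ ∩ a = insert x σ ∩ a := by
  rw [Finset.insert_inter_of_notMem fun hxa => Finset.disjoint_left.1 h hxa hx]

/-- Inserting the pivot leaves the intersections with the lower truncated intervals alone, since
these are disjoint from the pivot's interval. The pivot's interval remains a bad one: it already met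
`σ` in an element different from the pivot. -/
theorem LexOrder.IsFirst.pivot_insert (hF : o.IsFirst F σ) {x : P} (hx : x ∉ σ)
    (hpx : o.pivot F σ = some x) : o.pivot F (insert x σ) = some x := by
  by_cases h : ∃ x ∈ F.1, ∀ X ∈ o.skipped F, x ∉ X
  · rwa [o.pivot_of_not_covered F _ h] at hpx ⊢
  rcases forall_or_exists_first (MeetsInLeast σ) (o.truncated F) with h1 | ⟨as, J, bs, hJ, has, hb⟩
  · rw [o.pivot_of_forall F _ h h1] at hpx
    have hx' := (isLeast_of_least_eq_some hpx).1
    simp only [Finset.coe_filter, Set.mem_ofPred_eq] at hx'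
    rw [o.pivot_of_forall F _ h, hpx]
    intro a ha
    refine (meetsInLeast_of_inter_eq ?_).1 (h1 a ha)
    rw [Finset.insert_inter_of_notMem (hx'.2 a ha)]
  · rw [o.pivot_of_append F _ h hJ has hb] at hpx
    have hxJ := isLeast_of_least_eq_some hpx
    rw [o.pivot_of_append F _ h hJ, hpx]
    · intro a ha
      exact (meetsInLeast_of_inter_eq
        (inter_insert_of_disjoint (LexOrder.disjoint_of_append hJ ha) hxJ.1 σ)).1 (has a ha)
    · rintro ⟨y, hy, hy'⟩
      obtain ⟨z, hz⟩ := hF.truncated_inter hJ has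
      rw [Finset.mem_inter] at hz
      have h1 : x ∈ insert x σ ∩ J := by simpa using hxJ.1
      have h2 : z ∈ insert x σ ∩ J := by simp [hz]
      rw [hy', Finset.mem_singleton] at h1 h2
      exact hx (by rw [h1, ← h2]; exact hz.1)

/-- The core of acyclicity within one maximal chain. Deleting `q` cannot spoil an interval met in
just its least element: the intersection would become empty, which is impossible while `F` stays the
first chain. The pivot has to change, since the old one is still present while the new one is
absent. So the first bad interval of `ρ` has become good, and adding `y` does not touch it. -/
theorem LexOrder.IsFirst.level_lt {ρ : Finset P} {x q y : P} (hx : x ∈ ρ)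
    (hpx : o.pivot F ρ = some x) (hqx : q ≠ x) (hF : o.IsFirst F (ρ.erase q))
    (hpy : o.pivot F (ρ.erase q) = some y) (hy : y ∉ ρ.erase q) :
    o.level F ρ < o.level F (insert y (ρ.erase q)) := by
  have hxσ : x ∈ ρ.erase q := Finset.mem_erase.2 ⟨hqx.symm, hx⟩
  have hxy : o.pivot F (ρ.erase q) ≠ some x := fun h => by
    rw [hpy] at h
    exact hy (Option.some.inj h ▸ hxσ)
  -- If the skipped intervals leave part of `F` uncovered, the pivot depends on `F` only and could
  -- not change.
  have h : ¬ ∃ x ∈ F.1, ∀ X ∈ o.skipped F, x ∉ X := fun h => by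
    rw [o.pivot_of_not_covered F _ h] at hpx hxy
    exact hxy hpx
  -- an initial segment met by `ρ` in least elements is met so by `ρ \ q`
  have key : ∀ as bs, o.truncated F = as ++ bs → (∀ a ∈ as, MeetsInLeast ρ a) →
      ∀ a ∈ as, MeetsInLeast (ρ.erase q) a := by
    intro as bs hab has
    rcases forall_or_exists_first (MeetsInLeast (ρ.erase q)) as with h1 | ⟨cs, a, ds, rfl, hcs, ha⟩
    · exact h1
    exfalso
    have haρ := has a (by simp)
    have hqa : q ∈ a := by
      by_contra hqa
      refine ha ((meetsInLeast_of_inter_eq ?_).1 haρ)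
      rw [Finset.erase_inter, Finset.erase_eq_of_notMem]
      simp [hqa]
    obtain ⟨z, hz, hz'⟩ := haρ
    by_cases hqρ : q ∈ ρ
    · have hqz : q ∈ ρ ∩ a := Finset.mem_inter.2 ⟨hqρ, hqa⟩
      rw [hz', Finset.mem_singleton] at hqz
      obtain ⟨w, hw⟩ := hF.truncated_inter (as := cs) (J := a) (bs := ds ++ bs) (by simp [hab]) hcs
      rw [Finset.erase_inter, hz', hqz] at hw
      simp at hw
    · exact ha ⟨z, hz, by rw [Finset.erase_eq_of_notMem hqρ, hz']⟩
  rcases forall_or_exists_first (MeetsInLeast ρ) (o.truncated F) with h1 | ⟨as, J, bs, hJ, has, hb⟩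
  -- If `ρ` meets every truncated interval in its least element, then so does `ρ` without `q`, and
  -- both have the same pivot.
  · refine absurd ?_ hxy
    rw [o.pivot_of_forall F _ h (key _ [] (by simp) h1), ← o.pivot_of_forall F _ h h1, hpx]
  · have has' := key as (J :: bs) hJ has
    rw [o.level_of_append F ρ hJ has hb]
    rw [o.pivot_of_append F _ h hJ has hb] at hpx
    by_cases hJσ : MeetsInLeast (ρ.erase q) J
    -- The new pivot lies either in no truncated interval at all or in one that is not met in its
    -- least element; the intervals up to `J` are met so, and distinct intervals are disjoint.
    · have hyas : ∀ a ∈ as ++ [J], y ∉ a := by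
        intro a ha hya
        have hml : MeetsInLeast (ρ.erase q) a := by
          rcases List.mem_append.1 ha with ha | ha
          · exact has' a ha
          · rw [List.mem_singleton] at ha; exact ha ▸ hJσ
        rcases forall_or_exists_first (MeetsInLeast (ρ.erase q)) (o.truncated F) with
          h1 | ⟨cs, K, ds, hK, hcs, hKb⟩
        · rw [o.pivot_of_forall F _ h h1] at hpy
          have := (isLeast_of_least_eq_some hpy).1
          simp only [Finset.coe_filter, Set.mem_ofPred_eq] at this
          refine this.2 a ?_ hya
          rw [hJ]
          rcases List.mem_append.1 ha with ha | ha
          · simp [ha]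
          · simp_all
        · rw [o.pivot_of_append F _ h hK hcs hKb] at hpy
          have hyK := (isLeast_of_least_eq_some hpy).1
          have haK : a ≠ K := fun h => hKb (h ▸ hml)
          have hp := pairwise_disjoint_truncation F.2.isChain (o.skipped F).card
            (o.isIntervalFamily_skipped F)
          change (o.truncated F).Pairwise _ at hp
          have hsymm : Std.Symm (Disjoint : Finset P → Finset P → Prop) := ⟨fun _ _ h => h.symm⟩
          have haT : a ∈ o.truncated F := by
            rw [hJ]
            rcases List.mem_append.1 ha with ha | ha
            · simp [ha]
            · simp_all
          exact Finset.disjoint_left.1 (List.Pairwise.forall hp haT (by simp [hK]) haK) hya hyK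
      have hins : ∀ a ∈ as ++ [J], MeetsInLeast (ρ.erase q) a →
          MeetsInLeast (insert y (ρ.erase q)) a := fun a ha hm =>
        (meetsInLeast_of_inter_eq (by rw [Finset.insert_inter_of_notMem (hyas a ha)])).1 hm
      exact o.lt_level_of_append F _ hJ (fun a ha => hins a (by simp [ha]) (has' a ha))
        (hins J (by simp) hJσ)
    · rw [o.pivot_of_append F _ h hJ has' hJσ] at hxy
      exact absurd hpx hxy

end First

/-- Both members of a matched pair have the same first maximal chain and the same pivot. Toggling
the pivot is thus an involution, which gives the uniqueness statements that follow. -/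
theorem LexOrder.Matched.exists_first {o : LexOrder P} {τ σ : Simplex P} (h : o.Matched τ σ) :
    ∃ F x, o.IsFirst F σ.1 ∧ o.IsFirst F τ.1 ∧ o.pivot F σ.1 = some x ∧ o.pivot F τ.1 = some x ∧
      x ∉ σ.1 ∧ τ.1 = insert x σ.1 := by
  obtain ⟨-, F, hF, hF', x, hx, hpx, hτ⟩ := h
  have hfirst : o.IsFirst F σ.1 := ⟨hF, hF'⟩
  have hxτ := hfirst.pivot_insert hx hpx
  refine ⟨F, x, hfirst, hfirst.mono (hτ ▸ Finset.subset_insert _ _) ?_, hpx, hτ ▸ hxτ, hx, hτ⟩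
  rw [hτ, Finset.insert_subset_iff]
  refine ⟨?_, hF⟩
  have hle : ∀ J ∈ o.truncated F, J ⊆ F.1 := fun J hJ => by
    obtain ⟨X, hX, hJX⟩ := subset_of_mem_truncation F.2.isChain _ (o.isIntervalFamily_skipped F) J hJ
    exact hJX.trans ((o.isIntervalFamily_skipped F).subset X hX)
  by_cases h : ∃ x ∈ F.1, ∀ X ∈ o.skipped F, x ∉ X
  · rw [o.pivot_of_not_covered F _ h] at hpx
    have := (isLeast_of_least_eq_some hpx).1
    simp only [Finset.coe_filter, Set.mem_ofPred_eq] at this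
    exact this.1
  rcases forall_or_exists_first (MeetsInLeast σ.1) (o.truncated F) with
    h1 | ⟨as, J, bs, hJ, has, hb⟩
  · rw [o.pivot_of_forall F _ h h1] at hpx
    have := (isLeast_of_least_eq_some hpx).1
    simp only [Finset.coe_filter, Set.mem_ofPred_eq] at this
    exact this.1
  · rw [o.pivot_of_append F _ h hJ has hb] at hpx
    exact hle J (by simp [hJ]) (isLeast_of_least_eq_some hpx).1

theorem LexOrder.Matched.left_unique {o : LexOrder P} {τ τ' σ : Simplex P} (h : o.Matched τ σ)
    (h' : o.Matched τ' σ) : τ = τ' := by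
  obtain ⟨F, x, hF, -, hx, -, -, hτ⟩ := h.exists_first
  obtain ⟨F', x', hF', -, hx', -, -, hτ'⟩ := h'.exists_first
  obtain rfl := hF.unique hF'
  rw [hx] at hx'
  obtain rfl := Option.some.inj hx'
  exact Subtype.ext (hτ.trans hτ'.symm)

theorem LexOrder.Matched.right_unique {o : LexOrder P} {τ σ σ' : Simplex P} (h : o.Matched τ σ)
    (h' : o.Matched τ σ') : σ = σ' := by
  obtain ⟨F, x, -, hF, -, hx, hxσ, hτ⟩ := h.exists_first
  obtain ⟨F', x', -, hF', -, hx', hxσ', hτ'⟩ := h'.exists_first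
  obtain rfl := hF.unique hF'
  rw [hx] at hx'
  obtain rfl := Option.some.inj hx'
  refine Subtype.ext ?_
  rw [← Finset.erase_insert hxσ, ← Finset.erase_insert hxσ', ← hτ, ← hτ']

theorem LexOrder.Matched.not_matched {o : LexOrder P} {τ σ ρ : Simplex P} (h : o.Matched τ σ) :
    ¬ o.Matched ρ τ := by
  intro h'
  obtain ⟨F, x, -, hF, -, hx, hxσ, hτ⟩ := h.exists_first
  obtain ⟨F', x', hF', -, hx', -, hxσ', hτ'⟩ := h'.exists_first
  obtain rfl := hF.unique hF'
  rw [hx] at hx'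
  obtain rfl := Option.some.inj hx'
  exact hxσ' (by simp [hτ])

/-- A pair of numbers that decreases along alternating paths: the number of the first maximal chain
that contains the simplex, and the number of truncated intervals above its level. -/
def LexOrder.height (o : LexOrder P) (ρ : Finset P) : ℕ × ℕ :=
  if h : ∃ F, o.IsFirst F ρ then
    ({G | o.lt G h.choose}.ncard, (o.truncated h.choose).length - o.level h.choose ρ)
  else 0

theorem LexOrder.IsFirst.height_eq {o : LexOrder P} {F : Facet P} {ρ : Finset P}
    (h : o.IsFirst F ρ) :
    o.height ρ = ({G | o.lt G F}.ncard, (o.truncated F).length - o.level F ρ) := by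
  have hex : ∃ F, o.IsFirst F ρ := ⟨F, h⟩
  unfold LexOrder.height
  rw [dif_pos hex, hex.choose_spec.unique h]

/-- A face is contained in every chain that contains the simplex, so its first chain is the old one
or an earlier one. An earlier chain lowers the first component; for the same chain the level rises
and the second component drops. -/
theorem LexOrder.height_lt [Finite P] {o : LexOrder P} {ρ ρ' σ σ' : Simplex P}
    (h : o.Matched ρ σ) (h' : o.Matched ρ' σ') (hne : σ' ≠ σ) {q : P}
    (hσ' : σ'.1 = ρ.1.erase q) : Prod.Lex (· < ·) (· < ·) (o.height ρ'.1) (o.height ρ.1) := by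
  have hfin : Finite (Facet P) := inferInstanceAs (Finite {F : Finset P // _})
  obtain ⟨F, x, hFσ, hF, -, hx, hxσ, hτ⟩ := h.exists_first
  obtain ⟨F', x', hFσ', hF', hx', -, hxσ', hτ'⟩ := h'.exists_first
  rw [hF.height_eq, hF'.height_eq]
  rcases o.trichotomy F F' with hlt | rfl | hlt
  · exact absurd ((hσ' ▸ Finset.erase_subset _ _ : σ'.1 ⊆ ρ.1).trans hF.1) (hFσ'.2 F hlt)
  · refine Prod.Lex.right _ ?_
    have hqx : q ≠ x := by
      rintro rfl
      refine hne (Subtype.ext ?_)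
      rw [hσ', hτ, Finset.erase_insert hxσ]
    rw [hσ'] at hFσ' hx' hxσ' hτ'
    have := LexOrder.IsFirst.level_lt (by simp [hτ]) hx hqx hFσ' hx' hxσ'
    rw [← hτ'] at this
    have := o.level_le F ρ'.1
    omega
  · refine Prod.Lex.left _ _ (Set.ncard_lt_ncard ?_ (Set.toFinite _))
    refine ⟨fun G hG => o.trans hG hlt, fun hsub => o.irrefl F' (hsub hlt)⟩

end

end OrderComplex

/-! ### Algebraic discrete Morse theory in a ring -/

/-- A differential `d` in a ring, idempotents for the critical, the lower and the upper cells, the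
matched part `dM` of the differential with its inverse `v`, and the sum `Z` over all alternating
paths, which is inverse to `1 + v (d - dM)`. -/
structure MorseDatum (Λ : Type*) [Ring Λ] where
  (d eC eL eU dM v Z : Λ)
  d_sq : d * d = 0
  sum_eq : eC + eL + eU = 1
  eC_eC : eC * eC = eC
  eC_eU : eC * eU = 0
  eU_eC : eU * eC = 0
  eL_eC : eL * eC = 0
  eU_eL : eU * eL = 0
  eL_eU : eL * eU = 0
  eU_v : eU * v = v
  v_eL : v * eL = v
  v_dM : v * dM = eU
  dM_v : dM * v = eL
  Z_mul : Z * (1 + v * (d - dM)) = 1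
  mul_Z : (1 + v * (d - dM)) * Z = 1

namespace MorseDatum

variable {Λ : Type*} [Ring Λ] (m : MorseDatum Λ)

/-- The sum over alternating paths that go first up and then down. -/
def Z' : Λ := 1 - (m.d - m.dM) * m.Z * m.v

/-- The inclusion of the Morse complex. -/
def incl : Λ := m.Z * m.eC

/-- The projection to the Morse complex. -/
def proj : Λ := m.eC * m.Z'

/-- The homotopy. -/
def htpy : Λ := m.Z * m.v

/-- The differential of the Morse complex. -/
def diff : Λ := m.eC * m.d * m.Z * m.eC

theorem v_v : m.v * m.v = 0 := by
  rw [← m.v_eL, mul_assoc, ← m.eU_v, ← mul_assoc m.eL, ← mul_assoc m.eL, m.eL_eU]; simp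

theorem eC_v : m.eC * m.v = 0 := by rw [← m.eU_v, ← mul_assoc, m.eC_eU, zero_mul]

theorem v_eC : m.v * m.eC = 0 := by rw [← m.v_eL, mul_assoc, m.eL_eC, mul_zero]

theorem v_d : m.v * m.d = (1 + m.v * (m.d - m.dM)) - 1 + m.eU := by
  rw [mul_sub, m.v_dM]; abel

theorem d_v : m.d * m.v = (m.d - m.dM) * m.v + m.eL := by
  rw [sub_mul, m.dM_v]; abel

theorem Z_eq : m.Z = 1 - m.v * (m.d - m.dM) * m.Z := by
  have h := m.mul_Z
  rw [add_mul, one_mul] at h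
  exact eq_sub_of_add_eq h

theorem Z_eq' : m.Z = 1 - m.Z * (m.v * (m.d - m.dM)) := by
  have h := m.Z_mul
  rw [mul_add, mul_one] at h
  exact eq_sub_of_add_eq h

/-- Writing `v d` in terms of `1 + v (d - dM)` lets `Z` cancel. -/
theorem htpy_d : m.htpy * m.d = 1 - m.Z * (1 - m.eU) := by
  rw [htpy, mul_assoc, m.v_d, mul_add, mul_sub, m.Z_mul, mul_sub]; simp; abel

theorem htpy_eq : m.htpy = m.v * m.Z' := by
  rw [htpy, Z', mul_sub, mul_one]
  nth_rw 1 [m.Z_eq]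
  rw [sub_mul, one_mul]
  simp only [mul_assoc]

theorem d_htpy : m.d * m.htpy = 1 - (1 - m.eL) * m.Z' := by
  -- This is the formula `(1 + ab)⁻¹ = 1 - a (1 + ba)⁻¹ b` for `a = d - dM` and `b = v`.
  have h : (1 + (m.d - m.dM) * m.v) * m.Z' = 1 := by
    have h := m.mul_Z
    have h2 : (m.d - m.dM) * ((1 + m.v * (m.d - m.dM)) * m.Z) * m.v = (m.d - m.dM) * m.v := by
      rw [h, mul_one]
    rw [Z']
    calc (1 + (m.d - m.dM) * m.v) * (1 - (m.d - m.dM) * m.Z * m.v)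
        = 1 + (m.d - m.dM) * m.v -
          (m.d - m.dM) * ((1 + m.v * (m.d - m.dM)) * m.Z) * m.v := by noncomm_ring
      _ = 1 := by rw [h2]; abel
  rw [htpy_eq, ← mul_assoc, m.d_v]
  rw [add_mul, one_mul] at h
  have h3 : (m.d - m.dM) * m.v * m.Z' = 1 - m.Z' := eq_sub_of_add_eq' h
  rw [add_mul, h3]; noncomm_ring

/-- Since `d² = 0`, the product `(1 - hd)(1 - dh)` equals `1 - (dh + hd)`. The factors are `Z (1 -
eU)` and `(1 - eL) Z'`, and `(1 - eU)(1 - eL)` is the critical idempotent. -/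
theorem incl_proj_eq : 1 - m.incl * m.proj = m.d * m.htpy + m.htpy * m.d := by
  have h1 : (m.htpy * m.d) * (m.d * m.htpy) = 0 := by
    rw [mul_assoc, ← mul_assoc m.d, m.d_sq]; simp
  have h2 : (1 - m.htpy * m.d) * (1 - m.d * m.htpy) = 1 - (m.d * m.htpy + m.htpy * m.d) := by
    rw [sub_mul, mul_sub, mul_sub, h1]; simp; abel
  have h3 : (1 - m.eU) * (1 - m.eL) = m.eC := by
    rw [sub_mul, mul_sub, mul_sub, m.eU_eL, eq_sub_of_add_eq (eq_sub_of_add_eq m.sum_eq)]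
    noncomm_ring
  have h4 : m.incl * m.proj = (1 - m.htpy * m.d) * (1 - m.d * m.htpy) := by
    rw [m.htpy_d, m.d_htpy, incl, proj, sub_sub_cancel, sub_sub_cancel,
      mul_assoc m.Z, mul_assoc m.Z, ← mul_assoc (1 - m.eU), h3, ← mul_assoc m.eC, m.eC_eC]
  rw [h4, h2, sub_sub_cancel]

theorem proj_incl : m.proj * m.incl = m.eC := by
  have h1 : m.Z' * m.v = m.v := by rw [Z', sub_mul, mul_assoc _ m.v, m.v_v]; simp
  rw [proj, incl]
  have h2 : m.eC * m.Z' * (m.Z * m.eC) = m.eC * (m.Z' * m.Z) * m.eC := by noncomm_ring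
  have h3 : m.Z' * m.Z = m.Z' - m.Z' * m.v * ((m.d - m.dM) * m.Z) := by
    nth_rw 1 [m.Z_eq]; noncomm_ring
  rw [h2, h3, h1, mul_sub, ← mul_assoc m.eC m.v, m.eC_v, zero_mul, sub_zero, Z', mul_sub, sub_mul,
    mul_one, m.eC_eC, mul_assoc m.eC, mul_assoc _ m.v, m.v_eC]
  simp

theorem diff_eq : m.diff = m.proj * m.d * m.incl := by
  -- The corrections in `Z` have `v` as their leftmost factor, so they land in the upper cells.
  -- Hence `v d Z` collapses to `eU`, which kills `eC`.
  have h1 : m.v * m.d * m.incl = 0 := by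
    rw [incl, ← mul_assoc, m.v_d, add_mul, sub_mul, m.mul_Z, one_mul]
    have h2 : m.eU * m.Z = m.Z - (m.eC + m.eL) * m.Z := by
      rw [← sub_eq_of_eq_add' m.sum_eq.symm]; noncomm_ring
    have h3 : (m.eC + m.eL) * m.v = 0 := by
      rw [← m.eU_v, ← mul_assoc, add_mul, m.eC_eU, m.eL_eU]; simp
    have h4 : (m.eC + m.eL) * m.Z = m.eC + m.eL := by
      rw [m.Z_eq, mul_sub, mul_assoc m.v, ← mul_assoc _ m.v, h3]; simp
    rw [h2, h4]
    have h5 : 1 - m.Z + (m.Z - (m.eC + m.eL)) = m.eU := by rw [← m.sum_eq]; abel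
    rw [h5, m.eU_eC]
  rw [proj, Z', mul_sub, sub_mul, sub_mul, mul_one]
  have h6 : m.eC * ((m.d - m.dM) * m.Z * m.v) * m.d * m.incl =
      m.eC * ((m.d - m.dM) * m.Z) * (m.v * m.d * m.incl) := by noncomm_ring
  rw [h6, h1, mul_zero, sub_zero, incl, diff]; noncomm_ring

/-- The idempotent `incl * proj` is 1 minus the anticommutator of `d` with the homotopy, so it
commutes with `d`. That the inclusion and the projection are chain maps follows formally. -/
theorem d_incl_proj : m.d * (m.incl * m.proj) = m.incl * m.proj * m.d := by
  have h : m.incl * m.proj = 1 - (m.d * m.htpy + m.htpy * m.d) := by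
    rw [← m.incl_proj_eq, sub_sub_cancel]
  rw [h]
  have h1 : m.d * (1 - (m.d * m.htpy + m.htpy * m.d)) =
    m.d - (m.d * m.d) * m.htpy - m.d * m.htpy * m.d := by noncomm_ring
  have h2 : (1 - (m.d * m.htpy + m.htpy * m.d)) * m.d =
    m.d - m.htpy * (m.d * m.d) - m.d * m.htpy * m.d := by noncomm_ring
  rw [h1, h2, m.d_sq]; simp

theorem incl_eC : m.incl * m.eC = m.incl := by rw [incl, mul_assoc, m.eC_eC]

theorem eC_proj : m.eC * m.proj = m.proj := by rw [proj, ← mul_assoc, m.eC_eC]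

theorem d_incl : m.d * m.incl = m.incl * m.diff := by
  have h : m.d * (m.incl * m.proj) * m.incl = m.incl * m.proj * m.d * m.incl := by
    rw [m.d_incl_proj]
  rw [mul_assoc, mul_assoc m.incl, m.proj_incl, m.incl_eC] at h
  rw [h, m.diff_eq]; noncomm_ring

theorem proj_d : m.proj * m.d = m.diff * m.proj := by
  have h : m.proj * (m.d * (m.incl * m.proj)) = m.proj * (m.incl * m.proj * m.d) := by
    rw [m.d_incl_proj]
  rw [← mul_assoc, ← mul_assoc m.proj (m.incl * m.proj), ← mul_assoc m.proj m.incl, m.proj_incl,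
    m.eC_proj] at h
  rw [← h, m.diff_eq]; noncomm_ring

theorem diff_sq : m.diff * m.diff = 0 := by
  calc m.diff * m.diff = m.proj * m.d * (m.incl * m.diff) := by
        nth_rw 1 [m.diff_eq]; noncomm_ring
    _ = m.proj * (m.d * m.d) * m.incl := by rw [← m.d_incl]; noncomm_ring
    _ = 0 := by rw [m.d_sq]; simp

theorem eC_diff : m.eC * m.diff = m.diff := by
  rw [diff, ← mul_assoc, ← mul_assoc, ← mul_assoc, m.eC_eC]

end MorseDatum

/-! ### Facets of cells -/

namespace HPA

noncomputable section

open scoped Classical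
open PathAlgebra OrderComplex MulOpposite

variable {k V : Type*} [CommRing k] [Quiver V] [Fintype V] {A : HPA k V}

theorem Under.eq_bot_of_head_eq {v : V} {p : A.Under v} (h : p.head = v) : p = ⊥ := by
  obtain ⟨w, p⟩ := p
  obtain rfl : w = v := h
  exact congrArg (Sigma.mk w) (Hom.eq_id w p)

theorem Under.head_ne {v : V} {p : A.Under v} (h : p ≠ ⊥) : p.head ≠ v :=
  fun h' => h (Under.eq_bot_of_head_eq h')

namespace Cell

theorem ext_chain {v : V} {c d : Finset (A.Under v)} {hc hc' hd hd'} :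
    (⟨v, c, hc, hc'⟩ : A.Cell) = ⟨v, d, hd, hd'⟩ ↔ c = d := by
  simp

theorem isLeast_low {η : A.Cell} (h : η.chain.Nonempty) :
    IsLeast (η.chain : Set (A.Under η.tail)) η.low := by
  have h' : ∃ x, IsLeast (η.chain : Set (A.Under η.tail)) x := by
    obtain ⟨x, hx, hmin⟩ := Finset.exists_minimal h
    exact ⟨x, hx, fun y hy => (η.isChain.total hx hy).elim id fun h => hmin hy h⟩
  unfold low
  rw [dif_pos h']
  exact h'.choose_spec

theorem isGreatest_top {η : A.Cell} (h : η.chain.Nonempty) :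
    IsGreatest (η.chain : Set (A.Under η.tail)) η.top := by
  have h' : ∃ x, IsGreatest (η.chain : Set (A.Under η.tail)) x := by
    obtain ⟨x, hx, hmax⟩ := Finset.exists_maximal h
    exact ⟨x, hx, fun y hy => (η.isChain.total hy hx).elim id fun h => hmax hy h⟩
  unfold top
  rw [dif_pos h']
  exact h'.choose_spec

theorem low_eq {η : A.Cell} {p : A.Under η.tail}
    (h : IsLeast (η.chain : Set (A.Under η.tail)) p) : η.low = p :=
  (isLeast_low ⟨p, h.1⟩).unique h

theorem top_eq {η : A.Cell} {p : A.Under η.tail}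
    (h : IsGreatest (η.chain : Set (A.Under η.tail)) p) : η.top = p :=
  (isGreatest_top ⟨p, h.1⟩).unique h

theorem top_of_empty {η : A.Cell} (h : η.chain = ∅) : η.top = ⊥ := by
  unfold top
  rw [dif_neg]
  rintro ⟨x, hx, -⟩
  simp [h] at hx

theorem ne_bot_of_mem {η : A.Cell} {q : A.Under η.tail} (h : q ∈ η.chain) : q ≠ ⊥ :=
  fun h' => η.bot_notMem (h' ▸ h)

theorem erase_injOn {η : A.Cell} {q q' : A.Under η.tail} (hq : q ∈ η.chain)
    (h : η.erase q = η.erase q') : q = q' := by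
  have h' : η.chain.erase q = η.chain.erase q' := ext_chain.1 h
  by_contra hne
  have : q ∈ η.chain.erase q' := Finset.mem_erase.2 ⟨hne, hq⟩
  rw [← h'] at this
  simp at this

theorem top_erase {η : A.Cell} {q : A.Under η.tail} (hq : q ≠ η.top) :
    (η.erase q).top = η.top := by
  rcases η.chain.eq_empty_or_nonempty with h | h
  · rw [top_of_empty h]
    exact top_of_empty (show η.chain.erase q = ∅ by rw [h]; rfl)
  · have := isGreatest_top h
    refine top_eq ⟨?_, ?_⟩
    · exact Finset.mem_coe.2 (Finset.mem_erase.2 ⟨hq.symm, this.1⟩)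
    · intro y hy
      exact this.2 (Finset.mem_of_mem_erase hy)

variable [∀ v w : V, Finite (v ⟶ w)]

/-- The quiver is acyclic, so a nonconstant path ends at a new vertex. The initial facet is
therefore never one of the others, and no two contributions to an incidence number can cancel. -/
theorem tail_initialFacet_ne {η : A.Cell} (h : η.chain.Nonempty) :
    η.initialFacet.tail ≠ η.tail :=
  Under.head_ne (ne_bot_of_mem (isLeast_low h).1)

theorem erase_ne_initialFacet {η : A.Cell} (h : η.chain.Nonempty) (q : A.Under η.tail) :
    η.erase q ≠ η.initialFacet :=
  fun h' => tail_initialFacet_ne h (congrArg tail h').symm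

theorem incidence_initialFacet {η : A.Cell} (h : η.chain.Nonempty) :
    η.incidence η.initialFacet = 1 := by
  unfold incidence
  rw [if_pos ⟨h, rfl⟩, Finset.sum_eq_zero, add_zero]
  intro q _
  rw [if_neg (erase_ne_initialFacet h q).symm]

theorem incidence_erase {η : A.Cell} {q : A.Under η.tail} (hq : q ∈ η.chain) :
    η.incidence (η.erase q) = (-1) ^ (η.chain.filter (· ≤ q)).card := by
  unfold incidence
  rw [if_neg fun h => erase_ne_initialFacet ⟨q, hq⟩ q h.2, zero_add, Finset.sum_eq_single q]
  · simp
  · intro q' _ hne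
    rw [if_neg fun h => hne (erase_injOn hq h).symm]
  · exact fun h => absurd hq h

theorem incidence_eq_zero {η τ : A.Cell} (h : ¬ τ.IsFacet η) : η.incidence τ = 0 := by
  unfold incidence
  rw [if_neg fun h' => h ⟨h'.1, Or.inl h'.2⟩, zero_add]
  refine Finset.sum_eq_zero fun q hq => ?_
  rw [if_neg fun h' => h ⟨⟨q, hq⟩, Or.inr ⟨q, hq, h'⟩⟩]

theorem IsFacet.dim_eq {η τ : A.Cell} (h : τ.IsFacet η) : η.dim = τ.dim + 1 := by
  obtain ⟨hne, rfl | ⟨q, hq, rfl⟩⟩ := h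
  · have hmin := isLeast_low hne
    -- Multiplication by `p_1` is a bijection from the chain of the initial facet to the old chain
    -- without `p_1`.
    have himg : η.initialFacet.chain.image (fun r => η.low.comp r) = η.chain.erase η.low := by
      ext s
      simp only [initialFacet, Finset.mem_image, Set.Finite.mem_toFinset, Finset.mem_erase]
      constructor
      · rintro ⟨r, ⟨hr, hr'⟩, rfl⟩
        refine ⟨fun h => hr ?_, hr'⟩
        have h2 : η.low.comp r ≤ η.low.comp ⊥ := by
          rw [h]; exact ⟨⊥, rfl⟩
        exact le_bot_iff.1 ((Under.comp_le_comp_iff _ _ _).1 h2)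
      · rintro ⟨hs, hs'⟩
        obtain ⟨r, rfl⟩ := hmin.2 hs'
        refine ⟨r, ⟨fun h => hs ?_, hs'⟩, rfl⟩
        rw [h]
        exact congrArg (Sigma.mk _) (Hom.comp_id _)
    have hcard := congrArg Finset.card himg
    have hinj : Function.Injective fun r : A.Under η.low.head => η.low.comp r := fun r r' h =>
      le_antisymm ((Under.comp_le_comp_iff _ _ _).1 h.le) ((Under.comp_le_comp_iff _ _ _).1 h.ge)
    have hcard' := Finset.card_image_of_injective η.initialFacet.chain hinj
    rw [Finset.card_erase_of_mem hmin.1] at hcard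
    have := Finset.card_pos.2 hne
    exact (Nat.sub_eq_iff_eq_add this).1 (hcard.symm.trans hcard')
  · have := Finset.card_pos.2 hne
    unfold dim
    change _ = (η.chain.erase q).card + 1
    rw [Finset.card_erase_of_mem hq]
    omega

end Cell

variable [∀ v w : V, Finite (v ⟶ w)]

instance : Fintype A.Cell := Fintype.ofFinite _

/-! ### Matchings and sums over alternating paths -/

/-- An acyclic matching on the cells of `X_A` along inner facets. -/
structure IsMorseMatching (M : Set (A.Cell × A.Cell)) : Prop where
  inner : ∀ {ρ τ : A.Cell}, (ρ, τ) ∈ M → ∃ q ∈ ρ.chain, q ≠ ρ.top ∧ τ = ρ.erase q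
  left_unique : ∀ {ρ ρ' τ : A.Cell}, (ρ, τ) ∈ M → (ρ', τ) ∈ M → ρ = ρ'
  right_unique : ∀ {ρ τ τ' : A.Cell}, (ρ, τ) ∈ M → (ρ, τ') ∈ M → τ = τ'
  not_both : ∀ {ρ τ ω : A.Cell}, (ρ, τ) ∈ M → (τ, ω) ∉ M
  wf : WellFounded fun ρ η : A.Cell =>
    ∃ τ : A.Cell, τ.IsFacet η ∧ (η, τ) ∉ M ∧ (ρ, τ) ∈ M

namespace IsMorseMatching

variable {M : Set (A.Cell × A.Cell)}

theorem isFacet (hM : IsMorseMatching M) {ρ τ : A.Cell} (h : (ρ, τ) ∈ M) : τ.IsFacet ρ := by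
  obtain ⟨q, hq, -, rfl⟩ := hM.inner h
  exact ⟨⟨q, hq⟩, Or.inr ⟨q, hq, rfl⟩⟩

theorem incidence_mul_self (hM : IsMorseMatching M) {ρ τ : A.Cell} (h : (ρ, τ) ∈ M) :
    ρ.incidence τ * ρ.incidence τ = 1 := by
  obtain ⟨q, hq, -, rfl⟩ := hM.inner h
  rw [Cell.incidence_erase hq, ← pow_add]
  exact Even.neg_one_pow ⟨_, rfl⟩

theorem dim_eq (hM : IsMorseMatching M) {ρ τ : A.Cell} (h : (ρ, τ) ∈ M) :
    ρ.dim = τ.dim + 1 := (hM.isFacet h).dim_eq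

end IsMorseMatching

namespace ZigZag

variable {M : Set (A.Cell × A.Cell)} {R : Type*} [Ring R]

/-- The product of the weights of the steps down. -/
def weight (w : A.Cell → A.Cell → R) : ∀ {η ω : A.Cell}, ZigZag M η ω → R
  | _, _, nil _ => 1
  | η, _, cons τ _ _ _ _ z => w η τ * z.weight w

/-- The data of a step of an alternating path that starts at `η`. -/
abbrev Step (M : Set (A.Cell × A.Cell)) (η : A.Cell) : Type _ :=
  {x : A.Cell × A.Cell // x.1.IsFacet η ∧ (η, x.1) ∉ M ∧ (x.2, x.1) ∈ M}

/-- An alternating path is trivial, or has a first step. -/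
def equivSum (η ω : A.Cell) :
    ZigZag M η ω ≃ PLift (η = ω) ⊕ Σ x : Step M η, ZigZag M x.1.2 ω where
  toFun z := match z with
    | nil _ => Sum.inl ⟨rfl⟩
    | cons τ ρ facet down up z => Sum.inr ⟨⟨(τ, ρ), facet, down, up⟩, z⟩
  invFun s := match s with
    | Sum.inl h => h.down ▸ nil η
    | Sum.inr x => cons x.1.1.1 x.1.1.2 x.1.2.1 x.1.2.2.1 x.1.2.2.2 x.2
  left_inv z := by cases z <;> rfl
  right_inv s := by
    rcases s with ⟨⟨h⟩⟩ | ⟨⟨⟨τ, ρ⟩, h⟩, z⟩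
    · subst h; rfl
    · rfl

/-- By well-founded induction over the first step. This makes the `∑ᶠ` over alternating paths honest
sums rather than the default value 0. -/
theorem finite (hM : IsMorseMatching M) (η ω : A.Cell) : Finite (ZigZag M η ω) := by
  induction η using hM.wf.induction with
  | _ η ih =>
    have h (x : Step M η) : Finite (ZigZag M x.1.2 ω) := ih x.1.2 ⟨x.1.1, x.2⟩
    exact Finite.of_equiv _ (equivSum η ω).symm

/-- The sum over all alternating paths from `η` to `ω`, with signs and weights. -/
def total (M : Set (A.Cell × A.Cell)) (w : A.Cell → A.Cell → R) (η ω : A.Cell) : R :=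
  ∑ᶠ z : ZigZag M η ω, z.sign • z.weight w

/-- Splitting off the first step of an alternating path gives the entrywise form of `Z = 1 - Z v (d
- dM)`. The sum over all cells is harmless: pairs that are not steps have incidence 0, are matched
downwards, or are not matched upwards. -/
theorem total_eq (hM : IsMorseMatching M) (w : A.Cell → A.Cell → R) (η ω : A.Cell) :
    total M w η ω = (if η = ω then 1 else 0) - ∑ τ : A.Cell, ∑ ρ : A.Cell,
      if (ρ, τ) ∈ M then (if (η, τ) ∈ M then 0 else η.incidence τ • w η τ) *
        (ρ.incidence τ • total M w ρ ω) else 0 := by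
  have hfin (η ω) : Finite (ZigZag M η ω) := finite hM η ω
  letI inst : ∀ η ω, Fintype (ZigZag M η ω) := fun _ _ => Fintype.ofFinite _
  have h1 (η : A.Cell) : total M w η ω = ∑ z : ZigZag M η ω, z.sign • z.weight w :=
    finsum_eq_sum_of_fintype _
  rw [h1, ← (equivSum η ω).symm.sum_comp, Fintype.sum_sum_type, sub_eq_add_neg,
    Fintype.sum_sigma]
  congr 1
  · split_ifs with h
    · subst h
      letI : Unique (PLift (η = η)) := ⟨⟨⟨rfl⟩⟩, fun _ => rfl⟩
      rw [Fintype.sum_unique]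
      change (nil (M := M) η).sign • (nil (M := M) η).weight w = 1
      simp [sign, weight]
    · haveI : IsEmpty (PLift (η = ω)) := ⟨fun x => h x.down⟩
      simp
  · rw [← Fintype.sum_prod_type', ← Finset.sum_neg_distrib]
    symm
    rw [← Finset.sum_subset (Finset.subset_univ (Finset.univ.filter fun x : A.Cell × A.Cell =>
      x.1.IsFacet η ∧ (η, x.1) ∉ M ∧ (x.2, x.1) ∈ M))]
    · rw [← Finset.sum_subtype_eq_sum_filter]
      simp only [Finset.subtype_univ]
      refine Fintype.sum_congr _ _ fun x => ?_
      rw [if_pos x.2.2.2, if_neg x.2.2.1, h1, Finset.smul_sum, Finset.mul_sum,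
        ← Finset.sum_neg_distrib]
      refine Fintype.sum_congr _ _ fun z => ?_
      simp only [equivSum, Equiv.coe_fn_symm_mk, sign, weight, smul_mul_assoc, mul_smul_comm,
        smul_smul, neg_smul, neg_mul]
      congr 2
      ring
    · rintro ⟨τ, ρ⟩ - h
      simp only [Finset.mem_filter, Finset.mem_univ, true_and, not_and] at h
      split_ifs with h1 h2
      · simp
      · rw [Cell.incidence_eq_zero fun h' => h h' h2 h1]; simp
      · simp

end ZigZag

end

end HPA

/-! ### Endomorphisms given by matrices, and the Morse datum of an acyclic matching. -/

namespace HPA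

noncomputable section

open scoped Classical
open PathAlgebra OrderComplex MulOpposite

section OfMatrix

variable {X R : Type*} [Fintype X] [Ring R]

/-- The endomorphism of the free left module on `X` given by a matrix. -/
def ofMatrix (m : X → X → R) : Module.End R (X →₀ R) :=
  Finsupp.linearCombination R fun η => ∑ τ, Finsupp.single τ (m η τ)

/-- Scalars act from the left, so entries multiply from the right. Under composition the weights
then appear in the order in which the steps are taken, as in the weight of an alternating path; this
matters over the noncommutative enveloping algebra. -/
theorem ofMatrix_single (m : X → X → R) (η : X) (r : R) :
    ofMatrix m (Finsupp.single η r) = ∑ τ, Finsupp.single τ (r * m η τ) := by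
  simp [ofMatrix, Finset.smul_sum]

theorem ofMatrix_single_apply (m : X → X → R) (η τ : X) (r : R) :
    ofMatrix m (Finsupp.single η r) τ = r * m η τ := by
  rw [ofMatrix_single, Finsupp.finsetSum_apply, Finset.sum_eq_single τ] <;>
    simp +contextual

theorem ofMatrix_single_eq_zero {m : X → X → R} {η : X} (h : ∀ τ, m η τ = 0) (r : R) :
    ofMatrix m (Finsupp.single η r) = 0 := by
  rw [ofMatrix_single]; simp [h]

theorem ofMatrix_single_eq_single {m : X → X → R} {η ρ : X} (h : ∀ τ, τ ≠ ρ → m η τ = 0) (r : R) :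
    ofMatrix m (Finsupp.single η r) = Finsupp.single ρ (r * m η ρ) := by
  rw [ofMatrix_single, Finset.sum_eq_single ρ] <;> simp +contextual [h]

theorem ofMatrix_apply (m : X → X → R) (x : X →₀ R) (τ : X) :
    ofMatrix m x τ = ∑ η, x η * m η τ := by
  induction x using Finsupp.induction_linear with
  | zero => simp
  | add x y hx hy => simp [hx, hy, add_mul, Finset.sum_add_distrib]
  | single η r =>
    rw [ofMatrix_single_apply, Finset.sum_eq_single η] <;>
      simp +contextual

theorem end_ext {X R : Type*} [Ring R] {f g : Module.End R (X →₀ R)}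
    (h : ∀ η, f (Finsupp.single η 1) = g (Finsupp.single η 1)) : f = g := by
  refine Finsupp.lhom_ext fun η r => ?_
  have h1 : Finsupp.single η r = r • Finsupp.single η (1 : R) := by simp
  rw [h1, map_smul, map_smul, h]

theorem map_single {X R : Type*} [Ring R] {N : Type*} [AddCommGroup N] [Module R N] (f : (X →₀ R) →ₗ[R] N) (η : X)
    (r : R) : f (Finsupp.single η r) = r • f (Finsupp.single η 1) := by
  rw [← map_smul]; simp

end OfMatrix

variable {k V : Type*} [CommRing k] [Quiver V] [Fintype V] {A : HPA k V}
  [∀ v w : V, Finite (v ⟶ w)] {R : Type*} [Ring R]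

/-- The differential on the free module on the cells, with weights. -/
def boundary (w : A.Cell → A.Cell → R) : Module.End R (A.Cell →₀ R) :=
  ofMatrix fun η τ => η.incidence τ • w η τ

/-- The inverse of the matched part of the differential. -/
def matchUp (R : Type*) [Ring R] (M : Set (A.Cell × A.Cell)) : Module.End R (A.Cell →₀ R) :=
  ofMatrix fun τ ρ => if (ρ, τ) ∈ M then ((ρ.incidence τ : ℤ) : R) else 0

/-- The matched part of the differential. -/
def matchDown (R : Type*) [Ring R] (M : Set (A.Cell × A.Cell)) : Module.End R (A.Cell →₀ R) :=
  ofMatrix fun ρ τ => if (ρ, τ) ∈ M then ((ρ.incidence τ : ℤ) : R) else 0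

/-- The coordinate projection to a set of cells. -/
def cellProj (R : Type*) [Ring R] (s : Set A.Cell) : Module.End R (A.Cell →₀ R) :=
  ofMatrix fun η ω => if η = ω ∧ η ∈ s then 1 else 0

/-- The sum over all alternating paths. -/
def zigzagSum (M : Set (A.Cell × A.Cell)) (w : A.Cell → A.Cell → R) :
    Module.End R (A.Cell →₀ R) :=
  ofMatrix (ZigZag.total M w)

theorem cellProj_single_of_mem {s : Set A.Cell} {η : A.Cell} (h : η ∈ s) (r : R) :
    cellProj R s (Finsupp.single η r) = Finsupp.single η r := by
  unfold cellProj
  rw [ofMatrix_single_eq_single (ρ := η)]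
  · simp [h]
  · intro τ hτ; simp [hτ.symm]

theorem cellProj_single_of_notMem {s : Set A.Cell} {η : A.Cell} (h : η ∉ s) (r : R) :
    cellProj R s (Finsupp.single η r) = 0 :=
  ofMatrix_single_eq_zero (by simp [h]) r

theorem cellProj_single (s : Set A.Cell) (η : A.Cell) (r : R) :
    cellProj R s (Finsupp.single η r) = if η ∈ s then Finsupp.single η r else 0 := by
  split_ifs with h
  · exact cellProj_single_of_mem h r
  · exact cellProj_single_of_notMem h r

theorem cellProj_mul (s t : Set A.Cell) :
    (cellProj R s * cellProj R t : Module.End R (A.Cell →₀ R)) = cellProj R (s ∩ t) := by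
  refine end_ext fun η => ?_
  rw [Module.End.mul_apply, cellProj_single, cellProj_single]
  by_cases h1 : η ∈ t <;> by_cases h2 : η ∈ s <;> simp [h1, h2, cellProj_single]

theorem cellProj_eq_zero : (cellProj R ∅ : Module.End R (A.Cell →₀ R)) = 0 :=
  end_ext fun η => by simp [cellProj_single]

theorem cellProj_apply (s : Set A.Cell) (x : A.Cell →₀ R) (η : A.Cell) :
    cellProj R s x η = if η ∈ s then x η else 0 := by
  unfold cellProj
  rw [ofMatrix_apply, Finset.sum_eq_single η] <;> simp +contextual

theorem boundary_single_apply (w : A.Cell → A.Cell → R) (η τ : A.Cell) (r : R) :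
    boundary w (Finsupp.single η r) τ = r * (η.incidence τ • w η τ) :=
  ofMatrix_single_apply _ _ _ _

/-- Cells that are the smaller one of a matched pair. -/
def lowerCells (M : Set (A.Cell × A.Cell)) : Set A.Cell := {τ | ∃ ρ, (ρ, τ) ∈ M}

/-- Cells that are the larger one of a matched pair. -/
def upperCells (M : Set (A.Cell × A.Cell)) : Set A.Cell := {ρ | ∃ τ, (ρ, τ) ∈ M}

namespace IsMorseMatching

variable {M : Set (A.Cell × A.Cell)}

theorem matchUp_single {ρ τ : A.Cell} (hM : IsMorseMatching M) (h : (ρ, τ) ∈ M) (r : R) :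
    matchUp R M (Finsupp.single τ r) = Finsupp.single ρ (r * (ρ.incidence τ : ℤ)) := by
  unfold matchUp
  rw [ofMatrix_single_eq_single (ρ := ρ)]
  · simp [h]
  · intro ρ' hne
    rw [if_neg fun h' => hne (hM.left_unique h' h)]

theorem matchDown_single {ρ τ : A.Cell} (hM : IsMorseMatching M) (h : (ρ, τ) ∈ M) (r : R) :
    matchDown R M (Finsupp.single ρ r) = Finsupp.single τ (r * (ρ.incidence τ : ℤ)) := by
  unfold matchDown
  rw [ofMatrix_single_eq_single (ρ := τ)]
  · simp [h]
  · intro ρ' hne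
    rw [if_neg fun h' => hne (hM.right_unique h' h)]

theorem matchUp_single_eq_zero {τ : A.Cell} (h : τ ∉ lowerCells M) (r : R) :
    matchUp R M (Finsupp.single τ r) = 0 :=
  ofMatrix_single_eq_zero (fun ρ => if_neg fun h' => h ⟨ρ, h'⟩) r

theorem matchDown_single_eq_zero {ρ : A.Cell} (h : ρ ∉ upperCells M) (r : R) :
    matchDown R M (Finsupp.single ρ r) = 0 :=
  ofMatrix_single_eq_zero (fun τ => if_neg fun h' => h ⟨τ, h'⟩) r

theorem notMem_upper_of_lower (hM : IsMorseMatching M) {η : A.Cell} (h : η ∈ lowerCells M) :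
    η ∉ upperCells M := by
  rintro ⟨τ, hτ⟩
  obtain ⟨ρ, hρ⟩ := h
  exact hM.not_both hρ hτ

theorem critical_iff {η : A.Cell} : IsCritical M η ↔ η ∉ lowerCells M ∧ η ∉ upperCells M := by
  unfold IsCritical lowerCells upperCells
  simp only [Set.mem_ofPred_eq, not_exists]
  exact ⟨fun h => ⟨fun ρ => (h ρ).2, fun ρ => (h ρ).1⟩, fun h ρ => ⟨h.2 ρ, h.1 ρ⟩⟩

theorem incidence_cast_mul_self (hM : IsMorseMatching M) {ρ τ : A.Cell} (h : (ρ, τ) ∈ M) :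
    ((ρ.incidence τ : ℤ) : R) * (ρ.incidence τ : ℤ) = 1 := by
  rw [← Int.cast_mul, hM.incidence_mul_self h, Int.cast_one]

/-- Because matched edges have weight 1, subtracting the matched part deletes exactly the matched
edges. -/
theorem matchUp_sub_single (w : A.Cell → A.Cell → R) (hw : ∀ ρ τ, (ρ, τ) ∈ M → w ρ τ = 1)
    (η : A.Cell) : (boundary w - matchDown R M) (Finsupp.single η 1) =
      ∑ τ, Finsupp.single τ (if (η, τ) ∈ M then 0 else η.incidence τ • w η τ) := by
  rw [LinearMap.sub_apply, boundary, matchDown, ofMatrix_single, ofMatrix_single,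
    ← Finset.sum_sub_distrib]
  refine Fintype.sum_congr _ _ fun τ => ?_
  rw [← Finsupp.single_sub]
  split_ifs with h
  · simp [hw _ _ h]
  · simp

theorem zigzagSum_eq (hM : IsMorseMatching M) (w : A.Cell → A.Cell → R)
    (hw : ∀ ρ τ, (ρ, τ) ∈ M → w ρ τ = 1) :
    zigzagSum M w * (1 + matchUp R M * (boundary w - matchDown R M)) = 1 := by
  refine end_ext fun η => ?_
  rw [mul_add, mul_one, LinearMap.add_apply, Module.End.mul_apply, Module.End.mul_apply,
    matchUp_sub_single w hw, Module.End.one_apply]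
  ext ω
  rw [Finsupp.add_apply, zigzagSum, ofMatrix_single_apply, one_mul, ZigZag.total_eq hM,
    map_sum, map_sum, Finsupp.finsetSum_apply, sub_add_eq_add_sub, sub_eq_iff_eq_add,
    Finsupp.single_apply]
  congr 1
  refine Fintype.sum_congr _ _ fun τ => ?_
  rw [matchUp, ofMatrix_single, map_sum, Finsupp.finsetSum_apply]
  refine Fintype.sum_congr _ _ fun ρ => ?_
  rw [ofMatrix_single_apply]
  split_ifs <;> simp [mul_assoc]

/-- The hypothesis expresses `Y` at `η` through its values at the cells one alternating step further
on, so `Y` vanishes by induction along the acyclic relation. Applied to the defect of the right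
inverse, this upgrades the left inverse of `zigzagSum_eq` to a two-sided one. -/
theorem eq_zero_of_mul (hM : IsMorseMatching M) (w : A.Cell → A.Cell → R)
    (hw : ∀ ρ τ, (ρ, τ) ∈ M → w ρ τ = 1) (Y : Module.End R (A.Cell →₀ R))
    (hY : Y * (1 + matchUp R M * (boundary w - matchDown R M)) = 0) : Y = 0 := by
  refine end_ext fun η => ?_
  induction η using hM.wf.induction with
  | _ η ih =>
    have h := LinearMap.congr_fun hY (Finsupp.single η 1)
    rw [mul_add, mul_one, LinearMap.add_apply, Module.End.mul_apply, Module.End.mul_apply,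
      matchUp_sub_single w hw, map_sum, map_sum] at h
    rw [eq_neg_of_add_eq_zero_left h, LinearMap.zero_apply, neg_eq_zero]
    refine Finset.sum_eq_zero fun τ _ => ?_
    by_cases h1 : (η, τ) ∈ M
    · simp [h1]
    by_cases h2 : τ.IsFacet η
    · by_cases h3 : τ ∈ lowerCells M
      · obtain ⟨ρ, hρ⟩ := h3
        rw [hM.matchUp_single hρ, map_single, ih ρ ⟨τ, h2, h1, hρ⟩]
        simp
      · rw [matchUp_single_eq_zero h3, map_zero]
    · rw [Cell.incidence_eq_zero h2]; simp

theorem mul_zigzagSum (hM : IsMorseMatching M) (w : A.Cell → A.Cell → R)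
    (hw : ∀ ρ τ, (ρ, τ) ∈ M → w ρ τ = 1) :
    (1 + matchUp R M * (boundary w - matchDown R M)) * zigzagSum M w = 1 := by
  rw [← sub_eq_zero]
  refine hM.eq_zero_of_mul w hw _ ?_
  rw [sub_mul, mul_assoc, hM.zigzagSum_eq w hw]; simp

/-- The Morse datum of an acyclic matching. -/
def datum (hM : IsMorseMatching M) (w : A.Cell → A.Cell → R)
    (hw : ∀ ρ τ, (ρ, τ) ∈ M → w ρ τ = 1) (hd : boundary w * boundary w = 0) :
    MorseDatum (Module.End R (A.Cell →₀ R)) where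
  d := boundary w
  eC := cellProj R {η | IsCritical M η}
  eL := cellProj R (lowerCells M)
  eU := cellProj R (upperCells M)
  dM := matchDown R M
  v := matchUp R M
  Z := zigzagSum M w
  d_sq := hd
  sum_eq := by
    refine end_ext fun η => ?_
    by_cases h1 : η ∈ lowerCells M
    · simp [cellProj_single, critical_iff, h1, hM.notMem_upper_of_lower h1]
    · by_cases h2 : η ∈ upperCells M <;> simp [cellProj_single, critical_iff, h1, h2]
  eC_eC := by rw [cellProj_mul, Set.inter_self]
  eC_eU := by
    rw [cellProj_mul, ← cellProj_eq_zero]; congr 1; ext; simp +contextual [critical_iff]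
  eU_eC := by
    rw [cellProj_mul, ← cellProj_eq_zero]; congr 1; ext; simp +contextual [critical_iff]
  eL_eC := by
    rw [cellProj_mul, ← cellProj_eq_zero]; congr 1; ext; simp +contextual [critical_iff]
  eU_eL := by
    rw [cellProj_mul, ← cellProj_eq_zero]; congr 1; ext η
    simpa using fun h h' => hM.notMem_upper_of_lower h' h
  eL_eU := by
    rw [cellProj_mul, ← cellProj_eq_zero]; congr 1; ext η
    simpa using fun h h' => hM.notMem_upper_of_lower h h'
  eU_v := by
    refine end_ext fun η => ?_
    rw [Module.End.mul_apply]
    by_cases h : η ∈ lowerCells M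
    · obtain ⟨ρ, hρ⟩ := h
      rw [hM.matchUp_single hρ, cellProj_single_of_mem (s := upperCells M) ⟨η, hρ⟩]
    · rw [matchUp_single_eq_zero h, map_zero]
  v_eL := by
    refine end_ext fun η => ?_
    rw [Module.End.mul_apply, cellProj_single]
    split_ifs with h
    · rfl
    · rw [matchUp_single_eq_zero h, map_zero]
  v_dM := by
    refine end_ext fun η => ?_
    rw [Module.End.mul_apply, cellProj_single]
    split_ifs with h
    · obtain ⟨τ, hτ⟩ := h
      rw [hM.matchDown_single hτ, hM.matchUp_single hτ, one_mul, hM.incidence_cast_mul_self hτ]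
    · rw [matchDown_single_eq_zero h, map_zero]
  dM_v := by
    refine end_ext fun η => ?_
    rw [Module.End.mul_apply, cellProj_single]
    split_ifs with h
    · obtain ⟨ρ, hρ⟩ := h
      rw [hM.matchUp_single hρ, hM.matchDown_single hρ, one_mul, hM.incidence_cast_mul_self hρ]
    · rw [matchUp_single_eq_zero h, map_zero]
  Z_mul := hM.zigzagSum_eq w hw
  mul_Z := hM.mul_zigzagSum w hw

end IsMorseMatching

/-! ### Gradient paths -/

namespace GradientPath

variable {M : Set (A.Cell × A.Cell)}

/-- The product of the weights of the steps down. -/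
def weight (w : A.Cell → A.Cell → R) {η ω : A.Cell} (γ : GradientPath M η ω) : R :=
  γ.zigzag.weight w * w γ.mid ω

/-- A gradient path is an alternating path with a last step. -/
def equivSigma (η ω : A.Cell) : GradientPath M η ω ≃
    Σ ρ : {ρ : A.Cell // Cell.IsFacet ω ρ ∧ (ρ, ω) ∉ M}, ZigZag M η ρ.1 where
  toFun γ := ⟨⟨γ.mid, γ.facet, γ.down⟩, γ.zigzag⟩
  invFun x := ⟨x.1.1, x.2, x.1.2.1, x.1.2.2⟩
  left_inv _ := rfl
  right_inv _ := rfl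

theorem finite (hM : IsMorseMatching M) (η ω : A.Cell) : Finite (GradientPath M η ω) := by
  have (ρ : A.Cell) := ZigZag.finite hM η ρ
  exact Finite.of_equiv _ (equivSigma η ω).symm

/-- The sum over all gradient paths from `η` to `ω`, with signs and weights. -/
def total (M : Set (A.Cell × A.Cell)) (w : A.Cell → A.Cell → R) (η ω : A.Cell) : R :=
  ∑ᶠ γ : GradientPath M η ω, γ.sign • γ.weight w

/-- No matched edge ends in the critical cell `ω`, so the last step of a gradient path may be taken
with the full differential. -/
theorem total_eq (hM : IsMorseMatching M) (w : A.Cell → A.Cell → R) (η : A.Cell) {ω : A.Cell}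
    (hω : IsCritical M ω) :
    total M w η ω = boundary w (zigzagSum M w (Finsupp.single η 1)) ω := by
  have hfin (η ω) : Finite (ZigZag M η ω) := ZigZag.finite hM η ω
  let inst : ∀ η ω, Fintype (ZigZag M η ω) := fun _ _ => Fintype.ofFinite _
  have := finite hM η ω
  let inst2 : Fintype (GradientPath M η ω) := Fintype.ofFinite _
  have h1 (ρ : A.Cell) : ZigZag.total M w η ρ = ∑ z : ZigZag M η ρ, z.sign • z.weight w :=
    finsum_eq_sum_of_fintype _
  unfold boundary
  rw [ofMatrix_apply, total, finsum_eq_sum_of_fintype, ← (equivSigma η ω).symm.sum_comp,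
    Fintype.sum_sigma]
  simp only [zigzagSum, ofMatrix_single_apply, one_mul]
  rw [← Finset.sum_subset (Finset.subset_univ (Finset.univ.filter fun ρ : A.Cell =>
      Cell.IsFacet ω ρ ∧ (ρ, ω) ∉ M)), ← Finset.sum_subtype_eq_sum_filter]
  · simp only [Finset.subtype_univ]
    refine Fintype.sum_congr _ _ fun ρ => ?_
    rw [h1, Finset.sum_mul]
    refine Fintype.sum_congr _ _ fun z => ?_
    simp only [equivSigma, Equiv.coe_fn_symm_mk, sign, weight, smul_mul_assoc, mul_smul_comm,
      smul_smul]
    rw [mul_comm]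
  · intro ρ _ h
    simp only [Finset.mem_filter, Finset.mem_univ, true_and, not_and, not_not] at h
    by_cases hf : Cell.IsFacet ω ρ
    · exact absurd (h hf) (hω ρ).2
    · rw [Cell.incidence_eq_zero hf]; simp

end GradientPath

/-- This identifies the abstract differential `eC d Z eC` with the sum over gradient paths. -/
theorem IsMorseMatching.diff_single {M : Set (A.Cell × A.Cell)} (hM : IsMorseMatching M)
    (w : A.Cell → A.Cell → R) (hw : ∀ ρ τ, (ρ, τ) ∈ M → w ρ τ = 1)
    (hd : boundary w * boundary w = 0) {η ω : A.Cell} (hη : IsCritical M η)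
    (hω : IsCritical M ω) (r : R) :
    (hM.datum w hw hd).diff (Finsupp.single η r) ω = r * GradientPath.total M w η ω := by
  rw [GradientPath.total_eq hM w η hω, map_single]
  simp only [MorseDatum.diff, datum, Module.End.mul_apply]
  rw [cellProj_single_of_mem (show η ∈ {η | IsCritical M η} from hη)]
  simp only [Finsupp.smul_apply, smul_eq_mul]
  rw [cellProj_apply, if_pos (show ω ∈ {η | IsCritical M η} from hω)]

end

end HPA

/-! ### Chains with a given starting vertex, and the square of the differential -/

namespace HPA

noncomputable section

open scoped Classical
open PathAlgebra OrderComplex MulOpposite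

variable {k V : Type*} [CommRing k] [Quiver V] [Fintype V] {A : HPA k V}

theorem ofPath_mul (p q : PathOf V) :
    A.ofPath p * A.ofPath q = A.ideal.ringCon.mk' (PathAlgebra.of p * PathAlgebra.of q) :=
  (map_mul A.ideal.ringCon.mk' _ _).symm

theorem Hom.toAlg_comp {u v w : V} (p : A.Hom u v) (q : A.Hom v w) :
    (p.comp q).toAlg = p.toAlg * q.toAlg := by
  induction p using Quotient.inductionOn with | h p
  induction q using Quotient.inductionOn with | h q
  change A.ofPath ⟨u, w, p.comp q⟩ = A.ofPath ⟨u, v, p⟩ * A.ofPath ⟨v, w, q⟩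
  rw [ofPath_mul, of_mul_of']
  rfl

namespace Under

theorem toAlg_comp {v : V} (p : A.Under v) (r : A.Under p.head) :
    (p.comp r).toAlg = p.toAlg * r.toAlg := Hom.toAlg_comp p.2 r.2

theorem comp_bot {v : V} (p : A.Under v) : p.comp ⊥ = p :=
  congrArg (Sigma.mk _) (Hom.comp_id p.2)

theorem comp_assoc {v : V} (p : A.Under v) (r : A.Under p.head) (s : A.Under r.head) :
    (p.comp r).comp s = p.comp (r.comp s) :=
  congrArg (Sigma.mk _) (Hom.comp_assoc p.2 r.2 s.2)

theorem bot_comp {v : V} (p : A.Under v) : (⊥ : A.Under v).comp p = p :=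
  congrArg (Sigma.mk _) (Hom.id_comp p.2)

theorem comp_injective {v : V} (p : A.Under v) : Function.Injective p.comp := fun r r' h =>
  le_antisymm ((comp_le_comp_iff p r r').1 h.le) ((comp_le_comp_iff p r' r).1 h.ge)

theorem le_comp {v : V} (p : A.Under v) (r : A.Under p.head) : p ≤ p.comp r := ⟨r, rfl⟩

theorem comp_ne_bot {v : V} {p : A.Under v} (hp : p ≠ ⊥) (r : A.Under p.head) :
    p.comp r ≠ ⊥ := fun h => hp (le_bot_iff.1 (h ▸ le_comp p r))

theorem comp_ne_self {v : V} {p : A.Under v} {r : A.Under p.head} (hr : r ≠ ⊥) :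
    p.comp r ≠ p := fun h => hr (comp_injective p (h.trans (comp_bot p).symm))

theorem comp_ne_bot_of_right {v : V} {p : A.Under v} {r : A.Under p.head} (hr : r ≠ ⊥) :
    p.comp r ≠ ⊥ := by
  intro h
  have hp : p = ⊥ := le_bot_iff.1 (h ▸ le_comp p r)
  exact comp_ne_self hr (h.trans hp.symm)

theorem quot_comp_self {v : V} (p : A.Under v) (r : A.Under p.head) :
    (p.comp r).quot p = r.toAlg := by
  have h : ∃ r' : A.Under p.head, p.comp r' = p.comp r := ⟨r, rfl⟩
  unfold quot
  rw [dif_pos h]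
  congr 1
  exact comp_injective p h.choose_spec

theorem quot_bot {v : V} (p : A.Under v) : p.quot ⊥ = p.toAlg := by
  have h := quot_comp_self (⊥ : A.Under v) p
  rwa [bot_comp] at h

theorem quot_comp_comp {v : V} (p : A.Under v) {r s : A.Under p.head} (h : s ≤ r) :
    (p.comp r).quot (p.comp s) = r.quot s := by
  obtain ⟨t, rfl⟩ := h
  rw [quot_comp_self, ← comp_assoc]
  exact quot_comp_self (p.comp s) t

end Under

variable (A) in
/-- The chains of nonconstant paths that start at `v`. -/
abbrev Chains (v : V) : Type _ :=
  {c : Finset (A.Under v) // IsChain (· ≤ ·) (c : Set (A.Under v)) ∧ ⊥ ∉ c}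

namespace Chains

variable {v : V}

/-- The cell given by a chain. -/
abbrev cell (c : A.Chains v) : A.Cell := ⟨v, c.1, c.2.1, c.2.2⟩

/-- The empty chain. -/
def empty (A : HPA k V) (v : V) : A.Chains v := ⟨∅, by simp⟩

/-- The chain without the element `q`. -/
def erase (c : A.Chains v) (q : A.Under v) : A.Chains v :=
  ⟨c.1.erase q, c.2.1.mono (by simp), fun h => c.2.2 (Finset.mem_of_mem_erase h)⟩

/-- The paths of the chain, preceded by `p`. -/
def shift (p : A.Under v) (c : A.Chains p.head) : A.Chains v :=
  ⟨c.1.map ⟨p.comp, Under.comp_injective p⟩, by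
    rw [Finset.coe_map]
    rintro _ ⟨r, hr, rfl⟩ _ ⟨s, hs, rfl⟩ -
    exact (c.2.1.total hr hs).imp (Under.comp_le_comp_iff p _ _).2
      (Under.comp_le_comp_iff p _ _).2, by
    simp only [Finset.mem_map, Function.Embedding.coeFn_mk, not_exists, not_and]
    intro r hr
    exact Under.comp_ne_bot_of_right fun h => c.2.2 (h ▸ hr)⟩

/-- The path `p`, followed by the paths of the chain, preceded by `p`. -/
def cons (p : A.Under v) (hp : p ≠ ⊥) (c : A.Chains p.head) : A.Chains v :=
  ⟨insert p (shift p c).1, by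
    rw [Finset.coe_insert]
    refine (shift p c).2.1.insert fun s hs _ => Or.inl ?_
    obtain ⟨r, -, rfl⟩ := Finset.mem_map.1 hs
    exact Under.le_comp p r, by
    rw [Finset.mem_insert, not_or]
    exact ⟨hp.symm, (shift p c).2.2⟩⟩

theorem ne_bot {c : A.Chains v} {r : A.Under v} (hr : r ∈ c.1) : r ≠ ⊥ :=
  fun h => c.2.2 (h ▸ hr)

theorem mem_shift {p : A.Under v} {c : A.Chains p.head} {s : A.Under v} :
    s ∈ (shift p c).1 ↔ ∃ r ∈ c.1, p.comp r = s := by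
  simp [shift]

theorem comp_mem_shift {p : A.Under v} {c : A.Chains p.head} {r : A.Under p.head} :
    p.comp r ∈ (shift p c).1 ↔ r ∈ c.1 := by
  rw [mem_shift]
  exact ⟨fun ⟨s, hs, h⟩ => Under.comp_injective p h ▸ hs, fun h => ⟨r, h, rfl⟩⟩

theorem notMem_shift {p : A.Under v} {c : A.Chains p.head} : p ∉ (shift p c).1 := by
  rw [mem_shift]
  rintro ⟨r, hr, h⟩
  exact Under.comp_ne_self (ne_bot hr) h

theorem mem_cons {p : A.Under v} {hp : p ≠ ⊥} {c : A.Chains p.head} {s : A.Under v} :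
    s ∈ (cons p hp c).1 ↔ s = p ∨ ∃ r ∈ c.1, p.comp r = s := by
  rw [← mem_shift]; exact Finset.mem_insert

theorem erase_cons_self {p : A.Under v} {hp : p ≠ ⊥} {c : A.Chains p.head} :
    (cons p hp c).erase p = shift p c :=
  Subtype.ext (Finset.erase_insert notMem_shift)

theorem erase_cons {p : A.Under v} {hp : p ≠ ⊥} {c : A.Chains p.head} {r : A.Under p.head}
    (hr : r ∈ c.1) : (cons p hp c).erase (p.comp r) = cons p hp (c.erase r) := by
  refine Subtype.ext ?_
  have hne : p.comp r ≠ p := Under.comp_ne_self (ne_bot hr)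
  change (insert p (shift p c).1).erase (p.comp r) = insert p (shift p (c.erase r)).1
  rw [Finset.erase_insert_of_ne hne.symm]
  congr 1
  simp only [shift, erase, Finset.map_erase, Function.Embedding.coeFn_mk]

theorem shift_cons {p : A.Under v} {r : A.Under p.head} {hr : r ≠ ⊥} {c : A.Chains r.head} :
    shift p (cons r hr c) = cons (p.comp r) (Under.comp_ne_bot_of_right hr) c := by
  refine Subtype.ext (Finset.ext fun s => mem_shift.trans (Iff.trans ?_ mem_cons.symm))
  constructor
  · rintro ⟨t, ht, rfl⟩
    rcases mem_cons.1 ht with rfl | ⟨u, hu, rfl⟩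
    · exact Or.inl rfl
    · exact Or.inr ⟨u, hu, Under.comp_assoc p r u⟩
  · rintro (rfl | ⟨u, hu, rfl⟩)
    · exact ⟨r, mem_cons.2 (Or.inl rfl), rfl⟩
    · exact ⟨r.comp u, mem_cons.2 (Or.inr ⟨u, hu, rfl⟩), (Under.comp_assoc p r u).symm⟩

theorem shift_shift {p : A.Under v} {r : A.Under p.head} {c : A.Chains r.head} :
    shift p (shift r c) = shift (p.comp r) c := by
  refine Subtype.ext (Finset.ext fun s => mem_shift.trans (Iff.trans ?_ mem_shift.symm))
  constructor
  · rintro ⟨t, ht, rfl⟩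
    obtain ⟨u, hu, rfl⟩ := mem_shift.1 ht
    exact ⟨u, hu, Under.comp_assoc p r u⟩
  · rintro ⟨u, hu, rfl⟩
    exact ⟨r.comp u, comp_mem_shift.2 hu, (Under.comp_assoc p r u).symm⟩

theorem low_cons (p : A.Under v) (hp : p ≠ ⊥) (c : A.Chains p.head) :
    (cons p hp c).cell.low = p := by
  refine Cell.low_eq ⟨Finset.mem_coe.2 (mem_cons (hp := hp).2 (Or.inl rfl)), fun s hs => ?_⟩
  rcases mem_cons (hp := hp).1 (Finset.mem_coe.1 hs) with h | ⟨r, -, rfl⟩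
  · exact h.ge
  · exact Under.le_comp p r

theorem top_empty : (empty A v).cell.top = ⊥ := Cell.top_of_empty rfl

theorem top_cons (p : A.Under v) (hp : p ≠ ⊥) (c : A.Chains p.head) :
    (cons p hp c).cell.top = p.comp c.cell.top := by
  rcases c.1.eq_empty_or_nonempty with h | h
  · rw [Cell.top_of_empty (η := c.cell) h]
    refine (Cell.top_eq ⟨?_, fun s hs => ?_⟩).trans (Under.comp_bot p).symm
    · exact Finset.mem_coe.2 (mem_cons (hp := hp).2 (Or.inl rfl))
    · rcases mem_cons (hp := hp).1 (Finset.mem_coe.1 hs) with h' | ⟨r, hr, rfl⟩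
      · exact h'.le
      · simp [h] at hr
  · have htop := Cell.isGreatest_top (η := c.cell) h
    refine Cell.top_eq ⟨Finset.mem_coe.2 (mem_cons (hp := hp).2 (Or.inr ⟨_, htop.1, rfl⟩)), fun s hs => ?_⟩
    rcases mem_cons (hp := hp).1 (Finset.mem_coe.1 hs) with h' | ⟨r, hr, rfl⟩
    · exact h'.le.trans (Under.le_comp _ _)
    · exact (Under.comp_le_comp_iff p _ _).2 (htop.2 hr)

theorem erase_top_le (η : A.Cell) : η.terminalFacet.top ≤ η.top := by
  rcases η.terminalFacet.chain.eq_empty_or_nonempty with h | h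
  · rw [Cell.top_of_empty h]; exact bot_le
  · have h1 := (Cell.isGreatest_top h).1
    have h2 : η.terminalFacet.top ∈ η.chain := Finset.mem_of_mem_erase h1
    exact (Cell.isGreatest_top ⟨_, h2⟩).2 h2

/-- Prefixing `p` multiplies the last two elements by `p`, and their quotient does not change. For
the empty chain the statement fails: then `p` itself is the last step. -/
theorem lastStep_cons (p : A.Under v) (hp : p ≠ ⊥) {c : A.Chains p.head} (hc : c.1.Nonempty) :
    (cons p hp c).cell.lastStep = c.cell.lastStep := by
  have htop := (Cell.isGreatest_top (η := c.cell) hc).1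
  have h1 : (cons p hp c).cell.terminalFacet = (cons p hp (c.erase c.cell.top)).cell := by
    rw [← erase_cons htop]
    unfold Cell.terminalFacet
    rw [top_cons]
    rfl
  have h2 : (cons p hp c).cell.terminalFacet.top = p.comp c.cell.terminalFacet.top := by
    have h3 : ∀ (d : A.Chains v) (q : A.Under v), (d.cell.erase q).top = (d.erase q).cell.top :=
      fun _ _ => rfl
    unfold Cell.terminalFacet
    rw [top_cons, h3, erase_cons htop, top_cons]
    rfl
  unfold Cell.lastStep
  rw [h2, top_cons]
  exact Under.quot_comp_comp p (erase_top_le c.cell)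

theorem lastStep_cons_empty (p : A.Under v) (hp : p ≠ ⊥) :
    (cons p hp (empty A p.head)).cell.lastStep = p.toAlg := by
  have h1 : (cons p hp (empty A p.head)).cell.top = p := by
    rw [top_cons, top_empty, Under.comp_bot]
  have h2 : (cons p hp (empty A p.head)).cell.terminalFacet.top = ⊥ := by
    refine Cell.top_of_empty ?_
    unfold Cell.terminalFacet
    rw [h1]
    change (insert p (shift p (empty A p.head)).1).erase p = ∅
    rw [Finset.erase_insert notMem_shift]
    rfl
  unfold Cell.lastStep
  rw [h1, h2]
  exact Under.quot_bot p

theorem eq_empty_of_not_nonempty {c : A.Chains v} (h : ¬ c.1.Nonempty) : c = empty A v :=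
  Subtype.ext (Finset.not_nonempty_iff_eq_empty.1 h)

variable [∀ v w : V, Finite (v ⟶ w)]

instance : Fintype (A.Chains v) := Fintype.ofFinite _

theorem initialFacet_of_low_eq {η : A.Cell} {p : A.Under η.tail} (h : η.low = p)
    {c : A.Chains p.head} (hc : ∀ r, r ∈ c.1 ↔ r ≠ ⊥ ∧ p.comp r ∈ η.chain) :
    η.initialFacet = c.cell := by
  subst h
  refine Cell.ext_chain.2 (Finset.ext fun r => ?_)
  rw [hc]
  simp

theorem initialFacet_cons (p : A.Under v) (hp : p ≠ ⊥) (c : A.Chains p.head) :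
    (cons p hp c).cell.initialFacet = c.cell := by
  refine initialFacet_of_low_eq (low_cons p hp c) fun r => ?_
  change _ ↔ r ≠ ⊥ ∧ p.comp r ∈ (cons p hp c).1
  rw [mem_cons]
  constructor
  · intro hr
    exact ⟨ne_bot hr, Or.inr ⟨r, hr, rfl⟩⟩
  · rintro ⟨hr, h | ⟨s, hs, h⟩⟩
    · exact absurd h (Under.comp_ne_self hr)
    · exact Under.comp_injective p h ▸ hs

theorem exists_eq_cons {c : A.Chains v} (hc : c.1.Nonempty) :
    ∃ p hp d, c = cons p hp d := by
  have hmin := Cell.isLeast_low (η := c.cell) hc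
  have hp : c.cell.low ≠ ⊥ := ne_bot (c := c) hmin.1
  refine ⟨c.cell.low, hp, ⟨c.cell.initialFacet.chain, c.cell.initialFacet.isChain,
    c.cell.initialFacet.bot_notMem⟩, ?_⟩
  refine Subtype.ext (Finset.ext fun s => ?_)
  rw [mem_cons]
  constructor
  · intro hs
    obtain ⟨r, rfl⟩ := hmin.2 hs
    by_cases hr : r = ⊥
    · left; rw [hr]; exact Under.comp_bot _
    · exact Or.inr ⟨r, by simpa [Cell.initialFacet, hr] using hs, rfl⟩
  · rintro (rfl | ⟨r, hr, rfl⟩)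
    · exact hmin.1
    · have h2 : r ≠ ⊥ ∧ c.cell.low.comp r ∈ c.cell.chain := by
        simpa [Cell.initialFacet] using hr
      exact h2.2

theorem card_cons (p : A.Under v) (hp : p ≠ ⊥) (c : A.Chains p.head) :
    (cons p hp c).1.card = c.1.card + 1 := by
  change (insert p (shift p c).1).card = _
  rw [Finset.card_insert_of_notMem notMem_shift, shift, Finset.card_map]

/-- Chains are built by prepending paths, with a change of the starting vertex; the identities for
the differential are recursive in this sense. -/
theorem induction {motive : ∀ v, A.Chains v → Prop} (empty : ∀ v, motive v (empty A v))
    (cons : ∀ v p hp c, motive p.head c → motive v (cons p hp c)) (v : V) (c : A.Chains v) :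
    motive v c := by
  induction hn : c.1.card generalizing v with
  | zero =>
    rw [eq_empty_of_not_nonempty (c := c) (by simpa using hn)]
    exact empty v
  | succ n ih =>
    obtain ⟨p, hp, d, rfl⟩ := exists_eq_cons (Finset.card_pos.1 (by omega : 0 < c.1.card))
    rw [card_cons] at hn
    exact cons v p hp d (ih _ d (by omega))

end Chains

variable [∀ v w : V, Finite (v ⟶ w)]

/-! ### Multiplicative weights -/

variable {R : Type*} [Ring R] (lam : A.Alg →ₙ* R) (rho : A.Algᵐᵒᵖ →ₙ* R)

/-- The weight of a facet: the values of the paths that are split off. -/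
def stepWeight (η τ : A.Cell) : R :=
  (if τ = η.initialFacet then lam η.low.toAlg else 1) *
    (if τ = η.terminalFacet then rho (op η.lastStep) else 1)

/-- The weight of the facet that omits `q`. -/
def innerWeight (η : A.Cell) (q : A.Under η.tail) : R :=
  (-1) ^ (η.chain.filter (· ≤ q)).card * if q = η.top then rho (op η.lastStep) else 1

/-- The part of the differential that preserves the starting vertex. -/
def innerBoundary (v : V) : Module.End R (A.Chains v →₀ R) :=
  Finsupp.linearCombination R fun c =>
    ∑ q ∈ c.1, Finsupp.single (c.erase q) (innerWeight rho c.cell q)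

/-- The part of the differential given by the initial facets. -/
def initialBoundary (v : V) : (A.Chains v →₀ R) →ₗ[R] (A.Cell →₀ R) :=
  Finsupp.linearCombination R fun c =>
    if c.1.Nonempty then Finsupp.single c.cell.initialFacet (lam c.cell.low.toAlg) else 0

/-- Chains as cells. -/
def toCells (R : Type*) [Ring R] (v : V) : (A.Chains v →₀ R) →ₗ[R] (A.Cell →₀ R) :=
  Finsupp.lmapDomain R R Chains.cell

/-- Composition with `p` on the left, on chains. -/
def shiftMap {v : V} (p : A.Under v) : (A.Chains p.head →₀ R) →ₗ[R] (A.Chains v →₀ R) :=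
  Finsupp.linearCombination R fun c =>
    Finsupp.single (c.shift p) (if c.1.Nonempty then 1 else rho (op p.toAlg))

/-- Prepending `p`, on chains. -/
def consMap (R : Type*) [Ring R] {v : V} (p : A.Under v) (hp : p ≠ ⊥) :
    (A.Chains p.head →₀ R) →ₗ[R] (A.Chains v →₀ R) :=
  Finsupp.lmapDomain R R (Chains.cons p hp)

theorem innerBoundary_single {v : V} (c : A.Chains v) :
    innerBoundary rho v (Finsupp.single c 1) =
      ∑ q ∈ c.1, Finsupp.single (c.erase q) (innerWeight rho c.cell q) := by
  simp [innerBoundary]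

theorem initialBoundary_single_empty (v : V) (r : R) :
    initialBoundary lam v (Finsupp.single (Chains.empty A v) r) = 0 := by
  simp [initialBoundary, Chains.empty]

theorem initialBoundary_single_cons {v : V} (p : A.Under v) (hp : p ≠ ⊥) (c : A.Chains p.head)
    (r : R) : initialBoundary lam v (Finsupp.single (Chains.cons p hp c) r) =
      Finsupp.single c.cell (r * lam p.toAlg) := by
  have h : (Chains.cons p hp c).1.Nonempty := ⟨p, Chains.mem_cons.2 (Or.inl rfl)⟩
  simp only [initialBoundary, Finsupp.linearCombination_single, if_pos h]
  rw [Chains.initialFacet_cons, Chains.low_cons]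
  simp

theorem toCells_single {v : V} (c : A.Chains v) (r : R) :
    toCells R v (Finsupp.single c r) = Finsupp.single c.cell r := by
  simp [toCells]

theorem consMap_single {v : V} (p : A.Under v) (hp : p ≠ ⊥) (c : A.Chains p.head) (r : R) :
    consMap R p hp (Finsupp.single c r) = Finsupp.single (c.cons p hp) r := by
  simp [consMap]

/-- If nothing follows `p`, then `p` is the top element and omitting it splits it off on the right;
this accounts for the factor `rho`. -/
theorem shiftMap_single_empty {v : V} (p : A.Under v) (r : R) :
    shiftMap rho p (Finsupp.single (Chains.empty A p.head) r) =
      Finsupp.single (Chains.empty A v) (r * rho (op p.toAlg)) := by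
  simp [shiftMap, Chains.empty, Chains.shift]

theorem shiftMap_single_of_nonempty {v : V} (p : A.Under v) {c : A.Chains p.head}
    (hc : c.1.Nonempty) (r : R) :
    shiftMap rho p (Finsupp.single c r) = Finsupp.single (c.shift p) r := by
  simp [shiftMap, hc]

/-- The facets of a cell are pairwise distinct, so the matrix row, indexed by cells, can be compared
with the sum indexed by the omitted elements. -/
theorem boundary_single_cell {v : V} (c : A.Chains v) :
    boundary (stepWeight lam rho) (Finsupp.single c.cell 1) =
      initialBoundary lam v (Finsupp.single c 1) +
        toCells R v (innerBoundary rho v (Finsupp.single c 1)) := by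
  have hrow : ∀ τ : A.Cell, boundary (stepWeight lam rho) (Finsupp.single c.cell 1) τ =
      (if c.1.Nonempty ∧ τ = c.cell.initialFacet then lam c.cell.low.toAlg else 0) +
      ∑ q ∈ c.1, if τ = (c.erase q).cell then innerWeight rho c.cell q else 0 := by
    intro τ
    rw [boundary_single_apply, one_mul]
    by_cases hτ : τ.IsFacet c.cell
    · obtain ⟨hne, rfl | ⟨q, hq, rfl⟩⟩ := hτ
      · have hne' : c.1.Nonempty := hne
        rw [Cell.incidence_initialFacet hne, if_pos ⟨hne', rfl⟩, Finset.sum_eq_zero]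
        · unfold stepWeight
          rw [if_pos rfl, if_neg]
          · simp
          · exact (Cell.erase_ne_initialFacet hne _).symm
        · intro q _
          rw [if_neg]
          exact (Cell.erase_ne_initialFacet hne q).symm
      · rw [Cell.incidence_erase hq, if_neg fun h => Cell.erase_ne_initialFacet hne q h.2,
          Finset.sum_eq_single q]
        · unfold stepWeight innerWeight
          rw [if_neg (Cell.erase_ne_initialFacet hne q), if_pos (show c.cell.erase q = (c.erase q).cell from rfl)]
          have : c.cell.erase q = c.cell.terminalFacet ↔ q = c.cell.top :=
            ⟨fun h => Cell.erase_injOn hq h, fun h => by rw [h]; rfl⟩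
          rw [one_mul]
          simp only [this]
          simp [zsmul_eq_mul]
        · intro q' _ hne
          exact if_neg fun h => hne (Cell.erase_injOn hq h).symm
        · exact fun h => absurd hq h
    · rw [Cell.incidence_eq_zero hτ, zero_smul, if_neg fun h => hτ ⟨h.1, Or.inl h.2⟩,
        Finset.sum_eq_zero, zero_add]
      intro q hq
      exact if_neg fun h => hτ ⟨⟨q, hq⟩, Or.inr ⟨q, hq, h⟩⟩
  ext τ
  rw [hrow, innerBoundary_single, map_sum, Finsupp.add_apply, Finsupp.finsetSum_apply]
  congr 1
  · simp only [initialBoundary, Finsupp.linearCombination_single, one_smul]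
    by_cases h : c.1.Nonempty
    · simp [h, Finsupp.single_apply, eq_comm]
    · simp [h]
  · refine Finset.sum_congr rfl fun q _ => ?_
    rw [toCells_single, Finsupp.single_apply]
    simp [eq_comm]

theorem innerBoundary_empty (v : V) (r : R) :
    innerBoundary rho v (Finsupp.single (Chains.empty A v) r) = 0 := by
  simp [innerBoundary, Chains.empty]

/-- The recursion behind `d² = 0`. Omitting `p` has the sign of position 1; omitting a later element
has its old sign reversed, because `p` moves all positions up by one. -/
theorem innerBoundary_cons {v : V} (p : A.Under v) (hp : p ≠ ⊥) (c : A.Chains p.head) :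
    innerBoundary rho v (Finsupp.single (c.cons p hp) 1) =
      - shiftMap rho p (Finsupp.single c 1) -
        consMap R p hp (innerBoundary rho p.head (Finsupp.single c 1)) := by
  have htop : ∀ r ∈ c.1, (p.comp r = (c.cons p hp).cell.top ↔ r = c.cell.top) := fun r _ => by
    rw [Chains.top_cons]; exact (Under.comp_injective p).eq_iff
  rw [innerBoundary_single, innerBoundary_single, map_sum]
  change ∑ q ∈ insert p (c.shift p).1, _ = _
  rw [Finset.sum_insert Chains.notMem_shift, sub_eq_add_neg]
  congr 1
  · rw [Chains.erase_cons_self]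
    have hcard : ((c.cons p hp).cell.chain.filter (· ≤ p)) = {p} := by
      ext s
      change s ∈ Finset.filter _ (c.cons p hp).1 ↔ _
      rw [Finset.mem_filter, Chains.mem_cons, Finset.mem_singleton]
      constructor
      · rintro ⟨rfl | ⟨r, hr, rfl⟩, h⟩
        · rfl
        · exact le_antisymm h (Under.le_comp p r)
      · rintro rfl
        exact ⟨Or.inl rfl, le_rfl⟩
    unfold innerWeight
    rw [hcard]
    by_cases hc : c.1.Nonempty
    · rw [shiftMap_single_of_nonempty rho p hc, if_neg]
      · simp [← Finsupp.single_neg]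
      · rw [Chains.top_cons]
        have h1 := (Cell.isGreatest_top (η := c.cell) hc).1
        exact (Under.comp_ne_self (Chains.ne_bot h1)).symm
    · obtain rfl := Chains.eq_empty_of_not_nonempty hc
      rw [shiftMap_single_empty, if_pos, Chains.lastStep_cons_empty]
      · simp [← Finsupp.single_neg]
        congr 1
      · rw [Chains.top_cons, Chains.top_empty, Under.comp_bot]
  · change ∑ q ∈ Finset.map _ c.1, _ = _
    rw [Finset.sum_map, ← Finset.sum_neg_distrib]
    refine Finset.sum_congr rfl fun r hr => ?_
    rw [consMap_single, ← Finsupp.single_neg]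
    change Finsupp.single ((c.cons p hp).erase (p.comp r)) _ = _
    rw [Chains.erase_cons hr]
    congr 1
    have hc : c.1.Nonempty := ⟨r, hr⟩
    have hcard : ((c.cons p hp).cell.chain.filter (· ≤ p.comp r)).card =
        (c.cell.chain.filter (· ≤ r)).card + 1 := by
      have : (c.cons p hp).cell.chain.filter (· ≤ p.comp r) = insert p
          ((c.cell.chain.filter (· ≤ r)).map ⟨p.comp, Under.comp_injective p⟩) := by
        ext s
        change s ∈ Finset.filter _ (c.cons p hp).1 ↔ _
        rw [Finset.mem_filter, Chains.mem_cons, Finset.mem_insert, Finset.mem_map]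
        constructor
        · rintro ⟨rfl | ⟨t, ht, rfl⟩, h⟩
          · exact Or.inl rfl
          · exact Or.inr ⟨t, Finset.mem_filter.2 ⟨ht, (Under.comp_le_comp_iff p _ _).1 h⟩, rfl⟩
        · rintro (rfl | ⟨t, ht, rfl⟩)
          · exact ⟨Or.inl rfl, Under.le_comp _ _⟩
          · have := Finset.mem_filter.1 ht
            exact ⟨Or.inr ⟨t, this.1, rfl⟩, (Under.comp_le_comp_iff p _ _).2 this.2⟩
      rw [this, Finset.card_insert_of_notMem, Finset.card_map]
      rw [Finset.mem_map]
      rintro ⟨t, ht, h⟩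
      exact Under.comp_ne_self (Chains.ne_bot (Finset.mem_filter.1 ht).1) h
    unfold innerWeight
    have hiff := htop r hr
    change (-1) ^ ((c.cons p hp).cell.chain.filter (· ≤ p.comp r)).card *
      (if p.comp r = (c.cons p hp).cell.top then _ else _) = _
    rw [hcard, Chains.lastStep_cons p hp hc, pow_succ, mul_neg_one, neg_mul]
    simp only [hiff]

theorem shiftMap_cons {v : V} (p : A.Under v) (r : A.Under p.head) (hr : r ≠ ⊥)
    (x : A.Chains r.head →₀ R) :
    shiftMap rho p (consMap R r hr x) =
      consMap R (p.comp r) (Under.comp_ne_bot_of_right hr) x := by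
  have h : shiftMap rho p ∘ₗ consMap R r hr =
      (show (A.Chains r.head →₀ R) →ₗ[R] (A.Chains v →₀ R) from
        consMap R (p.comp r) (Under.comp_ne_bot_of_right hr)) := by
    refine Finsupp.lhom_ext fun c s => ?_
    refine Eq.trans ?_ (consMap_single (p.comp r) (Under.comp_ne_bot_of_right hr) c s).symm
    rw [LinearMap.comp_apply, consMap_single, shiftMap_single_of_nonempty]
    · exact congrArg (Finsupp.single · s) Chains.shift_cons
    · exact ⟨r, Chains.mem_cons.2 (Or.inl rfl)⟩
  exact LinearMap.congr_fun h x

theorem shiftMap_shiftMap {v : V} (p : A.Under v) (r : A.Under p.head)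
    (x : A.Chains r.head →₀ R) :
    shiftMap rho p (shiftMap rho r x) = shiftMap rho (p.comp r) x := by
  have h : shiftMap rho p ∘ₗ shiftMap rho r =
      (show (A.Chains r.head →₀ R) →ₗ[R] (A.Chains v →₀ R) from shiftMap rho (p.comp r)) := by
    refine Finsupp.lhom_ext fun c s => ?_
    rw [LinearMap.comp_apply]
    by_cases hc : c.1.Nonempty
    · refine Eq.trans ?_ (shiftMap_single_of_nonempty rho (p.comp r) hc s).symm
      rw [shiftMap_single_of_nonempty rho r hc, shiftMap_single_of_nonempty]
      · exact congrArg (Finsupp.single · s) Chains.shift_shift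
      · simpa [Chains.shift] using hc
    · obtain rfl := Chains.eq_empty_of_not_nonempty hc
      rw [shiftMap_single_empty, shiftMap_single_empty]
      refine Eq.trans ?_ (shiftMap_single_empty rho (p.comp r) s).symm
      rw [Under.toAlg_comp, op_mul, map_mul, mul_assoc]
  exact LinearMap.congr_fun h x

theorem innerBoundary_shiftMap {v : V} (p : A.Under v) (x : A.Chains p.head →₀ R) :
    innerBoundary rho v (shiftMap rho p x) = shiftMap rho p (innerBoundary rho p.head x) := by
  have h : innerBoundary rho v ∘ₗ shiftMap rho p = shiftMap rho p ∘ₗ innerBoundary rho p.head := by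
    refine Finsupp.lhom_ext fun c s => ?_
    rw [map_single (innerBoundary rho v ∘ₗ shiftMap rho p),
      map_single (shiftMap rho p ∘ₗ innerBoundary rho p.head)]
    congr 1
    simp only [LinearMap.comp_apply]
    by_cases hc : c.1.Nonempty
    · obtain ⟨r, hr, d, rfl⟩ := Chains.exists_eq_cons hc
      rw [innerBoundary_cons, map_sub, map_neg, shiftMap_cons, shiftMap_shiftMap,
        ← consMap_single, shiftMap_cons]
      exact (congrArg _ (consMap_single (p.comp r) _ d 1)).trans
        (innerBoundary_cons rho (p.comp r) _ d)
    · obtain rfl := Chains.eq_empty_of_not_nonempty hc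
      rw [shiftMap_single_empty, innerBoundary_empty, innerBoundary_empty, map_zero]
  exact LinearMap.congr_fun h x

theorem innerBoundary_consMap {v : V} (p : A.Under v) (hp : p ≠ ⊥) (x : A.Chains p.head →₀ R) :
    innerBoundary rho v (consMap R p hp x) =
      - shiftMap rho p x - consMap R p hp (innerBoundary rho p.head x) := by
  induction x using Finsupp.induction_linear with
  | zero => simp
  | add x y hx hy => simp only [map_add, hx, hy]; abel
  | single c s =>
    have h1 : Finsupp.single c s = s • Finsupp.single c (1 : R) := by simp
    rw [h1]
    simp only [map_smul]
    rw [consMap_single, innerBoundary_cons, smul_sub, smul_neg]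

/-- With `S` for shifting and `C` for prepending, the boundary of `C c` is `-S c - C ∂c`. As `S`
commutes with the boundary, the square is `-S ∂c + S ∂c + C ∂∂c`, and induction applies. -/
theorem innerBoundary_sq {v : V} (c : A.Chains v) :
    innerBoundary rho v (innerBoundary rho v (Finsupp.single c 1)) = 0 := by
  induction v, c using Chains.induction with
  | empty v => rw [innerBoundary_empty, map_zero]
  | cons v p hp c ih =>
    rw [innerBoundary_cons, map_sub, map_neg, innerBoundary_consMap, innerBoundary_shiftMap, ih]
    simp

theorem initialBoundary_shiftMap {v : V} (p : A.Under v) (c : A.Chains p.head) :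
    initialBoundary lam v (shiftMap rho p (Finsupp.single c 1)) =
      lam p.toAlg • initialBoundary lam p.head (Finsupp.single c 1) := by
  by_cases hc : c.1.Nonempty
  · obtain ⟨r, hr, d, rfl⟩ := Chains.exists_eq_cons hc
    rw [← consMap_single, shiftMap_cons, consMap_single,
      initialBoundary_single_cons, Finsupp.smul_single]
    refine (congrArg _ (consMap_single (p.comp r) _ d 1)).trans ?_
    refine (initialBoundary_single_cons lam (p.comp r) _ d 1).trans ?_
    rw [Under.toAlg_comp, map_mul, one_mul, one_mul, smul_eq_mul]
    rfl
  · obtain rfl := Chains.eq_empty_of_not_nonempty hc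
    rw [shiftMap_single_empty, initialBoundary_single_empty, initialBoundary_single_empty,
      smul_zero]

/-- Here a left weight passes a right weight; this is where the two have to commute. -/
theorem initialBoundary_consMap (hcomm : ∀ a b, Commute (lam a) (rho b)) {v : V} (p : A.Under v)
    (hp : p ≠ ⊥) (c : A.Chains p.head) :
    initialBoundary lam v (consMap R p hp (innerBoundary rho p.head (Finsupp.single c 1))) =
      lam p.toAlg • toCells R p.head (innerBoundary rho p.head (Finsupp.single c 1)) := by
  rw [innerBoundary_single]
  simp only [map_sum, Finset.smul_sum]
  refine Finset.sum_congr rfl fun q _ => ?_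
  rw [consMap_single, initialBoundary_single_cons, toCells_single, Finsupp.smul_single, smul_eq_mul]
  congr 1
  unfold innerWeight
  refine Commute.mul_left (Commute.pow_left (Commute.neg_one_left _) _) ?_
  split_ifs
  · exact (hcomm _ _).symm
  · exact Commute.one_left _

theorem boundary_toCells {v : V} (x : A.Chains v →₀ R) :
    boundary (stepWeight lam rho) (toCells R v x) =
      initialBoundary lam v x + toCells R v (innerBoundary rho v x) := by
  have h : boundary (stepWeight lam rho) ∘ₗ toCells R v =
      initialBoundary lam v + toCells R v ∘ₗ innerBoundary rho v := by
    refine Finsupp.lhom_ext fun c s => ?_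
    rw [map_single, map_single (initialBoundary lam v + toCells R v ∘ₗ innerBoundary rho v)]
    congr 1
    rw [LinearMap.comp_apply, toCells_single, boundary_single_cell]
    rfl
  exact LinearMap.congr_fun h x

theorem boundary_cons {v : V} (p : A.Under v) (hp : p ≠ ⊥) (c : A.Chains p.head) :
    boundary (stepWeight lam rho) (Finsupp.single (c.cons p hp).cell 1) =
      Finsupp.single c.cell (lam p.toAlg) - toCells R v (shiftMap rho p (Finsupp.single c 1)) -
        toCells R v (consMap R p hp (innerBoundary rho p.head (Finsupp.single c 1))) := by
  rw [boundary_single_cell, initialBoundary_single_cons, innerBoundary_cons, map_sub, map_neg,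
    one_mul]
  abel

/-- The differential with multiplicative weights squares to zero. -/
theorem boundary_sq (hcomm : ∀ a b, Commute (lam a) (rho b)) :
    boundary (stepWeight lam rho) * boundary (stepWeight lam rho) = 0 := by
  refine end_ext fun η => ?_
  obtain ⟨v, c, hη⟩ : ∃ v, ∃ c : A.Chains v, η = c.cell :=
    ⟨η.tail, ⟨η.chain, η.isChain, η.bot_notMem⟩, rfl⟩
  subst hη
  rw [Module.End.mul_apply, LinearMap.zero_apply, boundary_single_cell]
  by_cases hc : c.1.Nonempty
  · obtain ⟨p, hp, d, rfl⟩ := Chains.exists_eq_cons hc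
    -- The boundary of the initial facet, scaled by `lam p`, consists of an initial and an inner
    -- part. These cancel against the initial facets of the shifted chain and of the chains starting
    -- with `p`.
    rw [map_add, boundary_toCells, innerBoundary_sq, map_zero, add_zero, innerBoundary_cons,
      map_sub, map_neg, initialBoundary_shiftMap, initialBoundary_consMap lam rho hcomm,
      initialBoundary_single_cons, map_single, boundary_single_cell, smul_add, one_mul]
    abel
  · obtain rfl := Chains.eq_empty_of_not_nonempty hc
    rw [innerBoundary_empty, initialBoundary_single_empty]
    simp

theorem stepWeight_of_inner {η : A.Cell} {q : A.Under η.tail} (hq : q ∈ η.chain)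
    (hq' : q ≠ η.top) : stepWeight lam rho η (η.erase q) = 1 := by
  unfold stepWeight
  have h : η.erase q ≠ η.terminalFacet := fun h => hq' (Cell.erase_injOn hq h)
  rw [if_neg (Cell.erase_ne_initialFacet ⟨q, hq⟩ q), if_neg h, one_mul]

/-- Matched edges are inner and split off nothing. Hence the matched part of the differential is
invertible whatever the weights are. -/
theorem IsMorseMatching.stepWeight_eq_one {M : Set (A.Cell × A.Cell)} (hM : IsMorseMatching M)
    (ρ τ : A.Cell) (h : (ρ, τ) ∈ M) : stepWeight lam rho ρ τ = 1 := by
  obtain ⟨q, hq, hq', rfl⟩ := hM.inner h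
  exact stepWeight_of_inner lam rho hq hq'

end

end HPA

/-! ### The matching on the geometric realization is acyclic -/

namespace OrderComplex

open scoped Classical in
theorem Simplex.mem_erase {P : Type*} [PartialOrder P] {σ : Simplex P} {q x : P} :
    x ∈ (σ.erase q).1 ↔ x ≠ q ∧ x ∈ σ.1 := Finset.mem_erase

open scoped Classical in
theorem Simplex.card_erase {P : Type*} [PartialOrder P] {σ : Simplex P} {q : P} (h : q ∈ σ.1) :
    (σ.erase q).1.card + 1 = σ.1.card := Finset.card_erase_add_one h

open scoped Classical in
theorem LexOrder.Matched.exists_erase {P : Type*} [PartialOrder P] {o : LexOrder P}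
    {τ σ : Simplex P} (h : o.Matched τ σ) : ∃ x ∈ τ.1, τ.erase x = σ := by
  obtain ⟨-, F, -, -, x, hx, -, hτ⟩ := h
  refine ⟨x, by simp [hτ], Subtype.ext ?_⟩
  exact (congrArg (Finset.erase · x) hτ).trans (Finset.erase_insert hx)

end OrderComplex

namespace HPA

noncomputable section

open scoped Classical
open PathAlgebra OrderComplex MulOpposite

variable {k V : Type*} [CommRing k] [Quiver V] [Fintype V] {A : HPA k V}

section CellOf

variable {v : V} {p : A.Under v} {hp : p ≠ ⊥}

theorem mem_cellOf {σ : Simplex (Interval p)} {q : A.Under v} :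
    q ∈ (cellOf p hp σ).chain ↔ q = p ∨ ∃ y ∈ σ.1, y.1 = q := by
  change q ∈ insert p (Finset.map _ σ.1) ↔ _
  rw [Finset.mem_insert, Finset.mem_map]
  rfl

theorem top_cellOf (σ : Simplex (Interval p)) : (cellOf p hp σ).top = p := by
  refine Cell.top_eq ⟨Finset.mem_coe.2 (mem_cellOf.2 (Or.inl rfl)), fun s hs => ?_⟩
  rcases (mem_cellOf (hp := hp)).1 (Finset.mem_coe.1 hs) with h | ⟨y, -, h⟩
  · exact h.le
  · exact h ▸ y.2.2.le

theorem erase_cellOf (σ : Simplex (Interval p)) (y : Interval p) :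
    (cellOf p hp σ).erase y.1 = cellOf p hp (σ.erase y) := by
  refine Cell.ext_chain.2 ?_
  ext q
  refine Finset.mem_erase.trans (Iff.trans (and_congr_right fun _ => mem_cellOf)
    (Iff.trans ?_ (mem_cellOf (hp := hp)).symm))
  constructor
  · rintro ⟨hq, h | ⟨z, hz, rfl⟩⟩
    · exact Or.inl h
    · exact Or.inr ⟨z, Simplex.mem_erase.2 ⟨fun h => hq (congrArg _ h), hz⟩, rfl⟩
  · rintro (h | ⟨z, hz, rfl⟩)
    · exact ⟨fun h' => ne_of_lt y.2.2 (h'.symm.trans h), Or.inl h⟩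
    · rw [Simplex.mem_erase] at hz
      exact ⟨fun h => hz.1 (Subtype.ext h), Or.inr ⟨z, hz.2, rfl⟩⟩

theorem cellOf_injective : Function.Injective (cellOf p hp) := by
  intro σ σ' h
  have h1 : insert p (σ.1.map (Function.Embedding.subtype _)) =
      insert p (σ'.1.map (Function.Embedding.subtype _)) := Cell.ext_chain.1 h
  have hnot : ∀ σ : Simplex (Interval p), p ∉ σ.1.map (Function.Embedding.subtype _) := by
    intro σ h
    obtain ⟨y, -, hy⟩ := Finset.mem_map.1 h
    exact absurd hy (ne_of_lt y.2.2)
  refine Subtype.ext (Finset.map_injective (Function.Embedding.subtype _) ?_)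
  rw [← Finset.erase_insert (hnot σ), ← Finset.erase_insert (hnot σ'), h1]

end CellOf

variable (A) in
/-- The data of a cell of positive dimension. -/
abbrev IntervalSimplex : Type _ :=
  Σ v : V, Σ p : {p : A.Under v // p ≠ ⊥}, Simplex (Interval p.1)

/-- The cell with the given data. -/
def IntervalSimplex.cell (x : IntervalSimplex A) : A.Cell := cellOf x.2.1.1 x.2.1.2 x.2.2

theorem IntervalSimplex.cell_injective :
    Function.Injective (IntervalSimplex.cell (A := A)) := by
  rintro ⟨v, ⟨p, hp⟩, σ⟩ ⟨v', ⟨p', hp'⟩, σ'⟩ h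
  obtain rfl : v = v' := congrArg Cell.tail h
  change cellOf p hp σ = cellOf p' hp' σ' at h
  have htop : ∀ c d : A.Cell, c = d → HEq c.top d.top := by
    rintro c _ rfl; rfl
  obtain rfl : p = p' := by
    rw [← top_cellOf (hp := hp) σ, ← top_cellOf (hp := hp') σ']
    exact eq_of_heq (htop _ _ h)
  rw [cellOf_injective h]

/-- A cell of positive dimension determines its vertex, its top path and its simplex; in this form
an equality of cells can be used although the types of the simplices depend on the path. -/
theorem IntervalSimplex.ind {motive : ∀ (v' : V) (p' : A.Under v') (_ : p' ≠ ⊥),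
      Simplex (Interval p') → Prop} {v v' : V} {p : A.Under v} {p' : A.Under v'} {hp : p ≠ ⊥}
    {hp' : p' ≠ ⊥} {σ : Simplex (Interval p)} {σ' : Simplex (Interval p')}
    (h : cellOf p hp σ = cellOf p' hp' σ') (hm : motive v' p' hp' σ') : motive v p hp σ := by
  have h' : (⟨v, ⟨p, hp⟩, σ⟩ : IntervalSimplex A) = ⟨v', ⟨p', hp'⟩, σ'⟩ :=
    IntervalSimplex.cell_injective h
  cases h'
  exact hm

variable [∀ v w : V, Finite (v ⟶ w)]

namespace BabsonHersh

variable (B : A.BabsonHersh)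

/-- The pairs of simplices that give the matched pairs of cells. -/
def Pair {v : V} (p : A.Under v) (τ σ : Simplex (Interval p)) : Prop :=
  (B.order p).Matched τ σ ∨ ∃ h : Nonempty (Interval p), τ = vertex (B.base p h) ∧ σ.1 = ∅

variable {B}

theorem mem_matching_right {v : V} {p : A.Under v} {hp : p ≠ ⊥} {σ : Simplex (Interval p)}
    {ρ : A.Cell} :
    (ρ, cellOf p hp σ) ∈ B.matching ↔ ∃ τ, ρ = cellOf p hp τ ∧ B.Pair p τ σ := by
  constructor
  · rintro ⟨v', p', hp', τ', σ', h, hpair⟩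
    rw [Prod.mk.injEq] at h
    obtain ⟨rfl, h⟩ := h
    exact IntervalSimplex.ind (motive := fun v p hp σ =>
      ∃ τ, cellOf p' hp' τ' = cellOf p hp τ ∧ B.Pair p τ σ) h ⟨τ', rfl, hpair⟩
  · rintro ⟨τ, rfl, h⟩
    exact ⟨v, p, hp, τ, σ, rfl, h⟩

theorem mem_matching_left {v : V} {p : A.Under v} {hp : p ≠ ⊥} {τ : Simplex (Interval p)}
    {ω : A.Cell} :
    (cellOf p hp τ, ω) ∈ B.matching ↔ ∃ σ, ω = cellOf p hp σ ∧ B.Pair p τ σ := by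
  constructor
  · rintro ⟨v', p', hp', τ', σ', h, hpair⟩
    rw [Prod.mk.injEq] at h
    obtain ⟨h, rfl⟩ := h
    exact IntervalSimplex.ind (motive := fun v p hp τ =>
      ∃ σ, cellOf p' hp' σ' = cellOf p hp σ ∧ B.Pair p τ σ) h ⟨σ', rfl, hpair⟩
  · rintro ⟨σ, rfl, h⟩
    exact ⟨v, p, hp, τ, σ, rfl, h⟩

theorem Pair.exists_erase {v : V} {p : A.Under v} {τ σ : Simplex (Interval p)}
    (h : B.Pair p τ σ) : ∃ x ∈ τ.1, τ.erase x = σ := by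
  rcases h with h | ⟨h, rfl, hσ⟩
  · exact h.exists_erase
  · refine ⟨B.base p h, by simp [vertex], Subtype.ext ?_⟩
    rw [hσ]
    simp [Simplex.erase, vertex]

theorem Pair.left_unique {v : V} {p : A.Under v} {τ τ' σ : Simplex (Interval p)}
    (h : B.Pair p τ σ) (h' : B.Pair p τ' σ) : τ = τ' := by
  rcases h with h | ⟨h, rfl, hσ⟩ <;> rcases h' with h' | ⟨h', rfl, hσ'⟩
  · exact h.left_unique h'
  · exact absurd hσ' h.1.ne_empty
  · exact absurd hσ h'.1.ne_empty
  · rfl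

/-- The extra pair could only clash with the Babson-Hersh pairs at the base vertex, which was chosen
unmatched. -/
theorem Pair.right_unique {v : V} {p : A.Under v} {τ σ σ' : Simplex (Interval p)}
    (h : B.Pair p τ σ) (h' : B.Pair p τ σ') : σ = σ' := by
  rcases h with h | ⟨h, rfl, hσ⟩ <;> rcases h' with h' | ⟨h', h1, hσ'⟩
  · exact h.right_unique h'
  · exact absurd (h1 ▸ h) (B.base_unmatched p h' σ).2
  · exact absurd h' (B.base_unmatched p h σ').2
  · exact Subtype.ext (hσ.trans hσ'.symm)

theorem Pair.not_both {v : V} {p : A.Under v} {τ σ ρ : Simplex (Interval p)}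
    (h : B.Pair p τ σ) : ¬ B.Pair p σ ρ := by
  intro h'
  obtain ⟨x, hx, -⟩ := h'.exists_erase
  rcases h with h | ⟨h, rfl, hσ⟩
  · rcases h' with h' | ⟨h', rfl, -⟩
    · exact h'.not_matched h
    · exact (B.base_unmatched p h' τ).1 h
  · rw [hσ] at hx
    simp at hx

end BabsonHersh

/-- The number of paths below the top of a cell. -/
def Cell.size (η : A.Cell) : ℕ := (Set.Iic η.top).ncard

theorem Cell.size_erase {η : A.Cell} {q : A.Under η.tail} (hq : q ≠ η.top) :
    (η.erase q).size = η.size := by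
  unfold Cell.size
  rw [Cell.top_erase hq]
  rfl

theorem Cell.size_terminalFacet {η : A.Cell} (h : η.chain.Nonempty) :
    η.terminalFacet.size < η.size := by
  have htop := Cell.isGreatest_top h
  have hlt : η.terminalFacet.top < η.top := by
    refine lt_of_le_of_ne (Chains.erase_top_le η) fun heq => ?_
    rcases η.terminalFacet.chain.eq_empty_or_nonempty with h' | h'
    · rw [Cell.top_of_empty h'] at heq
      exact Cell.ne_bot_of_mem htop.1 heq.symm
    · have h1 := (Cell.isGreatest_top h').1
      rw [heq] at h1
      exact (Finset.mem_erase.1 h1).1 rfl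
  unfold Cell.size
  exact Set.ncard_lt_ncard (Set.Iic_ssubset_Iic.2 hlt) (Set.toFinite _)

/-- Multiplication by `p` embeds the paths below the old top into those below the new one and misses
the constant path. -/
theorem Cell.size_cons {v : V} (p : A.Under v) (hp : p ≠ ⊥) (c : A.Chains p.head) :
    c.cell.size < (c.cons p hp).cell.size := by
  unfold Cell.size
  rw [Chains.top_cons, ← Set.ncard_image_of_injective _ (Under.comp_injective p)]
  refine Set.ncard_lt_ncard ⟨?_, fun h => ?_⟩ (Set.toFinite _)
  · rintro _ ⟨r, hr, rfl⟩
    exact (Under.comp_le_comp_iff p _ _).2 hr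
  · obtain ⟨r, -, hr⟩ := h (show (⊥ : A.Under v) ∈ Set.Iic _ from Set.mem_Iic.2 bot_le)
    exact Under.comp_ne_bot hp r hr

theorem Cell.exists_chain (η : A.Cell) : ∃ v, ∃ c : A.Chains v, η = c.cell :=
  ⟨η.tail, ⟨η.chain, η.isChain, η.bot_notMem⟩, rfl⟩

theorem Cell.size_initialFacet {η : A.Cell} (h : η.chain.Nonempty) :
    η.initialFacet.size < η.size := by
  obtain ⟨v, c, rfl⟩ := η.exists_chain
  obtain ⟨p, hp, d, rfl⟩ := Chains.exists_eq_cons h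
  rw [Chains.initialFacet_cons]
  exact Cell.size_cons p hp d

/-- The facets that split off a path make the cell strictly smaller, so an alternating path that
splits something off never returns to its interval. Both acyclicity and the reduction modulo the
arrows rest on this dichotomy. -/
theorem Cell.IsFacet.size_lt_or {η τ : A.Cell} (h : τ.IsFacet η) :
    τ.size < η.size ∨ ∃ q ∈ η.chain, q ≠ η.top ∧ τ = η.erase q := by
  obtain ⟨hne, rfl | ⟨q, hq, rfl⟩⟩ := h
  · exact Or.inl (Cell.size_initialFacet hne)
  · by_cases hq' : q = η.top
    · rw [hq']; exact Or.inl (Cell.size_terminalFacet hne)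
    · exact Or.inr ⟨q, hq, hq', rfl⟩

namespace BabsonHersh

variable (B : A.BabsonHersh)

/-- The height of the simplex of a cell. -/
def height : A.Cell → ℕ × ℕ :=
  Function.extend IntervalSimplex.cell (fun x => (B.order x.2.1.1).height x.2.2.1) 0

theorem height_cellOf {v : V} (p : A.Under v) (hp : p ≠ ⊥) (σ : Simplex (Interval p)) :
    B.height (cellOf p hp σ) = (B.order p).height σ.1 :=
  IntervalSimplex.cell_injective.extend_apply _ _ (⟨v, ⟨p, hp⟩, σ⟩ : IntervalSimplex A)

/-- The matching of Babson and Hersh on the cells of `X_A` is an acyclic matching. -/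
theorem isMorseMatching : IsMorseMatching B.matching where
  inner := by
    rintro ρ τ ⟨v, p, hp, T, S, h, hpair⟩
    rw [Prod.mk.injEq] at h
    obtain ⟨rfl, rfl⟩ := h
    obtain ⟨x, hx, rfl⟩ := Pair.exists_erase hpair
    refine ⟨x.1, mem_cellOf.2 (Or.inr ⟨x, hx, rfl⟩), ?_, (erase_cellOf T x).symm⟩
    rw [top_cellOf]
    exact ne_of_lt x.2.2
  left_unique := by
    rintro ρ ρ' τ ⟨v, p, hp, T, S, h, hpair⟩ h'
    rw [Prod.mk.injEq] at h
    obtain ⟨rfl, rfl⟩ := h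
    obtain ⟨T', rfl, hpair'⟩ := mem_matching_right.1 h'
    rw [Pair.left_unique hpair hpair']
  right_unique := by
    rintro ρ τ τ' ⟨v, p, hp, T, S, h, hpair⟩ h'
    rw [Prod.mk.injEq] at h
    obtain ⟨rfl, rfl⟩ := h
    obtain ⟨S', rfl, hpair'⟩ := mem_matching_left.1 h'
    rw [Pair.right_unique hpair hpair']
  not_both := by
    rintro ρ τ ω ⟨v, p, hp, T, S, h, hpair⟩ h'
    rw [Prod.mk.injEq] at h
    obtain ⟨rfl, rfl⟩ := h
    obtain ⟨S', rfl, hpair'⟩ := mem_matching_left.1 h'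
    exact Pair.not_both hpair hpair'
  wf := by
    have hsize : ∀ {ρ τ : A.Cell}, (ρ, τ) ∈ B.matching → ρ.size = τ.size := by
      rintro ρ τ ⟨v, p, hp, T, S, h, hpair⟩
      rw [Prod.mk.injEq] at h
      obtain ⟨rfl, rfl⟩ := h
      unfold Cell.size
      rw [top_cellOf, top_cellOf]
      rfl
    -- Each step of an alternating path ends in an upper cell, so accessibility is needed only for
    -- these. The comparison inside an interval uses the partner of `η`.
    have key : ∀ η τ₀ : A.Cell, (η, τ₀) ∈ B.matching →
        Acc (fun ρ η : A.Cell => ∃ τ : A.Cell, τ.IsFacet η ∧ (η, τ) ∉ B.matching ∧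
          (ρ, τ) ∈ B.matching) η := by
      -- The measure is the number of paths below the top, followed by the height of the simplex
      -- inside its interval.
      have hwf : WellFounded (Prod.Lex (· < ·) (Prod.Lex (· < ·) (· < ·)) :
          ℕ × ℕ × ℕ → ℕ × ℕ × ℕ → Prop) :=
        WellFounded.prod_lex wellFounded_lt (WellFounded.prod_lex wellFounded_lt wellFounded_lt)
      intro η
      induction η using (InvImage.wf (fun η : A.Cell => (η.size, B.height η)) hwf).induction with
      | _ η ih =>
        intro τ₀ hη
        refine Acc.intro _ ?_
        rintro ρ ⟨τ, hτ, hητ, hρ⟩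
        refine ih ρ ?_ τ hρ
        change Prod.Lex _ _ (ρ.size, B.height ρ) (η.size, B.height η)
        rcases hτ.size_lt_or with hlt | ⟨q, hq, hqtop, rfl⟩
        · exact Prod.Lex.left _ _ (hsize hρ ▸ hlt)
        rw [hsize hρ, Cell.size_erase hqtop]
        refine Prod.Lex.right _ ?_
        obtain ⟨v, p, hp, T, S, h, hpair⟩ := hη
        rw [Prod.mk.injEq] at h
        obtain ⟨rfl, rfl⟩ := h
        rw [top_cellOf] at hqtop
        obtain ⟨y, hy, rfl⟩ := (mem_cellOf.1 hq).resolve_left hqtop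
        rw [erase_cellOf] at hρ hητ
        obtain ⟨T', rfl, hpair'⟩ := mem_matching_right.1 hρ
        rw [height_cellOf, height_cellOf]
        have hne : T.erase y ≠ S := fun h => hητ (mem_matching_left.2 ⟨S, by rw [h], hpair⟩)
        rcases hpair with hpair | ⟨h, rfl, hS⟩
        · rcases hpair' with hpair' | ⟨h, rfl, hS'⟩
          · exact LexOrder.height_lt hpair hpair' hne (q := y) rfl
          -- If a vertex of `T` is deleted and the empty simplex remains, then `T` is a vertex; but
          -- its partner is nonempty, so `T` has at least two.
          · exfalso
            obtain ⟨x, hx, rfl⟩ := hpair.exists_erase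
            have hcard := Finset.card_pos.2 hpair.1
            have h1 := Simplex.card_erase hx
            have h2 := Simplex.card_erase hy
            rw [hS', Finset.card_empty] at h2
            omega
        -- The base vertex has only the empty face, which is its own partner and hence not reached
        -- along an unmatched edge.
        · exfalso
          refine hne (Subtype.ext ?_)
          rw [hS]
          have : y = B.base p h := by simpa [vertex] using hy
          simp [Simplex.erase, vertex, this]
    refine ⟨fun η => Acc.intro _ ?_⟩
    rintro ρ ⟨τ, -, -, hρ⟩
    exact key ρ τ hρ

end BabsonHersh

end

end HPA

/-! ### Gradings of the complex on the cells -/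

namespace HPA

noncomputable section

open scoped Classical
open PathAlgebra OrderComplex MulOpposite

section Supported

variable {X Y R : Type*} [Ring R]

theorem map_supported {N : Type*} [AddCommGroup N] [Module R N] {f : (X →₀ R) →ₗ[R] N}
    {s : Set X} {T : Submodule R N} (h : ∀ η ∈ s, f (Finsupp.single η 1) ∈ T) {x : X →₀ R}
    (hx : x ∈ Finsupp.supported R R s) : f x ∈ T := by
  rw [Finsupp.supported_eq_span_single] at hx
  have hle : Submodule.span R ((fun i => Finsupp.single i (1 : R)) '' s) ≤ T.comap f := by
    rw [Submodule.span_le]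
    rintro _ ⟨η, hη, rfl⟩
    exact h η hη
  exact hle hx

theorem single_mem_supported {s : Set X} {η : X} (h : η ∈ s) (r : R) :
    Finsupp.single η r ∈ Finsupp.supported R R s :=
  Finsupp.single_mem_supported R r h

theorem mem_supported_iff {s : Set X} {x : X →₀ R} :
    x ∈ Finsupp.supported R R s ↔ ∀ η, η ∉ s → x η = 0 := by
  rw [Finsupp.mem_supported']

/-- Extension by zero along an injective map. -/
abbrev extendMap (R : Type*) [Ring R] (f : Y → X) : (Y →₀ R) →ₗ[R] (X →₀ R) :=
  Finsupp.lmapDomain R R f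

/-- Restriction along an injective map. -/
abbrev restrictMap (R : Type*) [Ring R] {f : Y → X} (hf : Function.Injective f) :
    (X →₀ R) →ₗ[R] (Y →₀ R) :=
  Finsupp.lcomapDomain f hf

theorem restrictMap_apply {f : Y → X} (hf : Function.Injective f) (x : X →₀ R) (y : Y) :
    restrictMap R hf x y = x (f y) := rfl

theorem extendMap_single (f : Y → X) (y : Y) (r : R) :
    extendMap R f (Finsupp.single y r) = Finsupp.single (f y) r := by
  simp

theorem extendMap_apply {f : Y → X} (hf : Function.Injective f) (y : Y →₀ R) (a : Y) :
    extendMap R f y (f a) = y a :=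
  Finsupp.mapDomain_apply hf y a

theorem extendMap_mem {f : Y → X} {s : Set X} (h : ∀ y, f y ∈ s) (y : Y →₀ R) :
    extendMap R f y ∈ Finsupp.supported R R s := by
  rw [mem_supported_iff]
  intro η hη
  refine Finsupp.mapDomain_of_notMem_range y η ?_
  rintro ⟨y, rfl⟩
  exact hη (h y)

theorem extendMap_restrictMap {f : Y → X} (hf : Function.Injective f) {s : Set X}
    (h : ∀ x ∈ s, x ∈ Set.range f) {x : X →₀ R} (hx : x ∈ Finsupp.supported R R s) :
    extendMap R f (restrictMap R hf x) = x := by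
  ext η
  by_cases hη : η ∈ Set.range f
  · obtain ⟨y, rfl⟩ := hη
    rw [extendMap_apply hf, restrictMap_apply]
  · rw [mem_supported_iff.1 hx η fun h' => hη (h η h')]
    exact Finsupp.mapDomain_of_notMem_range _ η hη

theorem extendMap_injective {f : Y → X} (hf : Function.Injective f) :
    Function.Injective (extendMap R f) := Finsupp.mapDomain_injective hf

end Supported

variable {k V : Type*} [CommRing k] [Quiver V] [Fintype V] {A : HPA k V}
  [∀ v w : V, Finite (v ⟶ w)] {R : Type*} [Ring R]

/-- A grading of a set of cells that is compatible with the differential and the matching. -/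
structure IsGrading (M : Set (A.Cell × A.Cell)) (w : A.Cell → A.Cell → R)
    (s : ℕ → Set A.Cell) : Prop where
  zero : ∀ η ∈ s 0, ∀ τ : A.Cell, τ.IsFacet η → w η τ = 0
  succ : ∀ n, ∀ η ∈ s (n + 1), ∀ τ : A.Cell, τ.IsFacet η → w η τ ≠ 0 → τ ∈ s n
  up : ∀ n ρ τ, (ρ, τ) ∈ M → τ ∈ s n → ρ ∈ s (n + 1)

namespace IsGrading

variable {M : Set (A.Cell × A.Cell)} {w : A.Cell → A.Cell → R} {s : ℕ → Set A.Cell}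

theorem boundary_zero (hs : IsGrading M w s) {x : A.Cell →₀ R}
    (hx : x ∈ Finsupp.supported R R (s 0)) : boundary w x = 0 := by
  have h : boundary w x ∈ (⊥ : Submodule R (A.Cell →₀ R)) := by
    refine map_supported (fun η hη => ?_) hx
    rw [Submodule.mem_bot]
    refine ofMatrix_single_eq_zero (fun τ => ?_) _
    by_cases h : τ.IsFacet η
    · rw [hs.zero η hη τ h, smul_zero]
    · rw [Cell.incidence_eq_zero h, zero_smul]
  exact h

theorem boundary_mem (hs : IsGrading M w s) {n : ℕ} {x : A.Cell →₀ R}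
    (hx : x ∈ Finsupp.supported R R (s (n + 1))) :
    boundary w x ∈ Finsupp.supported R R (s n) := by
  refine map_supported (fun η hη => ?_) hx
  rw [mem_supported_iff]
  intro τ hτ
  rw [boundary_single_apply]
  by_cases h : τ.IsFacet η
  · by_cases hw : w η τ = 0
    · simp [hw]
    · exact absurd (hs.succ n η hη τ h hw) hτ
  · rw [Cell.incidence_eq_zero h]; simp

theorem cellProj_mem {t u : Set A.Cell} {x : A.Cell →₀ R} (hx : x ∈ Finsupp.supported R R t) :
    cellProj R u x ∈ Finsupp.supported R R t := by
  rw [mem_supported_iff] at hx ⊢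
  intro η hη
  rw [cellProj_apply, hx η hη, ite_self]

theorem matchUp_mem (hM : IsMorseMatching M) (hs : IsGrading M w s) {n : ℕ} {x : A.Cell →₀ R}
    (hx : x ∈ Finsupp.supported R R (s n)) :
    matchUp R M x ∈ Finsupp.supported R R (s (n + 1)) := by
  refine map_supported (fun η hη => ?_) hx
  by_cases h : η ∈ lowerCells M
  · obtain ⟨ρ, hρ⟩ := h
    rw [hM.matchUp_single hρ]
    exact single_mem_supported (hs.up n ρ η hρ hη) _
  · rw [IsMorseMatching.matchUp_single_eq_zero h]
    exact zero_mem _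

/-- Each step down of nonzero weight lowers the degree by one and the following step up restores it;
in degree 0 no such step exists. -/
theorem zigzagSum_mem (hM : IsMorseMatching M) (hw : ∀ ρ τ, (ρ, τ) ∈ M → w ρ τ = 1)
    (hs : IsGrading M w s) {n : ℕ} {x : A.Cell →₀ R} (hx : x ∈ Finsupp.supported R R (s n)) :
    zigzagSum M w x ∈ Finsupp.supported R R (s n) := by
  refine map_supported (fun η => ?_) hx
  induction η using hM.wf.induction with
  | _ η ih =>
    intro hη
    have h := LinearMap.congr_fun (hM.zigzagSum_eq w hw) (Finsupp.single η 1)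
    rw [mul_add, mul_one, LinearMap.add_apply, Module.End.mul_apply, Module.End.mul_apply,
      IsMorseMatching.matchUp_sub_single w hw, map_sum, map_sum, Module.End.one_apply] at h
    rw [eq_sub_of_add_eq h]
    refine Submodule.sub_mem _ (single_mem_supported hη _) (Submodule.sum_mem _ fun τ _ => ?_)
    by_cases h1 : (η, τ) ∈ M
    · simp [h1]
    by_cases h2 : τ.IsFacet η
    · by_cases h3 : τ ∈ lowerCells M
      · obtain ⟨ρ, hρ⟩ := h3
        by_cases hwτ : w η τ = 0
        · simp [hwτ]
        rw [hM.matchUp_single hρ, map_single]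
        refine Submodule.smul_mem _ _ (ih ρ ⟨τ, h2, h1, hρ⟩ ?_)
        cases n with
        | zero => exact absurd (hs.zero η hη τ h2) hwτ
        | succ n => exact hs.up n ρ τ hρ (hs.succ n η hη τ h2 hwτ)
      · rw [IsMorseMatching.matchUp_single_eq_zero h3, map_zero]
        exact zero_mem _
    · rw [Cell.incidence_eq_zero h2]; simp

section Datum

variable (hM : IsMorseMatching M) (hw : ∀ ρ τ, (ρ, τ) ∈ M → w ρ τ = 1)
  (hd : boundary w * boundary w = 0)

theorem incl_mem (hs : IsGrading M w s) {n : ℕ} {x : A.Cell →₀ R}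
    (hx : x ∈ Finsupp.supported R R (s n)) :
    (hM.datum w hw hd).incl x ∈ Finsupp.supported R R (s n) :=
  hs.zigzagSum_mem hM hw (cellProj_mem hx)

theorem htpy_mem (hs : IsGrading M w s) {n : ℕ} {x : A.Cell →₀ R}
    (hx : x ∈ Finsupp.supported R R (s n)) :
    (hM.datum w hw hd).htpy x ∈ Finsupp.supported R R (s (n + 1)) :=
  hs.zigzagSum_mem hM hw (hs.matchUp_mem hM hx)

theorem diff_mem (hs : IsGrading M w s) {n : ℕ} {x : A.Cell →₀ R}
    (hx : x ∈ Finsupp.supported R R (s (n + 1))) :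
    (hM.datum w hw hd).diff x ∈ Finsupp.supported R R (s n) :=
  cellProj_mem (hs.boundary_mem (hs.zigzagSum_mem hM hw (cellProj_mem hx)))

theorem diff_zero (hs : IsGrading M w s) {x : A.Cell →₀ R}
    (hx : x ∈ Finsupp.supported R R (s 0)) : (hM.datum w hw hd).diff x = 0 := by
  change cellProj R _ (boundary w (zigzagSum M w (cellProj R _ x))) = 0
  rw [hs.boundary_zero (hs.zigzagSum_mem hM hw (cellProj_mem hx)), map_zero]

theorem matchDown_mem (hs : IsGrading M w s) (hM : IsMorseMatching M)
    (hw : ∀ ρ τ, (ρ, τ) ∈ M → w ρ τ = 1) {n : ℕ} {x : A.Cell →₀ R}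
    (hx : x ∈ Finsupp.supported R R (s (n + 1))) :
    matchDown R M x ∈ Finsupp.supported R R (s n) := by
  refine map_supported (fun η hη => ?_) hx
  by_cases h : η ∈ upperCells M
  · obtain ⟨τ, hτ⟩ := h
    rw [hM.matchDown_single hτ]
    -- Over the zero ring the weight 1 is not different from 0, so `succ` says nothing; but there
    -- all coefficients vanish.
    rcases subsingleton_or_nontrivial R with hR | hR
    · rw [Subsingleton.elim (1 * ((η.incidence τ : ℤ) : R)) 0, Finsupp.single_zero]
      exact zero_mem _
    · refine single_mem_supported (hs.succ n η hη τ (hM.isFacet hτ) ?_) _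
      rw [hw _ _ hτ]
      exact one_ne_zero
  · rw [IsMorseMatching.matchDown_single_eq_zero h]
    exact zero_mem _

theorem proj_mem (hs : IsGrading M w s) {n : ℕ} {x : A.Cell →₀ R}
    (hx : x ∈ Finsupp.supported R R (s n)) :
    (hM.datum w hw hd).proj x ∈ Finsupp.supported R R (s n) := by
  change cellProj R _ ((1 - (boundary w - matchDown R M) * zigzagSum M w * matchUp R M) x) ∈ _
  refine cellProj_mem (Submodule.sub_mem _ hx ?_)
  have h1 := hs.zigzagSum_mem hM hw (hs.matchUp_mem hM hx)
  exact Submodule.sub_mem _ (hs.boundary_mem h1) (hs.matchDown_mem hM hw h1)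

end Datum

end IsGrading

/-- The grading of the cells by dimension. -/
theorem IsMorseMatching.isGrading_dim {M : Set (A.Cell × A.Cell)} (hM : IsMorseMatching M)
    (w : A.Cell → A.Cell → R) : IsGrading M w fun n => {η | η.dim = n} where
  zero := by
    intro η hη τ hτ
    rw [Set.mem_ofPred_eq] at hη
    have := hτ.dim_eq
    omega
  succ := by
    intro n η hη τ hτ _
    rw [Set.mem_ofPred_eq] at hη ⊢
    have := hτ.dim_eq
    omega
  up := by
    intro n ρ τ h hτ
    rw [Set.mem_ofPred_eq] at hτ ⊢
    rw [hM.dim_eq h, hτ]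

/-! ### The cellular complex -/

section HomotopyEquiv

open CategoryTheory

theorem nonempty_homotopyEquiv_of {W : Type*} [Category W] [Preadditive W] {X Y : ℕ → W}
    {dX : ∀ n, X (n + 1) ⟶ X n} {dY : ∀ n, Y (n + 1) ⟶ Y n}
    (hX : ∀ n, dX (n + 1) ≫ dX n = 0) (hY : ∀ n, dY (n + 1) ≫ dY n = 0)
    (i : ∀ n, X n ⟶ Y n) (p : ∀ n, Y n ⟶ X n) (h : ∀ n, Y n ⟶ Y (n + 1))
    (hi : ∀ n, i (n + 1) ≫ dY n = dX n ≫ i n) (hp : ∀ n, p (n + 1) ≫ dX n = dY n ≫ p n)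
    (hip : ∀ n, i n ≫ p n = 𝟙 _) (h0 : 𝟙 _ - p 0 ≫ i 0 = h 0 ≫ dY 0)
    (hs : ∀ n, 𝟙 _ - p (n + 1) ≫ i (n + 1) = dY n ≫ h n + h (n + 1) ≫ dY (n + 1)) :
    Nonempty (HomotopyEquiv (ChainComplex.of X dX hX) (ChainComplex.of Y dY hY)) := by
  let I : ChainComplex.of X dX hX ⟶ ChainComplex.of Y dY hY :=
    ChainComplex.ofHom i fun n => by
      have h1 : (ChainComplex.of Y dY hY).d (n + 1) n = dY n := ChainComplex.of_d _ _ _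
      have h2 : (ChainComplex.of X dX hX).d (n + 1) n = dX n := ChainComplex.of_d _ _ _
      rw [h1, h2]; exact hi n
  let P : ChainComplex.of Y dY hY ⟶ ChainComplex.of X dX hX :=
    ChainComplex.ofHom p fun n => by
      have h1 : (ChainComplex.of Y dY hY).d (n + 1) n = dY n := ChainComplex.of_d _ _ _
      have h2 : (ChainComplex.of X dX hX).d (n + 1) n = dX n := ChainComplex.of_d _ _ _
      rw [h1, h2]; exact hp n
  refine ⟨⟨I, P, Homotopy.ofEq (by ext n; exact hip n), (Homotopy.symm ?_)⟩⟩
  let H : ∀ a b, (ChainComplex.of Y dY hY).X a ⟶ (ChainComplex.of Y dY hY).X b := fun a b =>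
    if e : a + 1 = b then h a ≫ eqToHom (congrArg Y e) else 0
  have hH : ∀ n, H n (n + 1) = h n := fun n => by simp [H]
  refine ⟨H, fun a b hab => dif_neg fun e => hab e, fun n => ?_⟩
  have hd : ∀ n, (ChainComplex.of Y dY hY).d (n + 1) n = dY n := fun n => ChainComplex.of_d _ _ _
  rw [Homotopy.prevD_chainComplex, hH, hd]
  cases n with
  | zero =>
    rw [Homotopy.dNext_zero_chainComplex, zero_add]
    exact sub_eq_iff_eq_add.1 h0
  | succ n =>
    rw [Homotopy.dNext_succ_chainComplex, hH, hd]
    exact sub_eq_iff_eq_add.1 (hs n)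

end HomotopyEquiv

theorem sum_single_apply {ι α S : Type*} [Fintype ι] [AddCommMonoid S] {f : ι → α}
    (hf : Function.Injective f) (g : ι → S) (i : ι) :
    ∑ j, Finsupp.single (f j) (g j) (f i) = g i := by
  rw [Finset.sum_eq_single i, Finsupp.single_eq_same]
  · exact fun j _ hj => Finsupp.single_eq_of_ne fun h => hj (hf h.symm)
  · exact fun h => absurd (Finset.mem_univ _) h

theorem critCell_injective (M : Set (A.Cell × A.Cell)) (n : ℕ) :
    Function.Injective fun η : CritCell M n => η.1 := Subtype.val_injective

theorem cellOfDim_injective (n : ℕ) :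
    Function.Injective fun η : A.CellOfDim n => η.1 := Subtype.val_injective

theorem stepWeight_one : stepWeight (A := A) (1 : A.Alg →ₙ* ℤ) (1 : A.Algᵐᵒᵖ →ₙ* ℤ) = 1 := by
  ext η τ
  have hl : ∀ a, (1 : A.Alg →ₙ* ℤ) a = 1 := fun _ => rfl
  have hr : ∀ a, (1 : A.Algᵐᵒᵖ →ₙ* ℤ) a = 1 := fun _ => rfl
  simp [stepWeight, hl, hr]

theorem ZigZag.weight_one {M : Set (A.Cell × A.Cell)} {η ω : A.Cell} (z : ZigZag M η ω) :
    z.weight (1 : A.Cell → A.Cell → R) = 1 := by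
  induction z with
  | nil => rfl
  | cons τ ρ _ _ _ z ih => rw [ZigZag.weight, ih]; simp

theorem GradientPath.total_one (M : Set (A.Cell × A.Cell)) (η ω : A.Cell) :
    GradientPath.total M (1 : A.Cell → A.Cell → ℤ) η ω = ∑ᶠ γ : GradientPath M η ω, γ.sign := by
  unfold GradientPath.total
  refine finsum_congr fun γ => ?_
  simp [GradientPath.weight, ZigZag.weight_one]

theorem boundary_one_sq :
    boundary (A := A) (1 : A.Cell → A.Cell → ℤ) * boundary 1 = 0 := by
  rw [← stepWeight_one]
  exact boundary_sq _ _ fun a b => Commute.all _ _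

/-- All degrees are placed into one free module on the cells, so that identities in its endomorphism
ring can be used for the graded complexes. -/
theorem extendMap_cellDiff (n : ℕ) (x : A.CellOfDim (n + 1) →₀ ℤ) :
    extendMap ℤ (fun η : A.CellOfDim n => η.1) (A.cellDiff n x) =
      boundary 1 (extendMap ℤ (fun η : A.CellOfDim (n + 1) => η.1) x) := by
  have h : extendMap ℤ (fun η : A.CellOfDim n => η.1) ∘ₗ A.cellDiff n =
      boundary 1 ∘ₗ extendMap ℤ (fun η : A.CellOfDim (n + 1) => η.1) := by
    refine Finsupp.lhom_ext fun η r => ?_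
    rw [LinearMap.comp_apply, LinearMap.comp_apply, extendMap_single, cellDiff,
      Finsupp.linearCombination_single, map_smul, map_sum]
    ext τ
    rw [boundary_single_apply]
    simp only [extendMap_single, Finsupp.smul_apply, Finsupp.finsetSum_apply, smul_eq_mul,
      Pi.one_apply, mul_one]
    congr 1
    by_cases hτ : τ.dim = n
    · exact sum_single_apply (cellOfDim_injective n)
        (fun ω : A.CellOfDim n => η.1.incidence ω.1) ⟨τ, hτ⟩
    · rw [Finset.sum_eq_zero, Cell.incidence_eq_zero]
      · intro h
        have := h.dim_eq
        have := η.2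
        omega
      · intro ω _
        exact Finsupp.single_eq_of_ne fun h => hτ (h ▸ ω.2)
  exact LinearMap.congr_fun h x

/-- With constant weight 1 the entries of the abstract differential are the sums of the signs;
outside the critical `n`-cells both sides vanish. -/
theorem IsMorseMatching.extendMap_critDiff {M : Set (A.Cell × A.Cell)} (hM : IsMorseMatching M)
    (n : ℕ) (x : CritCell M (n + 1) →₀ ℤ) :
    extendMap ℤ (fun η : CritCell M n => η.1) (critDiff M n x) =
      (hM.datum 1 (fun _ _ _ => rfl) boundary_one_sq).diff
        (extendMap ℤ (fun η : CritCell M (n + 1) => η.1) x) := by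
  have h : extendMap ℤ (fun η : CritCell M n => η.1) ∘ₗ critDiff M n =
      (hM.datum 1 (fun _ _ _ => rfl) boundary_one_sq).diff ∘ₗ
        extendMap ℤ (fun η : CritCell M (n + 1) => η.1) := by
    refine Finsupp.lhom_ext fun η r => ?_
    rw [LinearMap.comp_apply, LinearMap.comp_apply, extendMap_single, critDiff,
      Finsupp.linearCombination_single, map_smul, map_sum]
    ext τ
    by_cases hτ : τ.dim = n ∧ IsCritical M τ
    · rw [hM.diff_single _ _ _ η.2.2 hτ.2, GradientPath.total_one]
      simp only [extendMap_single, Finsupp.smul_apply, Finsupp.finsetSum_apply, smul_eq_mul]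
      congr 1
      exact (sum_single_apply (critCell_injective M n)
        (fun ω : CritCell M n => ∑ᶠ γ : GradientPath M η.1 ω.1, γ.sign) ⟨τ, hτ⟩)
    · have h1 : (r • ∑ ω : CritCell M n, extendMap ℤ (fun η : CritCell M n => η.1)
          (Finsupp.single ω (∑ᶠ γ : GradientPath M η.1 ω.1, γ.sign))) τ = 0 := by
        simp only [extendMap_single, Finsupp.smul_apply, Finsupp.finsetSum_apply, smul_eq_mul]
        rw [Finset.sum_eq_zero, mul_zero]
        intro ω _
        exact Finsupp.single_eq_of_ne fun h => hτ (h ▸ ω.2)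
      rw [h1]
      symm
      by_cases hd : τ.dim = n
      · rw [← MorseDatum.eC_diff, Module.End.mul_apply]
        refine (cellProj_apply _ _ _).trans (if_neg fun h => hτ ⟨hd, h⟩)
      · refine mem_supported_iff.1 ((hM.isGrading_dim 1).diff_mem hM _ _
          (single_mem_supported (s := {η : A.Cell | η.dim = n + 1}) η.2.1 _)) τ hd
  exact LinearMap.congr_fun h x

/-- The discrete Morse complex is chain homotopy equivalent to the cellular complex. -/
theorem IsMorseMatching.isCellular {M : Set (A.Cell × A.Cell)} (hM : IsMorseMatching M) :
    IsCellular M := by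
  have hwM : ∀ ρ τ, (ρ, τ) ∈ M → (1 : A.Cell → A.Cell → ℤ) ρ τ = 1 := fun _ _ _ => rfl
  let m := hM.datum (1 : A.Cell → A.Cell → ℤ) hwM boundary_one_sq
  let s : ℕ → Set A.Cell := fun n => {η | η.dim = n}
  have hs : IsGrading M (1 : A.Cell → A.Cell → ℤ) s := hM.isGrading_dim 1
  let eX : ∀ n, (CritCell M n →₀ ℤ) →ₗ[ℤ] (A.Cell →₀ ℤ) := fun n => extendMap ℤ fun η => η.1
  let rX : ∀ n, (A.Cell →₀ ℤ) →ₗ[ℤ] (CritCell M n →₀ ℤ) :=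
    fun n => restrictMap ℤ (critCell_injective M n)
  let eY : ∀ n, (A.CellOfDim n →₀ ℤ) →ₗ[ℤ] (A.Cell →₀ ℤ) := fun n => extendMap ℤ fun η => η.1
  let rY : ∀ n, (A.Cell →₀ ℤ) →ₗ[ℤ] (A.CellOfDim n →₀ ℤ) :=
    fun n => restrictMap ℤ (cellOfDim_injective n)
  -- Every identity below is checked after extension by zero to all cells, where it is one of the
  -- identities of the Morse datum.
  have heX : ∀ n, Function.Injective (eX n) := fun n => extendMap_injective (critCell_injective M n)
  have heY : ∀ n, Function.Injective (eY n) := fun n => extendMap_injective (cellOfDim_injective n)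
  have memX : ∀ n x, eX n x ∈ Finsupp.supported ℤ ℤ (s n) := fun n x =>
    extendMap_mem (fun η => η.2.1) x
  have memY : ∀ n x, eY n x ∈ Finsupp.supported ℤ ℤ (s n) := fun n x =>
    extendMap_mem (fun η => η.2) x
  have critX : ∀ n x, m.eC (eX n x) = eX n x := fun n x => by
    ext η
    refine (cellProj_apply _ _ _).trans (ite_eq_left_iff.2 fun h => Eq.symm ?_)
    exact mem_supported_iff.1 (extendMap_mem (s := {η | IsCritical M η}) (fun η => η.2.2) x) η h
  have erX : ∀ n x, x ∈ Finsupp.supported ℤ ℤ (s n) → m.eC x = x → eX n (rX n x) = x := by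
    intro n x hx hC
    refine extendMap_restrictMap (critCell_injective M n)
      (s := {η | η.dim = n ∧ IsCritical M η}) (fun η hη => ⟨⟨η, hη⟩, rfl⟩) ?_
    rw [mem_supported_iff] at hx ⊢
    intro η hη
    by_cases h : η.dim = n
    · rw [← hC]
      exact (cellProj_apply _ _ _).trans (if_neg fun h' => hη ⟨h, h'⟩)
    · exact hx η h
  have erY : ∀ n x, x ∈ Finsupp.supported ℤ ℤ (s n) → eY n (rY n x) = x := fun n x hx =>
    extendMap_restrictMap (cellOfDim_injective n) (fun η hη => ⟨⟨η, hη⟩, rfl⟩) hx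
  have dX : ∀ n x, eX n (critDiff M n x) = m.diff (eX (n + 1) x) := fun n x =>
    hM.extendMap_critDiff n x
  have dY : ∀ n x, eY n (A.cellDiff n x) = m.d (eY (n + 1) x) := fun n x =>
    extendMap_cellDiff n x
  let i : ∀ n, (CritCell M n →₀ ℤ) →ₗ[ℤ] (A.CellOfDim n →₀ ℤ) := fun n => rY n ∘ₗ m.incl ∘ₗ eX n
  let p : ∀ n, (A.CellOfDim n →₀ ℤ) →ₗ[ℤ] (CritCell M n →₀ ℤ) := fun n => rX n ∘ₗ m.proj ∘ₗ eY n
  let h : ∀ n, (A.CellOfDim n →₀ ℤ) →ₗ[ℤ] (A.CellOfDim (n + 1) →₀ ℤ) :=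
    fun n => rY (n + 1) ∘ₗ m.htpy ∘ₗ eY n
  have ei : ∀ n x, eY n (i n x) = m.incl (eX n x) := fun n x =>
    erY n _ (hs.incl_mem hM hwM boundary_one_sq (memX n x))
  have ep : ∀ n x, eX n (p n x) = m.proj (eY n x) := fun n x =>
    erX n _ (hs.proj_mem hM hwM boundary_one_sq (memY n x))
      (LinearMap.congr_fun m.eC_proj (eY n x))
  have eh : ∀ n x, eY (n + 1) (h n x) = m.htpy (eY n x) := fun n x =>
    erY (n + 1) _ (hs.htpy_mem hM hwM boundary_one_sq (memY n x))
  have hXX : ∀ n x, critDiff M n (critDiff M (n + 1) x) = 0 := fun n x => heX n (by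
    rw [dX, dX, map_zero]; exact LinearMap.congr_fun m.diff_sq _)
  have hYY : ∀ n x, A.cellDiff n (A.cellDiff (n + 1) x) = 0 := fun n x => heY n (by
    rw [dY, dY, map_zero]; exact LinearMap.congr_fun m.d_sq _)
  have hi : ∀ n x, A.cellDiff n (i (n + 1) x) = i n (critDiff M n x) := fun n x => heY n (by
    rw [dY, ei, ei, dX]; exact LinearMap.congr_fun m.d_incl _)
  have hp : ∀ n x, critDiff M n (p (n + 1) x) = p n (A.cellDiff n x) := fun n x => heX n (by
    rw [dX, ep, ep, dY]; exact (LinearMap.congr_fun m.proj_d _).symm)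
  have hip : ∀ n x, p n (i n x) = x := fun n x => heX n (by
    rw [ep, ei]; exact (LinearMap.congr_fun m.proj_incl _).trans (critX n x))
  have hh : ∀ x, x - m.incl (m.proj x) = m.d (m.htpy x) + m.htpy (m.d x) := fun x =>
    LinearMap.congr_fun m.incl_proj_eq x
  -- In degree 0 the term `h d` drops out, because vertices have no boundary.
  have h0 : ∀ x, x - i 0 (p 0 x) = A.cellDiff 0 (h 0 x) := fun x => heY 0 (by
    have h2 : m.d (eY 0 x) = 0 := hs.boundary_zero (memY 0 x)
    rw [map_sub, ei, ep, dY, eh, hh, h2, map_zero, add_zero])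
  have hs' : ∀ n x, x - i (n + 1) (p (n + 1) x) =
      h n (A.cellDiff n x) + A.cellDiff (n + 1) (h (n + 1) x) := fun n x => heY (n + 1) (by
    rw [map_sub, ei, ep, map_add, dY, eh, eh, dY, hh, add_comm])
  refine ⟨fun n => ?_, fun n => ?_, nonempty_homotopyEquiv_of _ _
    (fun n => ModuleCat.ofHom (i n)) (fun n => ModuleCat.ofHom (p n))
    (fun n => ModuleCat.ofHom (h n)) (fun n => ?_) (fun n => ?_) (fun n => ?_) ?_ (fun n => ?_)⟩
  · ext1; exact LinearMap.ext (hXX n)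
  · ext1; exact LinearMap.ext (hYY n)
  · ext1; exact LinearMap.ext (hi n)
  · ext1; exact LinearMap.ext (hp n)
  · ext1; exact LinearMap.ext (hip n)
  · ext1; exact LinearMap.ext h0
  · ext1; exact LinearMap.ext (hs' n)

end

end HPA

/-! ### The basis of the algebra given by the path classes -/

namespace HPA

noncomputable section

open scoped Classical
open PathAlgebra OrderComplex MulOpposite

variable {k V : Type*} [CommRing k] [Quiver V] [Fintype V] {A : HPA k V}

variable (A) in
/-- The class of a path of the quiver. -/
def pathClass (p : PathOf V) : Σ v, A.Under v := ⟨p.1, p.2.1, Quotient.mk _ p.2.2⟩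

theorem pathClass_surjective : Function.Surjective A.pathClass := by
  rintro ⟨v, w, p⟩
  induction p using Quotient.inductionOn with | h p
  exact ⟨⟨v, w, p⟩, rfl⟩

theorem pathClass_comp {u v w : V} {p p' : Quiver.Path u v} {q q' : Quiver.Path v w}
    (hp : A.pathClass ⟨u, v, p⟩ = A.pathClass ⟨u, v, p'⟩)
    (hq : A.pathClass ⟨v, w, q⟩ = A.pathClass ⟨v, w, q'⟩) :
    A.pathClass ⟨u, w, p.comp q⟩ = A.pathClass ⟨u, w, p'.comp q'⟩ := by
  have h (u v : V) (p p' : Quiver.Path u v)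
      (h : A.pathClass ⟨u, v, p⟩ = A.pathClass ⟨u, v, p'⟩) :
      (Quotient.mk _ p : A.Hom u v) = Quotient.mk _ p' :=
    eq_of_heq (Sigma.mk.inj (eq_of_heq (Sigma.mk.inj h).2)).2
  exact congrArg (fun x : A.Hom u w => (⟨u, w, x⟩ : Σ v, A.Under v))
    (congrArg₂ Hom.comp (h _ _ _ _ hp) (h _ _ _ _ hq))

variable (A) in
/-- The linear map that sends a path to its class, as a formal basis element. -/
def classMap : PathAlgebra k V →ₗ[k] ((Σ v, A.Under v) →₀ k) :=
  (basis k V).constr k fun p => Finsupp.single (A.pathClass p) 1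

theorem classMap_of (p : PathOf V) : A.classMap (of p) = Finsupp.single (A.pathClass p) 1 :=
  (basis k V).constr_basis k _ p

theorem classMap_of_mul_of {p p' q q' : PathOf V} (hp : A.pathClass p = A.pathClass p')
    (hq : A.pathClass q = A.pathClass q') :
    A.classMap (of p * of q) = A.classMap (of p' * of q') := by
  obtain ⟨u, v, p⟩ := p
  obtain ⟨u', v', p'⟩ := p'
  obtain ⟨w, x, q⟩ := q
  obtain ⟨w', x', q'⟩ := q'
  obtain rfl : u = u' := congrArg (·.1) hp
  obtain rfl : v = v' := congrArg (·.2.head) hp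
  obtain rfl : w = w' := congrArg (·.1) hq
  obtain rfl : x = x' := congrArg (·.2.head) hq
  by_cases h : v = w
  · subst h
    rw [of_mul_of', of_mul_of', classMap_of, classMap_of, pathClass_comp hp hq]
  · rw [of_mul_of_ne h, of_mul_of_ne h]

/-- The class of a product depends only on the classes of the factors. So multiplication by a path
descends along `classMap`, and its kernel is stable under left multiplication. -/
theorem classMap_mul_left (y : PathAlgebra k V) {x : PathAlgebra k V} (hx : A.classMap x = 0) :
    A.classMap (y * x) = 0 := by
  have h (p : PathOf V) : A.classMap ∘ₗ LinearMap.mulLeft k (of p) =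
      (Finsupp.linearCombination k fun c =>
        A.classMap (of p * of (Function.surjInv pathClass_surjective c))) ∘ₗ A.classMap := by
    refine ext_of fun q => ?_
    rw [LinearMap.comp_apply, LinearMap.comp_apply, classMap_of,
      Finsupp.linearCombination_single, one_smul]
    exact classMap_of_mul_of rfl (Function.surjInv_eq pathClass_surjective _).symm
  have h' : A.classMap ∘ₗ LinearMap.mulRight k x = 0 := by
    refine ext_of fun p => ?_
    have := LinearMap.congr_fun (h p) x
    rwa [LinearMap.comp_apply, LinearMap.comp_apply, hx, map_zero] at this
  exact LinearMap.congr_fun h' y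

theorem classMap_mul_right {x : PathAlgebra k V} (y : PathAlgebra k V) (hx : A.classMap x = 0) :
    A.classMap (x * y) = 0 := by
  have h (p : PathOf V) : A.classMap ∘ₗ LinearMap.mulRight k (of p) =
      (Finsupp.linearCombination k fun c =>
        A.classMap (of (Function.surjInv pathClass_surjective c) * of p)) ∘ₗ A.classMap := by
    refine ext_of fun q => ?_
    rw [LinearMap.comp_apply, LinearMap.comp_apply, classMap_of,
      Finsupp.linearCombination_single, one_smul, LinearMap.mulRight_apply]
    exact classMap_of_mul_of (Function.surjInv_eq pathClass_surjective _).symm rfl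
  have h' : A.classMap ∘ₗ LinearMap.mulLeft k x = 0 := by
    refine ext_of fun p => ?_
    have := LinearMap.congr_fun (h p) x
    rwa [LinearMap.comp_apply, LinearMap.comp_apply, hx, map_zero] at this
  exact LinearMap.congr_fun h' y

/-- The kernel of `classMap` is a two-sided ideal containing the generators of `I_S`. Hence the
class coordinates are defined on `A`, and distinct path classes are linearly independent. -/
theorem classMap_eq_zero {x : PathAlgebra k V} (hx : x ∈ A.ideal) : A.classMap x = 0 := by
  have h := TwoSidedIdeal.mem_span_iff.1 hx (TwoSidedIdeal.mk' {x | A.classMap x = 0}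
    (map_zero _) (fun {x y} hx hy => by
      rw [Set.mem_ofPred_eq] at hx hy ⊢; rw [map_add, hx, hy, add_zero])
    (fun {x} hx => by rw [Set.mem_ofPred_eq] at hx ⊢; rw [map_neg, hx, neg_zero])
    (fun {x y} hy => classMap_mul_left x hy) (fun {x y} hx => classMap_mul_right y hx)) ?_
  · exact (TwoSidedIdeal.mem_mk' {x | A.classMap x = 0} _ _ _ _ _ x).1 h
  · rintro _ ⟨v, w, s, hs, p, hp, p', hp', rfl⟩
    refine (TwoSidedIdeal.mem_mk' _ _ _ _ _ _ _).2 ?_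
    change A.classMap _ = 0
    rw [map_sub, classMap_of, classMap_of, sub_eq_zero]
    congr 1
    refine congrArg (fun x : A.Hom v w => (⟨v, w, x⟩ : Σ v, A.Under v)) (Quotient.sound ?_)
    exact TwoSidedIdeal.subset_span ⟨v, w, s, hs, p, hp, p', hp', rfl⟩

variable (A) in
/-- The quotient map from the path algebra. -/
def quotMap : PathAlgebra k V →ₗ[k] A.Alg where
  toFun := A.ideal.ringCon.mk'
  map_add' := map_add _
  map_smul' _ _ := rfl

theorem quotMap_surjective : Function.Surjective A.quotMap := Quotient.exists_rep

theorem quotMap_eq_zero {x : PathAlgebra k V} (h : A.quotMap x = 0) : x ∈ A.ideal := by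
  have h' : A.ideal.ringCon x 0 := (RingCon.eq _).1 (h.trans (map_zero A.quotMap).symm)
  have := (TwoSidedIdeal.rel_iff _ _ _).1 h'
  rwa [sub_zero] at this

variable (A) in
/-- The coordinates with respect to the path classes. -/
def classCoord : A.Alg →ₗ[k] ((Σ v, A.Under v) →₀ k) :=
  (LinearMap.ker A.quotMap).liftQ A.classMap (fun _ hx => classMap_eq_zero (quotMap_eq_zero hx)) ∘ₗ
    (A.quotMap.quotKerEquivOfSurjective quotMap_surjective).symm.toLinearMap

theorem classCoord_quotMap (x : PathAlgebra k V) : A.classCoord (A.quotMap x) = A.classMap x := by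
  have h : (A.quotMap.quotKerEquivOfSurjective quotMap_surjective).symm (A.quotMap x) =
      Submodule.Quotient.mk x := by
    rw [LinearEquiv.symm_apply_eq]
    rfl
  rw [classCoord, LinearMap.comp_apply, LinearEquiv.coe_coe, h]
  exact Submodule.liftQ_apply _ _ _

theorem algHom_ext {N : Type*} [AddCommMonoid N] [Module k N] {f g : A.Alg →ₗ[k] N}
    (h : ∀ v (p : A.Under v), f p.toAlg = g p.toAlg) : f = g := by
  have h' : f ∘ₗ A.quotMap = g ∘ₗ A.quotMap :=
    ext_of fun p => h _ (A.pathClass p).2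
  ext x
  obtain ⟨x, rfl⟩ := quotMap_surjective x
  exact LinearMap.congr_fun h' x

theorem classCoord_toAlg {v : V} (p : A.Under v) :
    A.classCoord p.toAlg = Finsupp.single ⟨v, p⟩ 1 := by
  obtain ⟨q, hq⟩ := pathClass_surjective (A := A) ⟨v, p⟩
  have h : p.toAlg = A.quotMap (of q) := congrArg (fun x : Σ v, A.Under v => x.2.toAlg) hq.symm
  rw [h, classCoord_quotMap, classMap_of, hq]

variable (A) in
/-- The path classes form a basis of the algebra. -/
def classBasis : Module.Basis (Σ v, A.Under v) k A.Alg :=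
  ⟨LinearEquiv.ofLinearMap A.classCoord (Finsupp.linearCombination k fun c => c.2.toAlg)
    (by
      refine Finsupp.lhom_ext' fun c => LinearMap.ext_ring ?_
      simp [classCoord_toAlg])
    (algHom_ext fun v p => by simp [classCoord_toAlg])⟩

theorem classBasis_apply (c : Σ v, A.Under v) : A.classBasis c = c.2.toAlg := by
  refine A.classBasis.repr.injective ?_
  rw [Module.Basis.repr_self]
  exact (classCoord_toAlg c.2).symm

theorem classBasis_constr {N : Type*} [AddCommMonoid N] [Module k N]
    (f : (Σ v, A.Under v) → N) {v : V} (p : A.Under v) :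
    A.classBasis.constr k f p.toAlg = f ⟨v, p⟩ := by
  have h := A.classBasis.constr_basis k f ⟨v, p⟩
  rwa [classBasis_apply] at h

theorem toAlg_mul_of_ne {v w : V} (p : A.Under v) (r : A.Under w) (h : p.head ≠ w) :
    p.toAlg * r.toAlg = 0 := by
  obtain ⟨x, p⟩ := p
  obtain ⟨y, r⟩ := r
  induction p using Quotient.inductionOn with | h p
  induction r using Quotient.inductionOn with | h r
  change A.ofPath ⟨v, x, p⟩ * A.ofPath ⟨w, y, r⟩ = 0
  rw [ofPath_mul, of_mul_of_ne h]
  exact map_zero A.quotMap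

theorem toAlg_bot (v : V) : (⊥ : A.Under v).toAlg = A.idem v := rfl

theorem idem_mul_toAlg {v : V} (p : A.Under v) : A.idem v * p.toAlg = p.toAlg := by
  rw [← toAlg_bot]
  exact (Under.toAlg_comp ⊥ p).symm.trans (congrArg _ (Under.bot_comp p))

theorem toAlg_mul_idem {v : V} (p : A.Under v) : p.toAlg * A.idem p.head = p.toAlg := by
  rw [← toAlg_bot, ← Under.toAlg_comp, Under.comp_bot]

theorem toAlg_mul_idem_of_ne {v w : V} (p : A.Under v) (h : p.head ≠ w) :
    p.toAlg * A.idem w = 0 := toAlg_mul_of_ne p ⊥ h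

theorem idem_mul_idem (v : V) : A.idem v * A.idem v = A.idem v := idem_mul_toAlg (⊥ : A.Under v)

theorem sum_idem : ∑ v, A.idem v = 1 := by
  have h : A.quotMap 1 = 1 := map_one A.ideal.ringCon.mk'
  rw [← h, one_def, map_sum]
  rfl

variable (A) in
/-- The linear form that reads off the coefficient of the constant path `e_v`. -/
def constCoord (v : V) : A.Alg →ₗ[k] k :=
  A.classBasis.constr k fun c => if c = ⟨v, ⊥⟩ then 1 else 0

theorem constCoord_toAlg (v : V) {u : V} (p : A.Under u) :
    A.constCoord v p.toAlg = if (⟨u, p⟩ : Σ v, A.Under v) = ⟨v, ⊥⟩ then 1 else 0 :=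
  classBasis_constr _ p

theorem constCoord_idem (v : V) : A.constCoord v (A.idem v) = 1 := by
  rw [← toAlg_bot, constCoord_toAlg, if_pos rfl]

theorem constCoord_idem_of_ne {v w : V} (h : w ≠ v) : A.constCoord v (A.idem w) = 0 := by
  rw [← toAlg_bot, constCoord_toAlg, if_neg fun h' => h (congrArg (·.1) h')]

theorem constCoord_of_ne_bot (v : V) {u : V} {p : A.Under u} (hp : p ≠ ⊥) :
    A.constCoord v p.toAlg = 0 := by
  rw [constCoord_toAlg, if_neg]
  intro h
  obtain rfl : u = v := congrArg (·.1) h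
  exact hp (eq_of_heq (Sigma.mk.inj h).2)

/-- A product of paths is constant only if both factors are; otherwise both sides vanish. This makes
the coefficient of `e_v` a character. -/
theorem constCoord_toAlg_mul (v : V) {u w : V} (p : A.Under u) (r : A.Under w) :
    A.constCoord v (p.toAlg * r.toAlg) = A.constCoord v p.toAlg * A.constCoord v r.toAlg := by
  by_cases h : p.head = w
  · subst h
    rw [← Under.toAlg_comp]
    by_cases hp : p = ⊥
    · subst hp
      have h1 : ((⊥ : A.Under u).comp r).toAlg = r.toAlg := congrArg _ (Under.bot_comp r)
      rw [h1, toAlg_bot]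
      by_cases hu : u = v
      · subst hu
        rw [constCoord_idem, one_mul]
      · rw [constCoord_idem_of_ne hu, zero_mul]
        refine (constCoord_toAlg v r).trans (if_neg fun h => hu ?_)
        exact congrArg (·.1) h
    · rw [constCoord_of_ne_bot v hp, zero_mul, constCoord_of_ne_bot v (Under.comp_ne_bot hp r)]
  · rw [toAlg_mul_of_ne p r h, map_zero]
    by_cases hp : p = ⊥
    · by_cases hr : r = ⊥
      · subst hp hr
        have h' : u ≠ w := h
        rw [toAlg_bot, toAlg_bot]
        by_cases hu : u = v
        · subst hu
          rw [constCoord_idem_of_ne h'.symm, mul_zero]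
        · rw [constCoord_idem_of_ne hu, zero_mul]
      · rw [constCoord_of_ne_bot v hr, mul_zero]
    · rw [constCoord_of_ne_bot v hp, zero_mul]

variable (A) in
/-- The character of the algebra given by the constant path `e_v`. -/
def character (v : V) : A.Alg →ₐ[k] k :=
  AlgHom.ofLinearMap (A.constCoord v)
    (by
      rw [← sum_idem, map_sum, Finset.sum_eq_single v]
      · exact constCoord_idem v
      · exact fun w _ hw => constCoord_idem_of_ne hw
      · exact fun h => absurd (Finset.mem_univ _) h)
    (by
      have h : (LinearMap.mul k A.Alg).compr₂ (A.constCoord v) =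
          (LinearMap.mul k k).compl₁₂ (A.constCoord v) (A.constCoord v) :=
        algHom_ext fun u p => algHom_ext fun w r => constCoord_toAlg_mul v p r
      exact fun x y => LinearMap.congr_fun₂ h x y)

theorem character_idem (v : V) : A.character v (A.idem v) = 1 := constCoord_idem v

theorem character_of_ne_bot (v : V) {u : V} {p : A.Under u} (hp : p ≠ ⊥) :
    A.character v p.toAlg = 0 := constCoord_of_ne_bot v hp

end

end HPA

/-! ### The complex of bimodules on all cells -/

namespace HPA

noncomputable section

open scoped Classical
open PathAlgebra OrderComplex MulOpposite

variable {k V : Type*} [CommRing k] [Quiver V] [Fintype V] {A : HPA k V}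

variable (A) in
/-- The left factor of the enveloping algebra. -/
def leftHom : A.Alg →ₙ* A.Env :=
  ((Algebra.TensorProduct.includeLeft : A.Alg →ₐ[k] A.Env) : A.Alg →* A.Env)

variable (A) in
/-- The right factor of the enveloping algebra. -/
def rightHom : A.Algᵐᵒᵖ →ₙ* A.Env :=
  ((Algebra.TensorProduct.includeRight : A.Algᵐᵒᵖ →ₐ[k] A.Env) : A.Algᵐᵒᵖ →* A.Env)

theorem leftHom_apply (a : A.Alg) : A.leftHom a = a ⊗ₜ[k] 1 := rfl

theorem rightHom_apply (b : A.Algᵐᵒᵖ) : A.rightHom b = 1 ⊗ₜ[k] b := rfl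

theorem commute_leftHom_rightHom (a : A.Alg) (b : A.Algᵐᵒᵖ) :
    Commute (A.leftHom a) (A.rightHom b) := by
  rw [Commute, SemiconjBy, leftHom_apply, rightHom_apply, Algebra.TensorProduct.tmul_mul_tmul,
    Algebra.TensorProduct.tmul_mul_tmul]
  simp

theorem gen_mul_gen (η : A.Cell) : gen η * gen η = gen η := by
  rw [gen, Algebra.TensorProduct.tmul_mul_tmul, ← op_mul, idem_mul_idem, idem_mul_idem]

/-- The left ideal generated by an idempotent is the fixed set of right multiplication by it. So the
sum of the `P_η` is the image of the idempotent endomorphism `genProj` of a free module, where the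
matrix calculus is available. -/
theorem mem_proj_iff {η : A.Cell} {x : A.Env} : x ∈ proj η ↔ x * gen η = x := by
  rw [proj, Submodule.mem_span_singleton]
  constructor
  · rintro ⟨a, rfl⟩
    rw [smul_eq_mul, mul_assoc, gen_mul_gen]
  · intro h
    exact ⟨x, h⟩

variable [∀ v w : V, Finite (v ⟶ w)]

theorem Cell.exists_eq_cons {η : A.Cell} (h : η.chain.Nonempty) :
    ∃ p hp, ∃ d : A.Chains p.head, η = (d.cons (v := η.tail) p hp).cell := by
  obtain ⟨p, hp, d, hd⟩ := Chains.exists_eq_cons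
    (c := (⟨η.chain, η.isChain, η.bot_notMem⟩ : A.Chains η.tail)) h
  exact ⟨p, hp, d, congrArg Chains.cell hd⟩

variable (A) in
/-- The weights in the enveloping algebra. -/
def envWeight : A.Cell → A.Cell → A.Env := stepWeight A.leftHom A.rightHom

theorem envWeight_eq (η τ : A.Cell) : A.envWeight η τ = η.left τ ⊗ₜ[k] op (η.right τ) := by
  unfold envWeight stepWeight Cell.left Cell.right
  rw [show ((1 : A.Env)) = 1 ⊗ₜ[k] 1 from rfl]
  split_ifs <;> simp [leftHom_apply, rightHom_apply]

theorem ZigZag.weight_env {M : Set (A.Cell × A.Cell)} {η ω : A.Cell} (z : ZigZag M η ω) :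
    z.weight A.envWeight = z.left ⊗ₜ[k] op z.right := by
  induction z with
  | nil => rfl
  | cons τ ρ _ _ _ z ih =>
    rw [ZigZag.weight, ih, envWeight_eq, Algebra.TensorProduct.tmul_mul_tmul, ← op_mul]
    rfl

theorem GradientPath.weight_env {M : Set (A.Cell × A.Cell)} {η ω : A.Cell}
    (γ : GradientPath M η ω) : γ.weight A.envWeight = γ.left ⊗ₜ[k] op γ.right := by
  rw [GradientPath.weight, ZigZag.weight_env, envWeight_eq, Algebra.TensorProduct.tmul_mul_tmul,
    ← op_mul]
  rfl

theorem boundary_env_sq : boundary A.envWeight * boundary A.envWeight = 0 :=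
  boundary_sq _ _ commute_leftHom_rightHom

/-! ### The idempotents -/

theorem Cell.terminalFacet_ne_initialFacet {η : A.Cell} (h : η.chain.Nonempty) :
    η.terminalFacet ≠ η.initialFacet := Cell.erase_ne_initialFacet h _

theorem Cell.head_initialFacet {η : A.Cell} (h : η.chain.Nonempty) :
    η.initialFacet.head = η.head := by
  obtain ⟨p, hp, d, hd⟩ := Cell.exists_eq_cons h
  rw [hd, Chains.initialFacet_cons]
  exact (congrArg Under.head (Chains.top_cons p hp d)).symm

theorem Cell.exists_lastStep (η : A.Cell) : ∃ r : A.Under η.terminalFacet.top.head,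
    r.head = η.head ∧ η.lastStep = r.toAlg := by
  obtain ⟨r, hr⟩ := Chains.erase_top_le η
  refine ⟨r, congrArg Under.head hr, ?_⟩
  unfold lastStep
  rw [← hr]
  exact Under.quot_comp_self _ r

/-- A path split off at either end leads from the corresponding endpoint of `η` to that of the
facet, so it carries one idempotent into the other. Thus the differential preserves the image of
`genProj`. -/
theorem gen_mul_envWeight {η τ : A.Cell} (h : τ.IsFacet η) :
    gen η * A.envWeight η τ = A.envWeight η τ * gen τ := by
  obtain ⟨hne, rfl | ⟨q, hq, rfl⟩⟩ := h
  · have h1 : A.envWeight η η.initialFacet = η.low.toAlg ⊗ₜ[k] 1 := by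
      rw [envWeight_eq, Cell.left, Cell.right, if_pos rfl,
        if_neg (Cell.terminalFacet_ne_initialFacet hne).symm]
      rfl
    rw [h1, gen, gen, Algebra.TensorProduct.tmul_mul_tmul, Algebra.TensorProduct.tmul_mul_tmul,
      Cell.head_initialFacet hne, mul_one, one_mul, idem_mul_toAlg]
    congr 1
    exact (toAlg_mul_idem η.low).symm
  · by_cases ht : q = η.top
    · subst ht
      have h1 : A.envWeight η η.terminalFacet = 1 ⊗ₜ[k] op η.lastStep := by
        rw [envWeight_eq, Cell.left, Cell.right, if_pos rfl,
          if_neg (Cell.terminalFacet_ne_initialFacet hne)]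
      obtain ⟨r, hr, hr'⟩ := η.exists_lastStep
      change gen η * A.envWeight η η.terminalFacet = A.envWeight η η.terminalFacet * _
      rw [h1, gen, gen, Algebra.TensorProduct.tmul_mul_tmul, Algebra.TensorProduct.tmul_mul_tmul,
        ← op_mul, ← op_mul, mul_one, one_mul, hr', ← hr, toAlg_mul_idem]
      congr 2
      exact (idem_mul_toAlg r).symm
    · have h1 : A.envWeight η (η.erase q) = 1 := stepWeight_of_inner _ _ hq ht
      have h2 : (η.erase q).head = η.head := congrArg Under.head (Cell.top_erase ht)
      rw [h1, mul_one, one_mul, gen, gen, h2]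
      rfl

variable (A) in
/-- Multiplication with the idempotents from the right. -/
def genProj : Module.End A.Env (A.Cell →₀ A.Env) := ofMatrix fun η τ => if η = τ then gen η else 0

theorem genProj_single (η : A.Cell) (r : A.Env) :
    A.genProj (Finsupp.single η r) = Finsupp.single η (r * gen η) := by
  unfold genProj
  rw [ofMatrix_single_eq_single (ρ := η) fun τ h => if_neg h.symm, if_pos rfl]

theorem genProj_apply (x : A.Cell →₀ A.Env) (η : A.Cell) : A.genProj x η = x η * gen η := by
  unfold genProj
  rw [ofMatrix_apply, Finset.sum_eq_single η]
  · rw [if_pos rfl]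
  · intro τ _ h
    rw [if_neg h, mul_zero]
  · exact fun h => absurd (Finset.mem_univ _) h

theorem genProj_genProj : A.genProj * A.genProj = A.genProj :=
  end_ext fun η => by
    rw [Module.End.mul_apply, genProj_single, genProj_single, mul_assoc, gen_mul_gen]

theorem commute_genProj_ofMatrix {m : A.Cell → A.Cell → A.Env}
    (h : ∀ η τ, gen η * m η τ = m η τ * gen τ) : Commute A.genProj (ofMatrix m) := by
  refine end_ext fun η => ?_
  ext τ
  rw [Module.End.mul_apply, Module.End.mul_apply, genProj_apply, genProj_single,
    ofMatrix_single_apply, ofMatrix_single_apply, one_mul, one_mul, h]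

theorem commute_genProj_boundary : Commute A.genProj (boundary A.envWeight) := by
  refine commute_genProj_ofMatrix fun η τ => ?_
  by_cases h : τ.IsFacet η
  · rw [mul_smul_comm, gen_mul_envWeight h, smul_mul_assoc]
  · rw [Cell.incidence_eq_zero h, zero_smul, mul_zero, zero_mul]

theorem commute_genProj_cellProj (s : Set A.Cell) : Commute A.genProj (cellProj A.Env s) := by
  refine commute_genProj_ofMatrix fun η τ => ?_
  split_ifs with h
  · rw [mul_one, one_mul, h.1]
  · rw [mul_zero, zero_mul]

namespace IsMorseMatching

variable {M : Set (A.Cell × A.Cell)}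

theorem gen_eq (hM : IsMorseMatching M) {ρ τ : A.Cell} (h : (ρ, τ) ∈ M) : gen ρ = gen τ := by
  obtain ⟨q, hq, hq', rfl⟩ := hM.inner h
  have h2 : (ρ.erase q).head = ρ.head := congrArg Under.head (Cell.top_erase hq')
  rw [gen, gen, h2]
  rfl

theorem commute_genProj_matchUp (hM : IsMorseMatching M) :
    Commute A.genProj (matchUp A.Env M) := by
  refine commute_genProj_ofMatrix fun η τ => ?_
  split_ifs with h
  · rw [hM.gen_eq h]
    exact (Int.cast_commute _ _).symm
  · rw [mul_zero, zero_mul]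

theorem commute_genProj_matchDown (hM : IsMorseMatching M) :
    Commute A.genProj (matchDown A.Env M) := by
  refine commute_genProj_ofMatrix fun η τ => ?_
  split_ifs with h
  · rw [hM.gen_eq h]
    exact (Int.cast_commute _ _).symm
  · rw [mul_zero, zero_mul]

/-- The Morse datum of the complex of bimodules. -/
abbrev envDatum (hM : IsMorseMatching M) : MorseDatum (Module.End A.Env (A.Cell →₀ A.Env)) :=
  hM.datum A.envWeight (hM.stepWeight_eq_one _ _) boundary_env_sq

/-- The sum over alternating paths is the inverse of an element that commutes with `genProj`. -/
theorem commute_genProj_zigzagSum (hM : IsMorseMatching M) :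
    Commute A.genProj (zigzagSum M A.envWeight) := by
  have h1 := hM.envDatum.Z_mul
  have h2 := hM.envDatum.mul_Z
  have h3 : Commute A.genProj (boundary A.envWeight - matchDown A.Env M) :=
    (commute_genProj_boundary (A := A)).sub_right hM.commute_genProj_matchDown
  have h4 : Commute A.genProj (matchUp A.Env M * (boundary A.envWeight - matchDown A.Env M)) :=
    hM.commute_genProj_matchUp.mul_right h3
  have h : Commute A.genProj
      (1 + matchUp A.Env M * (boundary A.envWeight - matchDown A.Env M)) :=
    (Commute.one_right A.genProj).add_right h4
  exact Commute.units_inv_right (u := ⟨_, _, h2, h1⟩) h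

theorem commute_genProj_incl (hM : IsMorseMatching M) : Commute A.genProj hM.envDatum.incl :=
  hM.commute_genProj_zigzagSum.mul_right (commute_genProj_cellProj {η | IsCritical M η})

theorem commute_genProj_proj (hM : IsMorseMatching M) : Commute A.genProj hM.envDatum.proj := by
  have h3 : Commute A.genProj (boundary A.envWeight - matchDown A.Env M) :=
    (commute_genProj_boundary (A := A)).sub_right hM.commute_genProj_matchDown
  have h4 : Commute A.genProj ((boundary A.envWeight - matchDown A.Env M) *
      zigzagSum M A.envWeight) := h3.mul_right hM.commute_genProj_zigzagSum
  have h5 : Commute A.genProj ((boundary A.envWeight - matchDown A.Env M) *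
      zigzagSum M A.envWeight * matchUp A.Env M) := h4.mul_right hM.commute_genProj_matchUp
  have h6 : Commute A.genProj (1 - (boundary A.envWeight - matchDown A.Env M) *
      zigzagSum M A.envWeight * matchUp A.Env M) := (Commute.one_right A.genProj).sub_right h5
  exact (commute_genProj_cellProj {η | IsCritical M η}).mul_right h6

theorem commute_genProj_diff (hM : IsMorseMatching M) : Commute A.genProj hM.envDatum.diff := by
  have h1 := commute_genProj_cellProj {η : A.Cell | IsCritical M η}
  have h2 : Commute A.genProj (cellProj A.Env {η | IsCritical M η} * boundary A.envWeight) :=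
    h1.mul_right commute_genProj_boundary
  have h3 : Commute A.genProj (cellProj A.Env {η | IsCritical M η} * boundary A.envWeight *
      zigzagSum M A.envWeight) := h2.mul_right hM.commute_genProj_zigzagSum
  exact h3.mul_right h1

end IsMorseMatching

end

end HPA

/-! ### The contracting homotopy -/

namespace HPA

noncomputable section

open scoped Classical
open PathAlgebra OrderComplex MulOpposite

variable {k V : Type*} [CommRing k] [Quiver V] [Fintype V] {A : HPA k V}
  [∀ v w : V, Finite (v ⟶ w)]

variable (A) in
/-- The contraction on the coefficients of a cell: the left coefficient becomes the first path of the
chain. -/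
def contractAt (η : A.Cell) : A.Env →ₗ[k] (A.Cell →₀ A.Env) :=
  TensorProduct.lift (A.classBasis.constr k fun c =>
    if h : c.2 ≠ ⊥ ∧ ∃ d : A.Chains c.2.head, d.cell = η then
      Finsupp.lsingle (R := k) (h.2.choose.cons c.2 h.1).cell ∘ₗ
        TensorProduct.mk k A.Alg A.Algᵐᵒᵖ (A.idem c.1)
    else 0)

variable (A) in
/-- The contracting homotopy. -/
def contraction : (A.Cell →₀ A.Env) →ₗ[k] (A.Cell →₀ A.Env) := Finsupp.lsum k A.contractAt

variable (A) in
/-- The contracting homotopy in degree `-1`. -/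
def baseMap : A.Alg →ₗ[k] (A.Cell →₀ A.Env) :=
  A.classBasis.constr k fun c =>
    Finsupp.single (Chains.empty A c.1).cell (A.idem c.1 ⊗ₜ[k] op c.2.toAlg)

variable (A) in
/-- The augmentation of the complex on all cells. -/
def augment : (A.Cell →₀ A.Env) →ₗ[A.Env] A.Alg :=
  Finsupp.linearCombination A.Env fun η => if η.chain = ∅ then 1 else 0

theorem env_smul (a : A.Alg) (b : A.Algᵐᵒᵖ) (x : A.Alg) :
    (a ⊗ₜ[k] b : A.Env) • x = a * (x * b.unop) := rfl

/-- It lets the augmentation be regarded as `k`-linear; the contraction and the base map are not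
linear over the enveloping algebra. -/
instance : IsScalarTower k A.Env A.Alg where
  smul_assoc c r a := by
    induction r using TensorProduct.induction_on with
    | zero => rw [smul_zero, zero_smul, smul_zero]
    | add x y hx hy => rw [smul_add, add_smul, add_smul, smul_add, hx, hy]
    | tmul x b => rw [TensorProduct.smul_tmul', env_smul, env_smul, smul_mul_assoc]

theorem chains_cell_injective {v : V} : Function.Injective (Chains.cell : A.Chains v → A.Cell) :=
  fun _ _ h => Subtype.ext (Cell.ext_chain.1 h)

/-- The extra degeneracy of the bar resolution: a nonconstant left coefficient is absorbed as the
first path of the chain. A constant one would give a degenerate cell, so it is sent to 0. -/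
theorem contraction_single {u : V} {p : A.Under u} (hp : p ≠ ⊥) (d : A.Chains p.head)
    (b : A.Algᵐᵒᵖ) : A.contraction (Finsupp.single d.cell (p.toAlg ⊗ₜ[k] b)) =
      Finsupp.single (d.cons p hp).cell (A.idem u ⊗ₜ[k] b) := by
  have h : p ≠ ⊥ ∧ ∃ d' : A.Chains p.head, d'.cell = d.cell := ⟨hp, d, rfl⟩
  rw [contraction, Finsupp.lsum_single, contractAt, TensorProduct.lift.tmul, classBasis_constr,
    dif_pos h, chains_cell_injective h.2.choose_spec]
  rfl

theorem contraction_single_idem (u : V) (η : A.Cell) (b : A.Algᵐᵒᵖ) :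
    A.contraction (Finsupp.single η (A.idem u ⊗ₜ[k] b)) = 0 := by
  rw [contraction, Finsupp.lsum_single, contractAt, TensorProduct.lift.tmul, ← toAlg_bot,
    classBasis_constr, dif_neg fun h => h.1 rfl]
  rfl

theorem innerWeight_env (η : A.Cell) (q : A.Under η.tail) :
    ∃ b : A.Algᵐᵒᵖ, innerWeight A.rightHom η q = 1 ⊗ₜ[k] b := by
  have h1 : ∀ n : ℕ, ((-1) ^ n : A.Env) = 1 ⊗ₜ[k] ((-1) ^ n : A.Algᵐᵒᵖ) := fun n => by
    have := map_pow (Algebra.TensorProduct.includeRight : A.Algᵐᵒᵖ →ₐ[k] A.Env) (-1) n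
    rw [map_neg, map_one] at this
    exact this.symm
  unfold innerWeight
  rw [h1]
  split_ifs
  · exact ⟨_, by rw [rightHom_apply, Algebra.TensorProduct.tmul_mul_tmul, one_mul]⟩
  · exact ⟨_, mul_one _⟩

theorem contraction_inner {u : V} {p : A.Under u} (hp : p ≠ ⊥) (c : A.Chains p.head)
    (b : A.Algᵐᵒᵖ) :
    A.contraction ((p.toAlg ⊗ₜ[k] b : A.Env) • toCells A.Env _
        (innerBoundary A.rightHom _ (Finsupp.single c 1))) =
      (A.idem u ⊗ₜ[k] b : A.Env) • toCells A.Env _ (consMap A.Env p hp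
        (innerBoundary A.rightHom _ (Finsupp.single c 1))) := by
  rw [innerBoundary_single]
  simp only [map_sum, Finset.smul_sum]
  refine Finset.sum_congr rfl fun q _ => ?_
  obtain ⟨b', hb'⟩ := innerWeight_env c.cell q
  rw [hb', toCells_single, consMap_single, toCells_single, Finsupp.smul_single,
    Finsupp.smul_single, smul_eq_mul, smul_eq_mul, Algebra.TensorProduct.tmul_mul_tmul,
    Algebra.TensorProduct.tmul_mul_tmul, mul_one, mul_one, contraction_single hp]

theorem contraction_inner_idem {u : V} (c : A.Chains u) (b : A.Algᵐᵒᵖ) :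
    A.contraction ((A.idem u ⊗ₜ[k] b : A.Env) • toCells A.Env _
        (innerBoundary A.rightHom _ (Finsupp.single c 1))) = 0 := by
  rw [innerBoundary_single]
  simp only [map_sum, Finset.smul_sum]
  refine Finset.sum_eq_zero fun q _ => ?_
  obtain ⟨b', hb'⟩ := innerWeight_env c.cell q
  rw [hb', toCells_single, Finsupp.smul_single, smul_eq_mul, Algebra.TensorProduct.tmul_mul_tmul,
    mul_one, contraction_single_idem]

theorem augment_single_empty (v : V) (r : A.Env) :
    A.augment (Finsupp.single (Chains.empty A v).cell r) = r • 1 := by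
  rw [augment, Finsupp.linearCombination_single]
  exact congrArg (r • ·) (if_pos rfl)

theorem augment_single_of_ne {η : A.Cell} (h : η.chain ≠ ∅) (r : A.Env) :
    A.augment (Finsupp.single η r) = 0 := by
  rw [augment, Finsupp.linearCombination_single, if_neg h, smul_zero]

theorem baseMap_toAlg {u : V} (p : A.Under u) : A.baseMap p.toAlg =
    Finsupp.single (Chains.empty A u).cell (A.idem u ⊗ₜ[k] op p.toAlg) := classBasis_constr _ p

/-- The linear map `b ↦ e_u ⊗ [e_u] ⊗ b`. -/
def insertRight (u : V) : A.Alg →ₗ[k] (A.Cell →₀ A.Env) :=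
  Finsupp.lsingle (R := k) (Chains.empty A u).cell ∘ₗ
    TensorProduct.mk k A.Alg A.Algᵐᵒᵖ (A.idem u) ∘ₗ (opLinearEquiv k).toLinearMap

/-- All paths occurring in `p b` start at `u`, so the base map puts the whole product on the right
of the same vertex. -/
theorem baseMap_mul {u : V} (p : A.Under u) (b : A.Alg) : A.baseMap (p.toAlg * b) =
    Finsupp.single (Chains.empty A u).cell (A.idem u ⊗ₜ[k] op (p.toAlg * b)) := by
  have h : A.baseMap ∘ₗ LinearMap.mulLeft k p.toAlg =
      insertRight u ∘ₗ LinearMap.mulLeft k p.toAlg := by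
    refine algHom_ext fun w r => ?_
    rw [LinearMap.comp_apply, LinearMap.comp_apply, LinearMap.mulLeft_apply]
    by_cases hw : p.head = w
    · subst hw
      rw [← Under.toAlg_comp, baseMap_toAlg]
      rfl
    · rw [toAlg_mul_of_ne p r hw, map_zero, map_zero]
  exact LinearMap.congr_fun h b

/-- For nonconstant `p`, the initial facet of the prepended cell returns the element. Its inner
facets cancel against the contracted inner facets, and the omission of `p` cancels against the
contracted initial facet of `c` or, for empty `c`, against the augmentation term. For constant `p`
the contraction vanishes, and the element is recovered from the contracted initial facet or, for
empty `c`, from the augmentation. -/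
theorem contraction_generator {u : V} (p : A.Under u) (c : A.Chains p.head) {b : A.Alg}
    (hb : A.idem c.cell.head * b = b) :
    Finsupp.single c.cell (p.toAlg ⊗ₜ[k] op b) =
      boundary A.envWeight (A.contraction (Finsupp.single c.cell (p.toAlg ⊗ₜ[k] op b))) +
      A.contraction (boundary A.envWeight (Finsupp.single c.cell (p.toAlg ⊗ₜ[k] op b))) +
      A.baseMap (A.augment (Finsupp.single c.cell (p.toAlg ⊗ₜ[k] op b))) := by
  have hD : boundary A.envWeight (Finsupp.single c.cell (p.toAlg ⊗ₜ[k] op b)) =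
      (p.toAlg ⊗ₜ[k] op b : A.Env) • (initialBoundary A.leftHom _ (Finsupp.single c 1)) +
      (p.toAlg ⊗ₜ[k] op b : A.Env) • toCells A.Env _
        (innerBoundary A.rightHom _ (Finsupp.single c 1)) := by
    rw [map_single, envWeight, boundary_single_cell, smul_add]
  by_cases hp : p = ⊥
  · subst hp
    have h1 : A.contraction (Finsupp.single c.cell (A.idem u ⊗ₜ[k] op b)) = 0 :=
      contraction_single_idem u _ _
    have h2 := contraction_inner_idem (u := u) c (op b)
    have h3 : A.contraction (boundary A.envWeight (Finsupp.single c.cell (A.idem u ⊗ₜ[k] op b))) =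
        A.contraction ((A.idem u ⊗ₜ[k] op b : A.Env) •
          (initialBoundary A.leftHom u (Finsupp.single c 1))) := by
      refine (congrArg A.contraction hD).trans ?_
      rw [map_add]
      refine (congrArg _ h2).trans (add_zero _)
    change Finsupp.single c.cell (A.idem u ⊗ₜ[k] op b) =
      boundary A.envWeight (A.contraction (Finsupp.single c.cell (A.idem u ⊗ₜ[k] op b))) +
      A.contraction (boundary A.envWeight (Finsupp.single c.cell (A.idem u ⊗ₜ[k] op b))) +
      A.baseMap (A.augment (Finsupp.single c.cell (A.idem u ⊗ₜ[k] op b)))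
    rw [h1, map_zero, zero_add, h3]
    by_cases hc : c.1.Nonempty
    · rw [augment_single_of_ne (η := c.cell) hc.ne_empty, map_zero, add_zero]
      obtain ⟨r, hr, d, rfl⟩ := Chains.exists_eq_cons hc
      have h4 := initialBoundary_single_cons A.leftHom r hr d 1
      refine Eq.symm ((congrArg (fun y => A.contraction ((A.idem u ⊗ₜ[k] op b : A.Env) • y))
        h4).trans ?_)
      rw [Finsupp.smul_single, leftHom_apply, one_mul, smul_eq_mul,
        Algebra.TensorProduct.tmul_mul_tmul, mul_one]
      have h5 : A.idem u * r.toAlg = r.toAlg := idem_mul_toAlg r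
      rw [h5]
      exact contraction_single hr d (op b)
    · obtain rfl := Chains.eq_empty_of_not_nonempty hc
      have h4 : initialBoundary A.leftHom u (Finsupp.single (Chains.empty A u) 1) = 0 :=
        initialBoundary_single_empty A.leftHom u 1
      -- For empty `c` the element can be recovered from its product only because `b` starts at the
      -- vertex of the cell.
      have hb' : A.idem u * b = b := by
        have := hb
        rwa [show (Chains.empty A (⊥ : A.Under u).head).cell.head = u from
          congrArg Under.head (Chains.top_empty (A := A) (v := u))] at this
      refine Eq.symm ((congrArg₂ (· + ·) (congrArg (fun y => A.contraction
        ((A.idem u ⊗ₜ[k] op b : A.Env) • y)) h4) (congrArg A.baseMap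
        (augment_single_empty u _))).trans ?_)
      rw [smul_zero, map_zero, zero_add, env_smul, one_mul, unop_op, ← toAlg_bot, baseMap_mul,
        toAlg_bot, hb']
      rfl
  · rw [contraction_single hp, hD, map_add, contraction_inner hp, map_single, envWeight,
      boundary_cons, smul_sub, smul_sub]
    have h1 : (A.idem u ⊗ₜ[k] op b : A.Env) • (Finsupp.single c.cell (A.leftHom p.toAlg)) =
        Finsupp.single c.cell (p.toAlg ⊗ₜ[k] op b) := by
      rw [Finsupp.smul_single, leftHom_apply, smul_eq_mul, Algebra.TensorProduct.tmul_mul_tmul,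
        mul_one, idem_mul_toAlg]
    have h2 : (A.idem u ⊗ₜ[k] op b : A.Env) • toCells A.Env u
          (shiftMap A.rightHom p (Finsupp.single c 1)) =
        A.contraction ((p.toAlg ⊗ₜ[k] op b : A.Env) •
          initialBoundary A.leftHom _ (Finsupp.single c 1)) +
        A.baseMap (A.augment (Finsupp.single c.cell (p.toAlg ⊗ₜ[k] op b))) := by
      by_cases hc : c.1.Nonempty
      · rw [augment_single_of_ne (η := c.cell) hc.ne_empty, map_zero, add_zero]
        obtain ⟨r, hr, d, rfl⟩ := Chains.exists_eq_cons hc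
        rw [initialBoundary_single_cons, ← consMap_single, shiftMap_cons, Finsupp.smul_single,
          leftHom_apply, one_mul, smul_eq_mul, Algebra.TensorProduct.tmul_mul_tmul, mul_one,
          ← Under.toAlg_comp]
        refine Eq.trans ?_
          (contraction_single (Under.comp_ne_bot_of_right (p := p) hr) d (op b)).symm
        refine (congrArg (fun y => (A.idem u ⊗ₜ[k] op b : A.Env) • toCells A.Env u y)
          (consMap_single (p.comp r) (Under.comp_ne_bot_of_right hr) d 1)).trans ?_
        rw [toCells_single, Finsupp.smul_single, smul_eq_mul, mul_one]
      · obtain rfl := Chains.eq_empty_of_not_nonempty hc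
        rw [initialBoundary_single_empty, smul_zero, map_zero, zero_add, shiftMap_single_empty,
          augment_single_empty, env_smul, toCells_single, Finsupp.smul_single, one_mul, one_mul,
          unop_op, baseMap_mul, rightHom_apply, smul_eq_mul, Algebra.TensorProduct.tmul_mul_tmul,
          mul_one, ← op_mul]
    rw [h1, h2]
    abel

/-- The contracting homotopy identity. -/
theorem contraction_spec {x : A.Cell →₀ A.Env} (hx : A.genProj x = x) :
    x = boundary A.envWeight (A.contraction x) + A.contraction (boundary A.envWeight x) +
      A.baseMap (A.augment x) := by
  rw [← hx]
  clear hx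
  induction x using Finsupp.induction_linear with
  | zero => simp
  | add x y hx hy =>
    simp only [map_add]
    nth_rw 1 [hx]
    nth_rw 1 [hy]
    abel
  | single η r =>
    induction r using TensorProduct.induction_on with
    | zero => simp
    | add x y hx hy =>
      simp only [Finsupp.single_add, map_add]
      nth_rw 1 [hx]
      nth_rw 1 [hy]
      abel
    | tmul a b =>
      obtain ⟨b, rfl⟩ := op_surjective b
      let L : (A.Cell →₀ A.Env) →ₗ[k] (A.Cell →₀ A.Env) :=
        (boundary A.envWeight).restrictScalars k ∘ₗ A.contraction +
          A.contraction ∘ₗ (boundary A.envWeight).restrictScalars k +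
          A.baseMap ∘ₗ A.augment.restrictScalars k
      let f : A.Alg →ₗ[k] (A.Cell →₀ A.Env) := A.genProj.restrictScalars k ∘ₗ
        Finsupp.lsingle (R := k) η ∘ₗ (TensorProduct.mk k A.Alg A.Algᵐᵒᵖ).flip (op b)
      -- Both sides are `k`-linear in the left coefficient, so it may be taken to be a path.
      have h : f = L ∘ₗ f := by
        refine algHom_ext fun u p => ?_
        have h1 : f p.toAlg = Finsupp.single η
            ((p.toAlg * A.idem η.tail) ⊗ₜ[k] op (A.idem η.head * b)) := by
          change A.genProj (Finsupp.single η (p.toAlg ⊗ₜ[k] op b)) = _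
          rw [genProj_single, gen, Algebra.TensorProduct.tmul_mul_tmul, ← op_mul]
        refine h1.trans (Eq.trans ?_ (congrArg L h1).symm)
        by_cases hp : p.head = η.tail
        · obtain ⟨c, rfl⟩ : ∃ c : A.Chains p.head, c.cell = η := by
            obtain ⟨v, c, h2, h3⟩ := η
            obtain rfl : p.head = v := hp
            exact ⟨⟨c, h2, h3⟩, rfl⟩
          have h2 : p.toAlg * A.idem c.cell.tail = p.toAlg := toAlg_mul_idem p
          rw [h2]
          exact contraction_generator p c (by rw [← mul_assoc, idem_mul_idem])
        · rw [toAlg_mul_idem_of_ne p hp, TensorProduct.zero_tmul, Finsupp.single_zero, map_zero]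
      exact LinearMap.congr_fun h a

theorem augment_boundary (x : A.Cell →₀ A.Env) : A.augment (boundary A.envWeight x) = 0 := by
  have h : A.augment ∘ₗ boundary A.envWeight = 0 := by
    refine Finsupp.lhom_ext fun η r => ?_
    rw [LinearMap.comp_apply, map_single, map_smul, LinearMap.zero_apply]
    convert smul_zero r
    by_cases hη : η.chain.Nonempty
    · obtain ⟨p, hp, d, hd⟩ := Cell.exists_eq_cons hη
      rw [hd, envWeight, boundary_cons, map_sub, map_sub]
      have hne : ∀ y : A.Chains p.head →₀ A.Env,
          A.augment (toCells A.Env _ (consMap A.Env p hp y)) = 0 := fun y => by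
        induction y using Finsupp.induction_linear with
        | zero => simp
        | add x y hx hy => rw [map_add, map_add, map_add, hx, hy, add_zero]
        | single c r =>
          rw [consMap_single, toCells_single, augment_single_of_ne]
          exact (Finset.nonempty_of_ne_empty (Finset.insert_ne_empty _ _)).ne_empty
      rw [hne, sub_zero]
      by_cases hc : d.1.Nonempty
      · rw [shiftMap_single_of_nonempty _ _ hc, toCells_single,
          augment_single_of_ne (η := d.cell) hc.ne_empty, augment_single_of_ne, sub_zero]
        exact (Finset.Nonempty.map hc).ne_empty
      · obtain rfl := Chains.eq_empty_of_not_nonempty hc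
        rw [shiftMap_single_empty, toCells_single, augment_single_empty, augment_single_empty,
          leftHom_apply, rightHom_apply, one_mul, env_smul, env_smul]
        simp
    · have : boundary A.envWeight (Finsupp.single η 1) = 0 := by
        refine ofMatrix_single_eq_zero (fun τ => ?_) _
        rw [Cell.incidence_eq_zero fun h => hη h.1, zero_smul]
      rw [this, map_zero]
  exact LinearMap.congr_fun h x

end

end HPA

/-! ### The Morse complex of bimodules is a resolution -/

namespace HPA

noncomputable section

open scoped Classical
open PathAlgebra OrderComplex MulOpposite

variable {k V : Type*} [CommRing k] [Quiver V] [Fintype V] {A : HPA k V}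
  [∀ v w : V, Finite (v ⟶ w)]

theorem IsMorseMatching.diff_apply_eq_zero {R : Type*} [Ring R] {M : Set (A.Cell × A.Cell)}
    (hM : IsMorseMatching M) (w : A.Cell → A.Cell → R) (hw : ∀ ρ τ, (ρ, τ) ∈ M → w ρ τ = 1)
    (hd : boundary w * boundary w = 0) {η : A.Cell} (hη : ¬ IsCritical M η) (x : A.Cell →₀ R) :
    (hM.datum w hw hd).diff x η = 0 := by
  rw [← MorseDatum.eC_diff, Module.End.mul_apply]
  exact (cellProj_apply _ _ _).trans (if_neg hη)

section ModuleMap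

variable (M : Set (A.Cell × A.Cell)) (n : ℕ)

/-- The Morse module as a submodule of the free module on the cells. -/
def moduleMap : MorseModule M n →ₗ[A.Env] (A.Cell →₀ A.Env) :=
  DirectSum.toModule A.Env _ _ fun η => Finsupp.lsingle η.1 ∘ₗ (proj η.1).subtype

variable {M n}

theorem moduleMap_lof (η : CritCell M n) (y : proj η.1) :
    moduleMap M n (DirectSum.lof A.Env _ (fun ω : CritCell M n => proj ω.1) η y) =
      Finsupp.single η.1 (y : A.Env) := DirectSum.toModule_lof _ _ _

theorem moduleMap_apply (x : MorseModule M n) (ω : CritCell M n) :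
    moduleMap M n x ω.1 = (x ω : A.Env) := by
  induction x using DirectSum.induction_on with
  | zero => rw [map_zero]; rfl
  | of η y =>
    change moduleMap M n (DirectSum.lof A.Env _ (fun ω : CritCell M n => proj ω.1) η y) ω.1 =
      ((DirectSum.lof A.Env _ (fun ω : CritCell M n => proj ω.1) η y) ω : A.Env)
    rw [moduleMap_lof]
    by_cases h : η = ω
    · subst h
      rw [Finsupp.single_eq_same, DirectSum.lof_apply]
    · rw [Finsupp.single_eq_of_ne fun h' => h (Subtype.ext h'.symm)]
      have : DirectSum.lof A.Env _ (fun ω : CritCell M n => proj ω.1) η y ω = 0 :=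
        DirectSum.of_eq_of_ne _ _ _ (Ne.symm h)
      rw [this]
      rfl
  | add x y hx hy =>
    rw [map_add, Finsupp.add_apply, hx, hy]
    rfl

theorem moduleMap_injective : Function.Injective (moduleMap M n) := fun x y h => by
  refine DFinsupp.ext fun ω => Subtype.ext ?_
  exact (moduleMap_apply x ω).symm.trans ((DFunLike.congr_fun h ω.1).trans (moduleMap_apply y ω))

theorem moduleMap_mem (x : MorseModule M n) : moduleMap M n x ∈
    Finsupp.supported A.Env A.Env {η : A.Cell | η.dim = n ∧ IsCritical M η} := by
  induction x using DirectSum.induction_on with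
  | zero => rw [map_zero]; exact zero_mem _
  | of η y =>
    refine Eq.subst (motive := (· ∈ Finsupp.supported A.Env A.Env
      {η : A.Cell | η.dim = n ∧ IsCritical M η})) (moduleMap_lof η y).symm ?_
    exact single_mem_supported (s := {η : A.Cell | η.dim = n ∧ IsCritical M η}) η.2 _
  | add x y hx hy => rw [map_add]; exact add_mem hx hy

theorem moduleMap_mem_dim (x : MorseModule M n) : moduleMap M n x ∈
    Finsupp.supported A.Env A.Env {η : A.Cell | η.dim = n} :=
  Finsupp.supported_mono (fun _ h => h.1) (moduleMap_mem x)

theorem genProj_moduleMap (x : MorseModule M n) :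
    A.genProj (moduleMap M n x) = moduleMap M n x := by
  ext η
  rw [genProj_apply]
  by_cases h : η.dim = n ∧ IsCritical M η
  · have := moduleMap_apply x ⟨η, h⟩
    change moduleMap M n x η = _ at this
    rw [this]
    exact mem_proj_iff.1 (x ⟨η, h⟩).2
  · rw [mem_supported_iff.1 (moduleMap_mem x) η h, zero_mul]

theorem cellProj_moduleMap (x : MorseModule M n) :
    cellProj A.Env {η | IsCritical M η} (moduleMap M n x) = moduleMap M n x := by
  ext η
  rw [cellProj_apply]
  split_ifs with h
  · rfl
  · exact (mem_supported_iff.1 (moduleMap_mem x) η fun h' => h h'.2).symm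

theorem exists_moduleMap {y : A.Cell →₀ A.Env} (hy : A.genProj y = y)
    (hdim : y ∈ Finsupp.supported A.Env A.Env {η : A.Cell | η.dim = n})
    (hcrit : cellProj A.Env {η | IsCritical M η} y = y) : ∃ x, moduleMap M n x = y := by
  have hmem (ω : CritCell M n) : y ω.1 ∈ proj ω.1 := by
    rw [mem_proj_iff, ← genProj_apply, hy]
  let x : MorseModule M n := DirectSum.mk (fun ω : CritCell M n => proj ω.1) Finset.univ
    fun ω => ⟨y ω.1.1, hmem ω.1⟩
  have hx (ω : CritCell M n) : (x ω : A.Env) = y ω.1 := by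
    have h : x ω = ⟨y ω.1, hmem ω⟩ := DirectSum.mk_apply_of_mem (Finset.mem_univ ω)
    rw [h]
  refine ⟨x, ?_⟩
  ext η
  by_cases h : η.dim = n ∧ IsCritical M η
  · exact (moduleMap_apply x ⟨η, h⟩).trans (hx ⟨η, h⟩)
  · refine (mem_supported_iff.1 (moduleMap_mem x) η h).trans ?_
    by_cases h1 : η.dim = n
    · rw [← hcrit, cellProj_apply]
      exact (if_neg fun h2 => h ⟨h1, h2⟩).symm
    · exact (mem_supported_iff.1 hdim η h1).symm

end ModuleMap

theorem projMap_apply (η ω : A.Cell) (l r : A.Alg) (y : proj η) :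
    (projMap η ω l r y : A.Env) = y * ((l ⊗ₜ[k] op r) * gen ω) := rfl

variable {M : Set (A.Cell × A.Cell)}

/-- There are finitely many gradient paths, so the `∑ᶠ` can be evaluated. The trailing idempotent
stems from `projMap` and is absorbed later, since the Morse differential commutes with `genProj`. -/
theorem morseDiff_lof_apply (hM : IsMorseMatching M) (n : ℕ) (η : CritCell M (n + 1))
    (y : proj η.1) (ω : CritCell M n) :
    (morseDiff M n (DirectSum.lof A.Env _ (fun ω : CritCell M (n + 1) => proj ω.1) η y) ω : A.Env) =
      y * GradientPath.total M A.envWeight η.1 ω.1 * gen ω.1 := by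
  have := GradientPath.finite hM η.1 ω.1
  let inst : Fintype (GradientPath M η.1 ω.1) := Fintype.ofFinite _
  have h1 : morseDiff M n (DirectSum.lof A.Env _ (fun ω : CritCell M (n + 1) => proj ω.1) η y) =
      ∑ ω : CritCell M n, DirectSum.lof A.Env (CritCell M n) (fun ω => proj ω.1) ω
        ((∑ᶠ γ : GradientPath M η.1 ω.1, γ.sign • projMap η.1 ω.1 γ.left γ.right) y) := by
    rw [morseDiff, DirectSum.toModule_lof, LinearMap.sum_apply]
    rfl
  have h2 : morseDiff M n (DirectSum.lof A.Env _ (fun ω : CritCell M (n + 1) => proj ω.1) η y) ω =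
      (∑ᶠ γ : GradientPath M η.1 ω.1, γ.sign • projMap η.1 ω.1 γ.left γ.right) y := by
    rw [h1, DirectSum.sum_apply, Finset.sum_eq_single ω]
    · exact DirectSum.lof_apply _ _ _
    · exact fun ω' _ h => DirectSum.of_eq_of_ne _ _ _ (Ne.symm h)
    · exact fun h => absurd (Finset.mem_univ _) h
  rw [h2, finsum_eq_sum_of_fintype, GradientPath.total, finsum_eq_sum_of_fintype,
    LinearMap.sum_apply, AddSubmonoidClass.coe_finsetSum, Finset.mul_sum, Finset.sum_mul]
  refine Finset.sum_congr rfl fun γ _ => ?_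
  rw [GradientPath.weight_env, mul_smul_comm, smul_mul_assoc, mul_assoc, ← projMap_apply]
  rfl

theorem moduleMap_morseDiff (hM : IsMorseMatching M) (n : ℕ) (x : MorseModule M (n + 1)) :
    moduleMap M n (morseDiff M n x) = hM.envDatum.diff (moduleMap M (n + 1) x) := by
  have h : moduleMap M n ∘ₗ morseDiff M n = hM.envDatum.diff ∘ₗ moduleMap M (n + 1) := by
    refine DirectSum.linearMap_ext _ fun η => LinearMap.ext fun y => ?_
    simp only [LinearMap.comp_apply]
    rw [moduleMap_lof]
    ext ω
    by_cases hω : ω.dim = n ∧ IsCritical M ω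
    · have h1 := hM.diff_single A.envWeight (hM.stepWeight_eq_one _ _) boundary_env_sq η.2.2 hω.2
        (y : A.Env)
      have h2 : A.genProj (hM.envDatum.diff (Finsupp.single η.1 (y : A.Env))) =
          hM.envDatum.diff (Finsupp.single η.1 (y : A.Env)) := by
        have := LinearMap.congr_fun hM.commute_genProj_diff.eq (Finsupp.single η.1 (y : A.Env))
        refine this.trans ?_
        rw [Module.End.mul_apply, genProj_single, mem_proj_iff.1 y.2]
      refine (moduleMap_apply _ (⟨ω, hω⟩ : CritCell M n)).trans ?_
      refine (morseDiff_lof_apply hM n η y ⟨ω, hω⟩).trans ?_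
      refine Eq.trans ?_ (DFunLike.congr_fun h2 ω)
      rw [genProj_apply]
      exact congrArg (· * gen ω) h1.symm
    · have h5 := moduleMap_mem (morseDiff M n
        (DirectSum.lof A.Env _ (fun ω : CritCell M (n + 1) => proj ω.1) η y))
      refine (mem_supported_iff.1 h5 ω hω).trans (Eq.symm ?_)
      by_cases h1 : ω.dim = n
      · exact hM.diff_apply_eq_zero _ _ _ (fun h2 => hω ⟨h1, h2⟩) _
      · have h3 : Finsupp.single η.1 (y : A.Env) ∈
            Finsupp.supported A.Env A.Env {η : A.Cell | η.dim = n + 1} :=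
          single_mem_supported (s := {η : A.Cell | η.dim = n + 1}) η.2.1 _
        have h4 := (hM.isGrading_dim A.envWeight).diff_mem hM
          (hM.stepWeight_eq_one A.leftHom A.rightHom) boundary_env_sq h3
        exact mem_supported_iff.1 h4 ω h1
  exact LinearMap.congr_fun h x

theorem augmentation_eq (x : MorseModule M 0) :
    augmentation M x = A.augment (moduleMap M 0 x) := by
  have h : augmentation M = A.augment ∘ₗ moduleMap M 0 := by
    refine DirectSum.linearMap_ext _ fun η => LinearMap.ext fun y => ?_
    simp only [LinearMap.comp_apply]
    rw [moduleMap_lof, augment, Finsupp.linearCombination_single, augmentation,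
      DirectSum.toModule_lof, if_pos (Finset.card_eq_zero.1 η.2.1)]
    rfl
  exact LinearMap.congr_fun h x

theorem augment_of_dim {n : ℕ} {x : A.Cell →₀ A.Env}
    (hx : x ∈ Finsupp.supported A.Env A.Env {η : A.Cell | η.dim = n + 1}) :
    A.augment x = 0 := by
  have h : A.augment x ∈ (⊥ : Submodule A.Env A.Alg) := by
    refine map_supported (fun η hη => ?_) hx
    rw [Submodule.mem_bot]
    refine augment_single_of_ne (fun h => ?_) _
    rw [Set.mem_ofPred_eq, Cell.dim, h] at hη
    simp at hη
  exact h

theorem boundary_cellProj_dim (w : A.Cell → A.Cell → A.Env) (n : ℕ) (x : A.Cell →₀ A.Env) :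
    boundary w (cellProj A.Env {η | η.dim = n + 1} x) =
      cellProj A.Env {η | η.dim = n} (boundary w x) := by
  have h : boundary w * cellProj A.Env {η | η.dim = n + 1} =
      cellProj A.Env {η | η.dim = n} * boundary w := by
    refine end_ext fun η => ?_
    ext τ
    rw [Module.End.mul_apply, Module.End.mul_apply, cellProj_apply, cellProj_single]
    simp only [Set.mem_ofPred_eq]
    by_cases hf : τ.IsFacet η
    · have := hf.dim_eq
      by_cases h1 : τ.dim = n
      · rw [if_pos h1, if_pos (by omega)]
      · rw [if_neg h1, if_neg (by omega), map_zero]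
        rfl
    · have h0 : boundary w (Finsupp.single η 1) τ = 0 := by
        rw [boundary_single_apply, Cell.incidence_eq_zero hf, zero_smul, mul_zero]
      rw [h0, ite_self]
      split_ifs
      · exact h0
      · rw [map_zero]; rfl
  exact LinearMap.congr_fun h x

/-- The inclusion turns `x` into a cycle `z` of the big complex, which by contraction is the
boundary of some `u`. Projecting back, `proj u` is a preimage: `diff (proj u) = proj (d u) = proj
(incl x) = x`. -/
theorem exists_morseDiff_eq (hM : IsMorseMatching M) (n : ℕ) (x : MorseModule M n)
    (h1 : boundary A.envWeight (hM.envDatum.incl (moduleMap M n x)) = 0)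
    (h2 : A.augment (hM.envDatum.incl (moduleMap M n x)) = 0) : ∃ y, morseDiff M n y = x := by
  have hs := hM.isGrading_dim A.envWeight
  have hwM := hM.stepWeight_eq_one A.leftHom A.rightHom
  set z := hM.envDatum.incl (moduleMap M n x) with hz
  have hzE : A.genProj z = z := by
    have := LinearMap.congr_fun hM.commute_genProj_incl.eq (moduleMap M n x)
    refine this.trans ?_
    rw [Module.End.mul_apply, genProj_moduleMap]
  have hzn : z ∈ Finsupp.supported A.Env A.Env {η : A.Cell | η.dim = n} :=
    hs.incl_mem hM hwM boundary_env_sq (moduleMap_mem_dim x)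
  have hzD : z = boundary A.envWeight (A.contraction z) := by
    have := contraction_spec hzE
    rwa [h1, h2, map_zero, map_zero, add_zero, add_zero] at this
  -- The contracted chain is cut down to dimension `n + 1` and to the submodule of the `P_η`; both
  -- operations are compatible with the differential and do not affect its boundary `z`.
  set u := A.genProj (cellProj A.Env {η | η.dim = n + 1} (A.contraction z)) with hu
  have huE : A.genProj u = u := LinearMap.congr_fun A.genProj_genProj _
  have hun : u ∈ Finsupp.supported A.Env A.Env {η : A.Cell | η.dim = n + 1} := by
    rw [mem_supported_iff]
    intro η hη
    rw [hu, genProj_apply, cellProj_apply, if_neg hη, zero_mul]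
  have huD : boundary A.envWeight u = z := by
    have h3 := LinearMap.congr_fun commute_genProj_boundary.eq
      (cellProj A.Env {η | η.dim = n + 1} (A.contraction z))
    refine h3.symm.trans ?_
    rw [Module.End.mul_apply, boundary_cellProj_dim, ← hzD]
    refine Eq.trans (congrArg A.genProj ?_) hzE
    ext η
    rw [cellProj_apply]
    split_ifs with h
    · rfl
    · exact (mem_supported_iff.1 hzn η h).symm
  obtain ⟨y, hy⟩ : ∃ y, moduleMap M (n + 1) y = hM.envDatum.proj u := by
    refine exists_moduleMap ?_ (hs.proj_mem hM hwM boundary_env_sq hun) ?_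
    · refine (LinearMap.congr_fun hM.commute_genProj_proj.eq u).trans ?_
      rw [Module.End.mul_apply, huE]
    · exact LinearMap.congr_fun hM.envDatum.eC_proj u
  refine ⟨y, moduleMap_injective ?_⟩
  rw [moduleMap_morseDiff hM, hy]
  have h4 : hM.envDatum.diff (hM.envDatum.proj u) = hM.envDatum.proj (boundary A.envWeight u) :=
    (LinearMap.congr_fun hM.envDatum.proj_d u).symm
  have h5 : hM.envDatum.proj (hM.envDatum.incl (moduleMap M n x)) =
      cellProj A.Env {η | IsCritical M η} (moduleMap M n x) :=
    LinearMap.congr_fun hM.envDatum.proj_incl _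
  rw [h4, huD, hz, h5, cellProj_moduleMap]

theorem boundary_incl (hM : IsMorseMatching M) (x : A.Cell →₀ A.Env) :
    boundary A.envWeight (hM.envDatum.incl x) = hM.envDatum.incl (hM.envDatum.diff x) :=
  LinearMap.congr_fun hM.envDatum.d_incl x

/-- Vertices have no facets, so no nontrivial alternating path starts at one. -/
theorem incl_of_dim_zero (hM : IsMorseMatching M) (x : MorseModule M 0) :
    hM.envDatum.incl (moduleMap M 0 x) = moduleMap M 0 x := by
  have h : hM.envDatum.incl (moduleMap M 0 x) = zigzagSum M A.envWeight (moduleMap M 0 x) :=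
    congrArg (zigzagSum M A.envWeight) (cellProj_moduleMap x)
  rw [h]
  have h2 : zigzagSum M A.envWeight (moduleMap M 0 x) = moduleMap M 0 x -
      (zigzagSum M A.envWeight * matchUp A.Env M)
        ((boundary A.envWeight - matchDown A.Env M) (moduleMap M 0 x)) := by
    have := LinearMap.congr_fun hM.envDatum.Z_eq' (moduleMap M 0 x)
    rw [← mul_assoc] at this
    exact this
  have h3 : matchDown A.Env M (moduleMap M 0 x) = 0 := by
    have : matchDown A.Env M (moduleMap M 0 x) ∈ (⊥ : Submodule A.Env (A.Cell →₀ A.Env)) := by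
      refine map_supported (fun η hη => ?_) (moduleMap_mem x)
      rw [Submodule.mem_bot]
      exact IsMorseMatching.matchDown_single_eq_zero (IsMorseMatching.critical_iff.1 hη.2).2 _
    exact this
  rw [h2, LinearMap.sub_apply, h3,
    (hM.isGrading_dim A.envWeight).boundary_zero (moduleMap_mem_dim x), sub_zero, map_zero,
    sub_zero]

theorem projective_proj (η : A.Cell) : Module.Projective A.Env (proj η) := by
  refine Module.Projective.of_split (M := A.Env) (proj η).subtype
    ((LinearMap.toSpanSingleton A.Env A.Env (gen η)).codRestrict (proj η) fun x =>
      Submodule.smul_mem _ _ (Submodule.subset_span rfl)) ?_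
  refine LinearMap.ext fun x => Subtype.ext ?_
  exact mem_proj_iff.1 x.2

/-- An inner facet still contains the top of the larger cell, so the smaller member of a matched
pair is never a vertex; nor is the larger one, which has an element to omit. -/
theorem isCritical_empty (hM : IsMorseMatching M) (v : V) :
    IsCritical M (Chains.empty A v).cell := by
  intro ρ
  constructor
  · intro h
    obtain ⟨q, hq, -⟩ := hM.inner h
    exact absurd hq (Finset.notMem_empty q)
  · intro h
    obtain ⟨q, hq, hq', he⟩ := hM.inner h
    have h1 := (Cell.isGreatest_top ⟨q, hq⟩).1
    have h2 : ρ.top ∈ (ρ.erase q).chain := Finset.mem_erase.2 ⟨hq'.symm, h1⟩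
    have h3 := hM.dim_eq h
    have h4 : (ρ.erase q).dim = 0 := congrArg Cell.dim he.symm
    rw [Cell.dim, Finset.card_eq_zero] at h4
    rw [h4] at h2
    exact absurd h2 (Finset.notMem_empty _)

/-- The Morse complex of an acyclic matching along inner facets is a projective resolution. -/
theorem IsMorseMatching.isProjectiveResolution (hM : IsMorseMatching M) :
    IsProjectiveResolution M where
  projective n := by
    have (η : CritCell M n) : Module.Projective A.Env (proj η.1) := projective_proj η.1
    exact Module.Projective.directSum
  exact n := by
    intro x
    constructor
    · intro hx
      have h0 : hM.envDatum.diff (moduleMap M (n + 1) x) = 0 := by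
        rw [← moduleMap_morseDiff hM, hx, map_zero]
      refine exists_morseDiff_eq hM (n + 1) x ?_ ?_
      · rw [boundary_incl, h0, map_zero]
      · exact augment_of_dim ((hM.isGrading_dim A.envWeight).incl_mem hM
          (hM.stepWeight_eq_one A.leftHom A.rightHom) boundary_env_sq (moduleMap_mem_dim x))
    · rintro ⟨y, rfl⟩
      refine moduleMap_injective ?_
      rw [moduleMap_morseDiff hM, moduleMap_morseDiff hM, map_zero]
      exact LinearMap.congr_fun hM.envDatum.diff_sq _
  exact_zero := by
    intro x
    constructor
    · intro hx
      refine exists_morseDiff_eq hM 0 x ?_ ?_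
      · rw [incl_of_dim_zero hM]
        exact (hM.isGrading_dim A.envWeight).boundary_zero (moduleMap_mem_dim x)
      · rw [incl_of_dim_zero hM, ← augmentation_eq, hx]
    · rintro ⟨y, rfl⟩
      rw [augmentation_eq, ← incl_of_dim_zero hM, moduleMap_morseDiff hM, ← boundary_incl,
        augment_boundary]
  surjective := by
    have h1 : (1 : A.Alg) ∈ LinearMap.range (augmentation M) := by
      rw [← sum_idem]
      refine Submodule.sum_mem _ fun v _ => ?_
      refine ⟨DirectSum.lof A.Env _ (fun ω : CritCell M 0 => proj ω.1)
        ⟨(Chains.empty A v).cell, rfl, isCritical_empty hM v⟩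
        ⟨gen (Chains.empty A v).cell, Submodule.subset_span rfl⟩, ?_⟩
      rw [augmentation_eq]
      refine (congrArg A.augment (moduleMap_lof (n := 0) _ _)).trans ?_
      refine (augment_single_empty v _).trans ?_
      change (A.idem v ⊗ₜ[k] op (A.idem (Chains.empty A v).cell.head) : A.Env) • (1 : A.Alg) = _
      rw [env_smul, one_mul, unop_op]
      have h2 : (Chains.empty A v).cell.head = v := congrArg Under.head Chains.top_empty
      rw [h2]
      exact idem_mul_idem v
    intro a
    have h2 := Submodule.smul_mem _ (a ⊗ₜ[k] 1 : A.Env) h1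
    rw [env_smul] at h2
    simpa using h2

end

end HPA

/-! ### The Morse complex modulo the arrows -/

namespace HPA

noncomputable section

open scoped Classical
open PathAlgebra OrderComplex MulOpposite

variable {k V : Type*} [CommRing k] [Quiver V] [Fintype V] {A : HPA k V}
  [∀ v w : V, Finite (v ⟶ w)]

/-- The multiplicative map that vanishes identically. -/
def zeroHom (N R : Type*) [Mul N] [Ring R] : N →ₙ* R := ⟨fun _ => 0, fun _ _ => (mul_zero 0).symm⟩

variable (A) in
/-- The weights that vanish on the facets that split off a path. -/
def baseWeight (R : Type*) [Ring R] : A.Cell → A.Cell → R :=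
  stepWeight (zeroHom A.Alg R) (zeroHom A.Algᵐᵒᵖ R)

theorem baseWeight_eq (R : Type*) [Ring R] (η τ : A.Cell) : A.baseWeight R η τ =
    if τ = η.initialFacet ∨ τ = η.terminalFacet then 0 else 1 := by
  have h1 : ∀ a, zeroHom A.Alg R a = 0 := fun _ => rfl
  have h2 : ∀ a, zeroHom A.Algᵐᵒᵖ R a = 0 := fun _ => rfl
  unfold baseWeight stepWeight
  rw [h1, h2]
  by_cases h3 : τ = η.initialFacet
  · rw [if_pos h3, if_pos (Or.inl h3), zero_mul]
  · by_cases h4 : τ = η.terminalFacet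
    · rw [if_pos h4, if_pos (Or.inr h4), mul_zero]
    · rw [if_neg h3, if_neg h4, if_neg (not_or.2 ⟨h3, h4⟩), mul_one]

theorem boundary_baseWeight_sq (R : Type*) [Ring R] :
    boundary (A.baseWeight R) * boundary (A.baseWeight R) = 0 :=
  boundary_sq _ _ fun _ _ => Commute.zero_left _

section Map

variable {R S : Type*} [Ring R] [Ring S] (g : R →+* S) {w : A.Cell → A.Cell → R}
  {w' : A.Cell → A.Cell → S} {M : Set (A.Cell × A.Cell)}

theorem ZigZag.map_weight (h : ∀ η τ : A.Cell, τ.IsFacet η → g (w η τ) = w' η τ) {η ω : A.Cell}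
    (z : ZigZag M η ω) : g (z.weight w) = z.weight w' := by
  induction z with
  | nil => exact map_one g
  | cons τ ρ facet _ _ z ih => rw [ZigZag.weight, ZigZag.weight, map_mul, ih, h _ _ facet]

theorem GradientPath.map_total (hM : IsMorseMatching M)
    (h : ∀ η τ : A.Cell, τ.IsFacet η → g (w η τ) = w' η τ) (η ω : A.Cell) :
    g (GradientPath.total M w η ω) = GradientPath.total M w' η ω := by
  have := GradientPath.finite hM η ω
  let inst : Fintype (GradientPath M η ω) := Fintype.ofFinite _
  rw [GradientPath.total, GradientPath.total, finsum_eq_sum_of_fintype, finsum_eq_sum_of_fintype,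
    map_sum]
  refine Finset.sum_congr rfl fun γ _ => ?_
  rw [map_zsmul, GradientPath.weight, GradientPath.weight, map_mul, ZigZag.map_weight g h,
    h _ _ γ.facet]

end Map

theorem map_baseWeight {R S : Type*} [Ring R] [Ring S] (g : R →+* S) (η τ : A.Cell) :
    g (A.baseWeight R η τ) = A.baseWeight S η τ := by
  rw [baseWeight_eq, baseWeight_eq]
  split_ifs
  · exact map_zero g
  · exact map_one g

theorem Cell.exists_lastStep_ne_bot {η : A.Cell} (h : η.chain.Nonempty) :
    ∃ r : A.Under η.terminalFacet.top.head, r ≠ ⊥ ∧ η.lastStep = r.toAlg := by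
  obtain ⟨r, hr⟩ := Chains.erase_top_le η
  refine ⟨r, ?_, ?_⟩
  · rintro rfl
    have h1 := Cell.size_terminalFacet h
    have h2 : η.terminalFacet.top = η.top := (Under.comp_bot _).symm.trans hr
    refine h1.ne ?_
    unfold Cell.size
    rw [← h2]
    rfl
  · unfold lastStep
    rw [← hr]
    exact Under.quot_comp_self _ r

/-- The paths that are split off are nonconstant. So every ring map killing the nonconstant paths on
both sides turns the bimodule weights into the weights 0 and 1. -/
theorem map_envWeight {S : Type*} [Ring S] (g : A.Env →+* S)
    (hl : ∀ (v : V) (p : A.Under v), p ≠ ⊥ → g (p.toAlg ⊗ₜ[k] 1) = 0)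
    (hr : ∀ (v : V) (p : A.Under v), p ≠ ⊥ → g (1 ⊗ₜ[k] op p.toAlg) = 0)
    (η τ : A.Cell) (h : τ.IsFacet η) : g (A.envWeight η τ) = A.baseWeight S η τ := by
  have h1 : g (A.leftHom η.low.toAlg) = 0 :=
    hl _ _ (Cell.ne_bot_of_mem (Cell.isLeast_low h.1).1)
  have h2 : g (A.rightHom (op η.lastStep)) = 0 := by
    obtain ⟨r, hr1, hr2⟩ := Cell.exists_lastStep_ne_bot h.1
    rw [hr2]
    exact hr _ r hr1
  rw [baseWeight_eq, envWeight, stepWeight, map_mul]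
  by_cases h3 : τ = η.initialFacet
  · rw [if_pos h3, if_pos (Or.inl h3), h1, zero_mul]
  · by_cases h4 : τ = η.terminalFacet
    · rw [if_pos h4, if_pos (Or.inr h4), h2, mul_zero]
    · rw [if_neg h3, if_neg h4, if_neg (not_or.2 ⟨h3, h4⟩), map_one, mul_one]

/-! ### Ring maps that kill the arrows -/

theorem exists_arrow_of_ne_bot {v : V} {p : A.Under v} (hp : p ≠ ⊥) :
    ∃ (u w : V) (a : u ⟶ w) (x : A.Alg), p.toAlg = x * A.ofPath ⟨u, w, a.toPath⟩ := by
  obtain ⟨w, p⟩ := p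
  induction p using Quotient.inductionOn with | h p
  cases p with
  | nil => exact absurd rfl hp
  | cons p a =>
    refine ⟨_, _, a, A.ofPath ⟨_, _, p⟩, ?_⟩
    rw [ofPath_mul, of_mul_of']
    rfl

theorem ofPath_arrow {u w : V} (a : u ⟶ w) :
    ∃ p : A.Under u, p ≠ ⊥ ∧ A.ofPath ⟨u, w, a.toPath⟩ = p.toAlg := by
  refine ⟨⟨w, Quotient.mk _ a.toPath⟩, ?_, rfl⟩
  intro h
  have h1 : w = u := congrArg Under.head h
  subst h1
  have := A.acyclic w a.toPath
  simp at this

theorem arrowIdeal_left {v : V} {p : A.Under v} (hp : p ≠ ⊥) :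
    (p.toAlg ⊗ₜ[k] 1 : A.Env) ∈ A.arrowIdeal := by
  obtain ⟨u, w, a, x, h⟩ := exists_arrow_of_ne_bot hp
  have h1 : (p.toAlg ⊗ₜ[k] 1 : A.Env) =
      (x ⊗ₜ[k] 1) * (A.ofPath ⟨u, w, a.toPath⟩ ⊗ₜ[k] 1) := by
    rw [Algebra.TensorProduct.tmul_mul_tmul, one_mul, h]
  rw [h1]
  exact TwoSidedIdeal.mul_mem_left _ _ _ (TwoSidedIdeal.subset_span ⟨u, w, a, Or.inl rfl⟩)

theorem arrowIdeal_right {v : V} {p : A.Under v} (hp : p ≠ ⊥) :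
    (1 ⊗ₜ[k] op p.toAlg : A.Env) ∈ A.arrowIdeal := by
  obtain ⟨u, w, a, x, h⟩ := exists_arrow_of_ne_bot hp
  have h1 : (1 ⊗ₜ[k] op p.toAlg : A.Env) =
      (1 ⊗ₜ[k] op (A.ofPath ⟨u, w, a.toPath⟩)) * (1 ⊗ₜ[k] op x) := by
    rw [Algebra.TensorProduct.tmul_mul_tmul, one_mul, ← op_mul, h]
  rw [h1]
  exact TwoSidedIdeal.mul_mem_right _ _ _ (TwoSidedIdeal.subset_span ⟨u, w, a, Or.inr rfl⟩)

variable (A) in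
/-- The character of the enveloping algebra given by two vertices. -/
def envCharacter (v w : V) : A.Env →ₐ[k] k :=
  Algebra.TensorProduct.lift (A.character v)
    ((A.character w).fromOpposite fun _ _ => Commute.all _ _) fun _ _ => Commute.all _ _

theorem envCharacter_tmul (v w : V) (a : A.Alg) (b : A.Alg) :
    A.envCharacter v w (a ⊗ₜ[k] op b) = A.character v a * A.character w b :=
  Algebra.TensorProduct.lift_tmul _ _ _ _ _

theorem envCharacter_left (v w : V) (u : V) (p : A.Under u) (hp : p ≠ ⊥) :
    A.envCharacter v w (p.toAlg ⊗ₜ[k] 1) = 0 := by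
  rw [← op_one, envCharacter_tmul, character_of_ne_bot v hp, zero_mul]

theorem envCharacter_right (v w : V) (u : V) (p : A.Under u) (hp : p ≠ ⊥) :
    A.envCharacter v w (1 ⊗ₜ[k] op p.toAlg) = 0 := by
  rw [envCharacter_tmul, character_of_ne_bot w hp, mul_zero]

/-- These characters detect the scalar part of a differential entry modulo the arrows, which is how
minimality is turned into an equation in `k`. -/
theorem envCharacter_eq_zero (v w : V) {x : A.Env} (hx : x ∈ A.arrowIdeal) :
    A.envCharacter v w x = 0 := by
  have h := TwoSidedIdeal.mem_span_iff.1 hx (TwoSidedIdeal.ker (A.envCharacter v w)) ?_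
  · exact (TwoSidedIdeal.mem_ker _).1 h
  · rintro _ ⟨u, u', a, rfl | rfl⟩
    · obtain ⟨p, hp, h⟩ := ofPath_arrow (A := A) a
      rw [h]
      exact (TwoSidedIdeal.mem_ker _).2 (envCharacter_left v w _ p hp)
    · obtain ⟨p, hp, h⟩ := ofPath_arrow (A := A) a
      rw [h]
      exact (TwoSidedIdeal.mem_ker _).2 (envCharacter_right v w _ p hp)

theorem envCharacter_gen (η : A.Cell) : A.envCharacter η.tail η.head (gen η) = 1 := by
  rw [gen, envCharacter_tmul, character_idem, character_idem, mul_one]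

variable {M : Set (A.Cell × A.Cell)}

/-- The Morse complex is minimal if the differential vanishes modulo the arrows. -/
theorem IsMorseMatching.isMinimal (hM : IsMorseMatching M)
    (h : ∀ n (η : CritCell M (n + 1)) (ω : CritCell M n),
      GradientPath.total M (A.baseWeight k) η.1 ω.1 = 0) : IsMinimal M := by
  intro n x ω
  induction x using DirectSum.induction_on with
  | zero =>
    rw [map_zero]
    exact A.arrowIdeal.zero_mem
  | add x y hx hy =>
    rw [map_add]
    exact A.arrowIdeal.add_mem hx hy
  | of η y =>
    have h1 := morseDiff_lof_apply hM n η y ω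
    refine Eq.subst (motive := (· ∈ A.arrowIdeal)) h1.symm ?_
    refine TwoSidedIdeal.mul_mem_right _ _ _ (TwoSidedIdeal.mul_mem_left _ _ _ ?_)
    have hq : ∀ y : A.Env, A.arrowIdeal.ringCon.mk' y = 0 ↔ y ∈ A.arrowIdeal := fun y => by
      rw [← map_zero A.arrowIdeal.ringCon.mk', TwoSidedIdeal.mem_iff]
      exact RingCon.eq _
    -- Modulo the arrows the entry is the image of the corresponding sum over `k`, which vanishes by
    -- hypothesis.
    rw [← hq, GradientPath.map_total _ hM (map_envWeight A.arrowIdeal.ringCon.mk'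
      (fun v p hp => (hq _).2 (arrowIdeal_left hp)) (fun v p hp => (hq _).2 (arrowIdeal_right hp))),
      ← GradientPath.map_total (A.arrowIdeal.ringCon.mk'.comp (algebraMap k A.Env)) hM
        (fun η τ _ => map_baseWeight _ η τ), h, map_zero]

/-- If the Morse complex is minimal, then its differential vanishes modulo the arrows. -/
theorem IsMorseMatching.total_eq_zero (hM : IsMorseMatching M) (hmin : IsMinimal M) {n : ℕ}
    (η : CritCell M (n + 1)) (ω : CritCell M n) (ht : η.1.tail = ω.1.tail)
    (hh : η.1.head = ω.1.head) : GradientPath.total M (A.baseWeight k) η.1 ω.1 = 0 := by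
  have h1 := morseDiff_lof_apply hM n η ⟨gen η.1, Submodule.subset_span rfl⟩ ω
  have h2 := envCharacter_eq_zero η.1.tail η.1.head (hmin n
    (DirectSum.lof A.Env _ (fun ω : CritCell M (n + 1) => proj ω.1) η
      ⟨gen η.1, Submodule.subset_span rfl⟩) ω)
  have h3 := (congrArg (A.envCharacter η.1.tail η.1.head) h1).symm.trans h2
  rw [map_mul, map_mul, envCharacter_gen, one_mul] at h3
  -- Equal endpoints ensure that the chosen character takes the value 1 on the idempotent of `ω` as
  -- well.
  have h4 : A.envCharacter η.1.tail η.1.head (gen ω.1) = 1 := by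
    rw [ht, hh, envCharacter_gen]
  rw [h4, mul_one] at h3
  have h5 := GradientPath.map_total (A.envCharacter η.1.tail η.1.head : A.Env →+* k) hM
    (map_envWeight _ (envCharacter_left _ _) (envCharacter_right _ _)) η.1 ω.1
  exact h5.symm.trans h3

end

end HPA

/-! ### The cells of an interval -/

namespace HPA

noncomputable section

open scoped Classical
open PathAlgebra OrderComplex MulOpposite

variable {k V : Type*} [CommRing k] [Quiver V] [Fintype V] {A : HPA k V}

/-- The cells `[e < σ < p]`, for the simplices `σ` with `n` vertices. -/
def intervalCells {v : V} (p : A.Under v) (hp : p ≠ ⊥) (n : ℕ) : Set A.Cell :=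
  {η | ∃ σ : Simplex (Interval p), σ.1.card = n ∧ cellOf p hp σ = η}

/-- The cell `[e < σ < p]`, for a simplex `σ` with `n` vertices. -/
abbrev simplexCell {v : V} (p : A.Under v) (hp : p ≠ ⊥) (n : ℕ)
    (σ : {σ : Simplex (Interval p) // σ.1.card = n}) : A.Cell := cellOf p hp σ.1

variable {v : V} {p : A.Under v} (hp : p ≠ ⊥)

theorem simplexCell_injective (n : ℕ) : Function.Injective (simplexCell p hp n) :=
  fun _ _ h => Subtype.ext (cellOf_injective h)

theorem mem_range_simplexCell {n : ℕ} {η : A.Cell} (h : η ∈ intervalCells p hp n) :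
    η ∈ Set.range (simplexCell p hp n) := by
  obtain ⟨σ, hσ, rfl⟩ := h
  exact ⟨⟨σ, hσ⟩, rfl⟩

theorem simplexCell_mem {n : ℕ} (σ : {σ : Simplex (Interval p) // σ.1.card = n}) :
    simplexCell p hp n σ ∈ intervalCells p hp n := ⟨σ.1, σ.2, rfl⟩

/-- The chain of the cell `[e < σ < p]`. -/
abbrev cellChain (σ : Simplex (Interval p)) : A.Chains v :=
  ⟨(cellOf p hp σ).chain, (cellOf p hp σ).isChain, (cellOf p hp σ).bot_notMem⟩

/-- Positions in a cell are counted from 1, the initial facet having index 0, while vertices of a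
simplex are counted from 0. The shift produces the minus sign in `boundary_cellOf`. -/
theorem filter_cellOf (σ : Simplex (Interval p)) {y : Interval p} (hy : y ∈ σ.1) :
    ((cellOf p hp σ).chain.filter (· ≤ y.1)).card = (σ.1.filter (· < y)).card + 1 := by
  have h1 : (cellOf p hp σ).chain.filter (· ≤ y.1) =
      (insert y (σ.1.filter (· < y))).map (Function.Embedding.subtype _) := by
    ext q
    refine Finset.mem_filter.trans ((and_congr_left' (mem_cellOf (hp := hp))).trans ?_)
    simp only [Finset.mem_map, Finset.mem_insert, Finset.mem_filter]
    constructor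
    · rintro ⟨rfl | ⟨z, hz, rfl⟩, h⟩
      · exact absurd h (not_le_of_gt y.2.2)
      · refine ⟨z, ?_, rfl⟩
        rcases (show z ≤ y from h).eq_or_lt with h | h
        · exact Or.inl h
        · exact Or.inr ⟨hz, h⟩
    · rintro ⟨z, rfl | ⟨hz, h⟩, rfl⟩
      · exact ⟨Or.inr ⟨z, hy, rfl⟩, le_rfl⟩
      · exact ⟨Or.inr ⟨z, hz, rfl⟩, h.le⟩
  rw [h1, Finset.card_map, Finset.card_insert_of_notMem (by simp)]

variable [∀ v w : V, Finite (v ⟶ w)]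

theorem Cell.exists_cellOf {η : A.Cell} (h : η.chain.Nonempty) :
    ∃ (p : A.Under η.tail) (hp : p ≠ ⊥) (σ : Simplex (Interval p)),
      cellOf p hp σ = η ∧ σ.1.card + 1 = η.dim := by
  obtain ⟨v, c, hc, hbot⟩ := η
  set η : A.Cell := ⟨v, c, hc, hbot⟩ with hη
  have htop := Cell.isGreatest_top h
  have hne : η.top ≠ ⊥ := Cell.ne_bot_of_mem htop.1
  have hIoo : ∀ q ∈ c.erase η.top, q ∈ Set.Ioo (⊥ : A.Under v) η.top := by
    intro q hq
    have hq' := Finset.mem_erase.1 hq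
    refine ⟨bot_lt_iff_ne_bot.2 fun h => hbot (h ▸ hq'.2), ?_⟩
    exact lt_of_le_of_ne (htop.2 hq'.2) hq'.1
  let σ : Simplex (Interval η.top) := ⟨(c.erase η.top).subtype (· ∈ Set.Ioo (⊥ : A.Under v) η.top),
    fun x hx y hy hxy => by
      have hx' := Finset.mem_subtype.1 (Finset.mem_coe.1 hx)
      have hy' := Finset.mem_subtype.1 (Finset.mem_coe.1 hy)
      exact hc.total (Finset.mem_of_mem_erase hx') (Finset.mem_of_mem_erase hy')⟩
  have hmap : σ.1.map (Function.Embedding.subtype _) = c.erase η.top :=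
    Finset.subtype_map_of_mem hIoo
  refine ⟨η.top, hne, σ, ?_, ?_⟩
  · refine Cell.ext_chain.2 ?_
    rw [hmap]
    exact Finset.insert_erase htop.1
  · rw [← Finset.card_map (Function.Embedding.subtype _), hmap]
    exact Finset.card_erase_add_one htop.1

/-- The initial and the terminal facet have weight 0; what remains are the faces obtained by
deleting vertices of `σ`, with shifted signs. -/
theorem boundary_cellOf (σ : Simplex (Interval p)) :
    boundary (A.baseWeight k) (Finsupp.single (cellOf p hp σ) 1) =
      - ∑ y ∈ σ.1, Finsupp.single (cellOf p hp (σ.erase y))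
        ((-1) ^ (σ.1.filter (· < y)).card) := by
  have h1 : boundary (A.baseWeight k) (Finsupp.single (cellOf p hp σ) 1) =
      initialBoundary (zeroHom A.Alg k) v (Finsupp.single (cellChain hp σ) 1) +
        toCells k v (innerBoundary (zeroHom A.Algᵐᵒᵖ k) v (Finsupp.single (cellChain hp σ) 1)) :=
    boundary_single_cell _ _ (cellChain hp σ)
  have h2 : initialBoundary (zeroHom A.Alg k) v (Finsupp.single (cellChain hp σ) 1) = 0 := by
    rw [initialBoundary, Finsupp.linearCombination_single, one_smul]
    split_ifs
    · exact Finsupp.single_zero _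
    · rfl
  have h0 : ∀ a, zeroHom A.Algᵐᵒᵖ k a = 0 := fun _ => rfl
  rw [h1, h2, zero_add, innerBoundary_single, map_sum]
  change ∑ q ∈ insert p (σ.1.map (Function.Embedding.subtype _)), _ = _
  have hnot : p ∉ σ.1.map (Function.Embedding.subtype _) := by
    rw [Finset.mem_map]
    rintro ⟨y, -, h⟩
    exact y.2.2.ne h
  rw [Finset.sum_insert hnot, Finset.sum_map, ← Finset.sum_neg_distrib]
  have hp0 : innerWeight (zeroHom A.Algᵐᵒᵖ k) (cellChain hp σ).cell p = 0 := by
    have h3 : p = (cellChain hp σ).cell.top := (top_cellOf (hp := hp) σ).symm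
    unfold innerWeight
    rw [if_pos h3, h0, mul_zero]
  rw [toCells_single, hp0, Finsupp.single_zero, zero_add]
  refine Finset.sum_congr rfl fun y hy => ?_
  rw [toCells_single, ← Finsupp.single_neg]
  have h3 : ((cellChain hp σ).erase y.1).cell = cellOf p hp (σ.erase y) := erase_cellOf σ y
  have h4 : innerWeight (zeroHom A.Algᵐᵒᵖ k) (cellChain hp σ).cell y.1 =
      -(-1) ^ (σ.1.filter (· < y)).card := by
    unfold innerWeight
    have h5 : y.1 ≠ (cellChain hp σ).cell.top := fun h => y.2.2.ne (h.trans (top_cellOf (hp := hp) σ))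
    have h6 := filter_cellOf hp σ hy
    rw [if_neg h5, mul_one]
    change (-1) ^ ((cellOf p hp σ).chain.filter (· ≤ y.1)).card = _
    rw [h6, pow_succ, mul_neg_one]
  exact congrArg₂ Finsupp.single h3 h4

/-- The reduced chains of the order complex as chains on the cells. -/
abbrev redToCells (n : ℕ) : RedChain k (Interval p) n →ₗ[k] (A.Cell →₀ k) :=
  extendMap k (simplexCell p hp n)

theorem redToCells_mem {n : ℕ} (x : RedChain k (Interval p) n) :
    redToCells hp n x ∈ Finsupp.supported k k (intervalCells p hp n) :=
  extendMap_mem (simplexCell_mem hp) x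

theorem redToCells_injective (n : ℕ) : Function.Injective (redToCells (k := k) hp n) :=
  extendMap_injective (simplexCell_injective hp n)

theorem exists_redToCells {n : ℕ} {x : A.Cell →₀ k}
    (hx : x ∈ Finsupp.supported k k (intervalCells p hp n)) : ∃ y, redToCells hp n y = x :=
  ⟨_, extendMap_restrictMap (simplexCell_injective hp n)
    (fun _ h => mem_range_simplexCell hp h) hx⟩

theorem boundary_redToCells (n : ℕ) (x : RedChain k (Interval p) (n + 1)) :
    boundary (A.baseWeight k) (redToCells hp (n + 1) x) =
      - redToCells hp n (redBoundary k (Interval p) n x) := by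
  have h : boundary (A.baseWeight k) ∘ₗ redToCells hp (n + 1) =
      - (redToCells hp n ∘ₗ redBoundary k (Interval p) n) := by
    refine Finsupp.lhom_ext fun σ r => ?_
    rw [map_single, map_single (-(redToCells hp n ∘ₗ redBoundary k (Interval p) n))]
    congr 1
    rw [LinearMap.neg_apply, LinearMap.comp_apply, LinearMap.comp_apply, extendMap_single]
    refine (boundary_cellOf hp σ.1).trans (congrArg Neg.neg ?_)
    rw [redBoundary, Finsupp.linearCombination_single, one_smul, map_sum, ← Finset.sum_attach]
    refine Finset.sum_congr rfl fun y _ => ?_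
    rw [extendMap_single]
  exact LinearMap.congr_fun h x

namespace BabsonHersh

variable (B : A.BabsonHersh)

/-- The grading of the cells of an interval. -/
theorem isGrading_interval (R : Type*) [Ring R] :
    IsGrading B.matching (A.baseWeight R) (intervalCells p hp) where
  zero := by
    rintro _ ⟨σ, hσ, rfl⟩ τ ⟨-, rfl | ⟨q, hq, rfl⟩⟩
    · rw [baseWeight_eq, if_pos (Or.inl rfl)]
    · rcases (mem_cellOf (hp := hp)).1 hq with h | ⟨y, hy, -⟩
      · exact (baseWeight_eq R _ _).trans (if_pos (Or.inr (congrArg (Cell.erase _)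
          (h.trans (top_cellOf (hp := hp) σ).symm))))
      · rw [Finset.card_eq_zero] at hσ
        rw [hσ] at hy
        exact absurd hy (Finset.notMem_empty y)
  succ := by
    rintro n _ ⟨σ, hσ, rfl⟩ τ ⟨-, rfl | ⟨q, hq, rfl⟩⟩ hw
    · rw [baseWeight_eq, if_pos (Or.inl rfl)] at hw
      exact absurd rfl hw
    · rcases (mem_cellOf (hp := hp)).1 hq with h | ⟨y, hy, rfl⟩
      · exact absurd ((baseWeight_eq R _ _).trans (if_pos (Or.inr (congrArg (Cell.erase _)
          (h.trans (top_cellOf (hp := hp) σ).symm))))) hw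
      · refine ⟨σ.erase y, ?_, (erase_cellOf σ y).symm⟩
        have := Simplex.card_erase hy
        omega
  up := by
    rintro n ρ _ h ⟨σ, hσ, rfl⟩
    obtain ⟨τ, rfl, hτ⟩ := mem_matching_right.1 h
    obtain ⟨x, hx, rfl⟩ := hτ.exists_erase
    have := Simplex.card_erase hx
    exact ⟨τ, by omega, rfl⟩

/-- The Morse datum modulo the arrows. -/
abbrev baseDatum : MorseDatum (Module.End k (A.Cell →₀ k)) :=
  B.isMorseMatching.datum (A.baseWeight k) (B.isMorseMatching.stepWeight_eq_one _ _)
    (boundary_baseWeight_sq k)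

/-- The size never grows along an alternating path, and it is constant only if all steps down are
inner. So alternating paths between cells of one interval have weight 1. -/
theorem size_zigzag {η ω : A.Cell} (z : ZigZag B.matching η ω) :
    ω.size ≤ η.size ∧ (ω.size = η.size → z.weight (A.baseWeight k) = 1) := by
  induction z with
  | nil => exact ⟨le_rfl, fun _ => rfl⟩
  | @cons η ω τ ρ facet down up z ih =>
    have h1 : ρ.size = τ.size := by
      obtain ⟨q, -, hq, rfl⟩ := B.isMorseMatching.inner up
      exact (Cell.size_erase hq).symm
    rcases facet.size_lt_or with h | ⟨q, hq, hq', rfl⟩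
    · exact ⟨by omega, fun h' => by omega⟩
    · have h2 := Cell.size_erase hq'
      refine ⟨by omega, fun h' => ?_⟩
      rw [ZigZag.weight, ih.2 (by omega), mul_one]
      exact stepWeight_of_inner _ _ hq hq'

theorem size_cellOf (σ τ : Simplex (Interval p)) :
    (cellOf p hp σ).size = (cellOf p hp τ).size := by
  unfold Cell.size
  rw [top_cellOf]
  exact congrArg (fun q : A.Under v => (Set.Iic q).ncard) (top_cellOf (hp := hp) τ).symm

/-- This matches the sum over all alternating paths in `morseChain` with the sum over weighted ones.
-/
theorem total_cellOf (σ τ : Simplex (Interval p)) :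
    ZigZag.total B.matching (A.baseWeight k) (cellOf p hp σ) (cellOf p hp τ) =
      ((∑ᶠ z : ZigZag B.matching (cellOf p hp σ) (cellOf p hp τ), z.sign : ℤ) : k) := by
  have := ZigZag.finite B.isMorseMatching (cellOf p hp σ) (cellOf p hp τ)
  let inst : Fintype (ZigZag B.matching (cellOf p hp σ) (cellOf p hp τ)) := Fintype.ofFinite _
  rw [ZigZag.total, finsum_eq_sum_of_fintype, finsum_eq_sum_of_fintype, Int.cast_sum]
  refine Finset.sum_congr rfl fun z _ => ?_
  rw [(B.size_zigzag z).2 (size_cellOf hp _ _), zsmul_eq_mul, mul_one]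

end BabsonHersh

end

end HPA

/-! ### The homology of the intervals -/

namespace HPA

noncomputable section

open scoped Classical
open PathAlgebra OrderComplex MulOpposite

variable {k V : Type*} [CommRing k] [Quiver V] [Fintype V] {A : HPA k V}
  [∀ v w : V, Finite (v ⟶ w)] {v : V} {p : A.Under v}

namespace BabsonHersh

variable (B : A.BabsonHersh) (hp : p ≠ ⊥)

/-- The cell of a critical simplex. -/
abbrev critSimplexCell (n : ℕ) (σ : B.CritSimplex p hp n) : A.Cell := cellOf p hp σ.1.1

theorem critSimplexCell_injective (n : ℕ) : Function.Injective (B.critSimplexCell hp n) :=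
  fun _ _ h => Subtype.ext (Subtype.ext (cellOf_injective h))

instance (n : ℕ) : Finite (B.CritSimplex p hp n) :=
  Finite.of_injective _ (B.critSimplexCell_injective hp n)

/-- The chains on the critical simplices as chains on the cells. -/
abbrev critToCells (n : ℕ) : (B.CritSimplex p hp n →₀ k) →ₗ[k] (A.Cell →₀ k) :=
  extendMap k (B.critSimplexCell hp n)

theorem critToCells_injective (n : ℕ) : Function.Injective (B.critToCells hp n) :=
  extendMap_injective (B.critSimplexCell_injective hp n)

theorem critToCells_mem {n : ℕ} (c : B.CritSimplex p hp n →₀ k) :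
    B.critToCells hp n c ∈ Finsupp.supported k k (intervalCells p hp n) :=
  extendMap_mem (s := intervalCells p hp n) (f := B.critSimplexCell hp n)
    (fun σ => ⟨σ.1.1, σ.1.2, rfl⟩) c

theorem cellProj_critToCells {n : ℕ} (c : B.CritSimplex p hp n →₀ k) :
    cellProj k {η | IsCritical B.matching η} (B.critToCells hp n c) = B.critToCells hp n c := by
  ext η
  rw [cellProj_apply]
  split_ifs with h
  · rfl
  · exact (mem_supported_iff.1 (extendMap_mem (s := {η | IsCritical B.matching η})
      (f := B.critSimplexCell hp n) (fun σ => σ.2) c) η h).symm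

theorem exists_critToCells {n : ℕ} {x : A.Cell →₀ k}
    (hx : x ∈ Finsupp.supported k k (intervalCells p hp n))
    (hC : cellProj k {η | IsCritical B.matching η} x = x) : ∃ c, B.critToCells hp n c = x := by
  refine ⟨_, extendMap_restrictMap (B.critSimplexCell_injective hp n)
    (s := {η | η ∈ intervalCells p hp n ∧ IsCritical B.matching η}) ?_ ?_⟩
  · rintro _ ⟨⟨σ, hσ, rfl⟩, h⟩
    exact ⟨⟨⟨σ, hσ⟩, h⟩, rfl⟩
  · rw [mem_supported_iff] at hx ⊢
    intro η hη
    by_cases h : η ∈ intervalCells p hp n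
    · rw [← hC, cellProj_apply]
      exact if_neg fun h' => hη ⟨h, h'⟩
    · exact hx η h

/-- The chain of a combination of critical simplices. -/
def morseMap (n : ℕ) : (B.CritSimplex p hp n →₀ k) →ₗ[k] RedChain k (Interval p) n :=
  restrictMap k (simplexCell_injective hp n) ∘ₗ B.baseDatum.incl ∘ₗ B.critToCells hp n

theorem redToCells_morseMap {n : ℕ} (c : B.CritSimplex p hp n →₀ k) :
    redToCells hp n (B.morseMap hp n c) = B.baseDatum.incl (B.critToCells hp n c) := by
  refine extendMap_restrictMap (simplexCell_injective hp n)
    (fun _ h => mem_range_simplexCell hp h) ?_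
  exact (B.isGrading_interval hp k).incl_mem B.isMorseMatching
    (B.isMorseMatching.stepWeight_eq_one _ _) (boundary_baseWeight_sq k) (B.critToCells_mem hp c)

theorem morseMap_single {n : ℕ} (σ : B.CritSimplex p hp n) :
    B.morseMap hp n (Finsupp.single σ 1) = B.morseChain p hp n σ := by
  ext τ
  have h1 : B.baseDatum.incl (B.critToCells hp n (Finsupp.single σ 1)) =
      zigzagSum B.matching (A.baseWeight k) (Finsupp.single (cellOf p hp σ.1.1) 1) := by
    refine congrArg (zigzagSum B.matching (A.baseWeight k))
      ((B.cellProj_critToCells hp _).trans ?_)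
    rw [extendMap_single]
  have h2 : B.morseMap hp n (Finsupp.single σ 1) τ =
      zigzagSum B.matching (A.baseWeight k) (Finsupp.single (cellOf p hp σ.1.1) 1)
        (cellOf p hp τ.1) := by
    rw [← h1]
    rfl
  rw [h2, zigzagSum, ofMatrix_single_apply, one_mul, total_cellOf, morseChain,
    Finsupp.finsetSum_apply]
  exact (sum_single_apply (f := fun τ : {τ : Simplex (Interval p) // τ.1.card = n} => τ)
    Function.injective_id (fun τ => ((∑ᶠ z : ZigZag B.matching (cellOf p hp σ.1.1)
      (cellOf p hp τ.1), z.sign : ℤ) : k)) τ).symm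

/-- The differential of the Morse complex vanishes on the critical simplices with `n + 1` vertices. -/
def DiffZero (n : ℕ) : Prop :=
  ∀ c : B.CritSimplex p hp (n + 1) →₀ k, B.baseDatum.diff (B.critToCells hp (n + 1) c) = 0

theorem boundary_incl (x : A.Cell →₀ k) :
    boundary (A.baseWeight k) (B.baseDatum.incl x) = B.baseDatum.incl (B.baseDatum.diff x) :=
  LinearMap.congr_fun B.baseDatum.d_incl x

theorem redToCells_redBoundary_morseMap {n : ℕ} (c : B.CritSimplex p hp (n + 1) →₀ k) :
    redToCells hp n (redBoundary k (Interval p) n (B.morseMap hp (n + 1) c)) =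
      - B.baseDatum.incl (B.baseDatum.diff (B.critToCells hp (n + 1) c)) := by
  rw [← boundary_incl, ← redToCells_morseMap, boundary_redToCells, neg_neg]

theorem morseMap_mem_zero (c : B.CritSimplex p hp 0 →₀ k) :
    B.morseMap hp 0 c ∈ redCycles k (Interval p) 0 := Submodule.mem_top

theorem morseMap_mem_succ {n : ℕ} (h : B.DiffZero hp n) (c : B.CritSimplex p hp (n + 1) →₀ k) :
    B.morseMap hp (n + 1) c ∈ redCycles k (Interval p) (n + 1) := by
  refine LinearMap.mem_ker.2 (redToCells_injective hp n ?_)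
  rw [redToCells_redBoundary_morseMap, h c, map_zero, map_zero, neg_zero]

section HomMap

variable {n : ℕ} (hc : ∀ c, B.morseMap hp n c ∈ redCycles k (Interval p) n)

/-- The map from the critical simplices to homology. -/
def homMap : (B.CritSimplex p hp n →₀ k) →ₗ[k] RedHomology k (Interval p) n :=
  Submodule.mkQ _ ∘ₗ (B.morseMap hp n).codRestrict _ hc

theorem homMap_eq_zero_iff (c : B.CritSimplex p hp n →₀ k) :
    B.homMap hp hc c = 0 ↔ ∃ y, redBoundary k (Interval p) n y = B.morseMap hp n c :=
  Submodule.Quotient.mk_eq_zero _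

theorem boundary_redToCells_of_mem (B : A.BabsonHersh) {z : RedChain k (Interval p) n}
    (hz : z ∈ redCycles k (Interval p) n) :
    boundary (A.baseWeight k) (redToCells hp n z) = 0 := by
  cases n with
  | zero => exact (B.isGrading_interval hp k).boundary_zero (redToCells_mem hp z)
  | succ n => rw [boundary_redToCells, LinearMap.mem_ker.1 hz, map_zero, neg_zero]

/-- For a cycle `z` the homotopy formula reduces to `z - incl (proj z) = d (h z)`, so `z` is
homologous to the chain of `proj z`. -/
theorem homMap_surjective : Function.Surjective (B.homMap hp hc) := by
  intro h
  obtain ⟨⟨z, hz⟩, rfl⟩ := Submodule.Quotient.mk_surjective _ h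
  have hs := B.isGrading_interval hp k
  have hwM := B.isMorseMatching.stepWeight_eq_one (zeroHom A.Alg k) (zeroHom A.Algᵐᵒᵖ k)
  obtain ⟨c, hcz⟩ := B.exists_critToCells hp (n := n) (x := B.baseDatum.proj (redToCells hp n z))
    (hs.proj_mem B.isMorseMatching hwM (boundary_baseWeight_sq k) (redToCells_mem hp z))
    (LinearMap.congr_fun B.baseDatum.eC_proj _)
  obtain ⟨y, hy⟩ := exists_redToCells hp (hs.htpy_mem B.isMorseMatching hwM
    (boundary_baseWeight_sq k) (redToCells_mem hp z))
  have h1 := LinearMap.congr_fun B.baseDatum.incl_proj_eq (redToCells hp n z)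
  have h2 : redToCells hp n z - B.baseDatum.incl (B.critToCells hp n c) =
      boundary (A.baseWeight k) (redToCells hp (n + 1) y) := by
    rw [hcz, hy]
    refine h1.trans ?_
    have h3 : (B.baseDatum.htpy * B.baseDatum.d) (redToCells hp n z) =
        B.baseDatum.htpy (boundary (A.baseWeight k) (redToCells hp n z)) := rfl
    rw [LinearMap.add_apply, h3, boundary_redToCells_of_mem hp B hz, map_zero, add_zero]
    rfl
  have h4 : redBoundary k (Interval p) n y = B.morseMap hp n c - z := by
    refine redToCells_injective hp n ?_
    rw [map_sub, redToCells_morseMap, ← neg_sub, h2, boundary_redToCells, neg_neg]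
  refine ⟨c, (Submodule.Quotient.eq _).2 ?_⟩
  exact ⟨y, h4⟩

/-- If `incl c = ± d y`, then `c = ± proj (d y) = ± diff (proj y)`, which is 0 when the Morse
differential into this degree vanishes. -/
theorem homMap_injective (hd : B.DiffZero hp n) : Function.Injective (B.homMap hp hc) := by
  refine (injective_iff_map_eq_zero _).2 fun c h => ?_
  obtain ⟨y, hy⟩ := (B.homMap_eq_zero_iff hp hc c).1 h
  have hs := B.isGrading_interval hp k
  have hwM := B.isMorseMatching.stepWeight_eq_one (zeroHom A.Alg k) (zeroHom A.Algᵐᵒᵖ k)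
  obtain ⟨e, he⟩ := B.exists_critToCells hp (n := n + 1)
    (x := B.baseDatum.proj (redToCells hp (n + 1) y))
    (hs.proj_mem B.isMorseMatching hwM (boundary_baseWeight_sq k) (redToCells_mem hp y))
    (LinearMap.congr_fun B.baseDatum.eC_proj _)
  have h1 : B.baseDatum.proj (B.baseDatum.incl (B.critToCells hp n c)) = B.critToCells hp n c :=
    (LinearMap.congr_fun B.baseDatum.proj_incl _).trans (B.cellProj_critToCells hp c)
  have h2 : B.baseDatum.proj (boundary (A.baseWeight k) (redToCells hp (n + 1) y)) =
      B.baseDatum.diff (B.baseDatum.proj (redToCells hp (n + 1) y)) :=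
    LinearMap.congr_fun B.baseDatum.proj_d _
  refine B.critToCells_injective hp n ?_
  rw [← h1, ← redToCells_morseMap, ← hy, ← neg_neg (redToCells hp n _), ← boundary_redToCells,
    map_neg, h2, ← he, hd e, neg_zero, map_zero]

/-- A basis indexed by the critical simplices turns the surjection `homMap` into a surjective
endomorphism of a finitely generated module over a Noetherian ring, so it is injective. Which basis
is given does not matter. -/
theorem diffZero_of_basis [IsNoetherianRing k]
    (hc : ∀ c, B.morseMap hp n c ∈ redCycles k (Interval p) n)
    (b : Module.Basis (B.CritSimplex p hp n) k (RedHomology k (Interval p) n)) :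
    B.DiffZero hp n := by
  have hinj : Function.Injective (B.homMap hp hc) := by
    have h1 : Function.Injective (b.repr.toLinearMap ∘ₗ B.homMap hp hc) :=
      IsNoetherian.injective_of_surjective_endomorphism _
        (b.repr.surjective.comp (B.homMap_surjective hp hc))
    exact fun x y h => h1 (congrArg b.repr h)
  intro c
  have hs := B.isGrading_interval hp k
  have hwM := B.isMorseMatching.stepWeight_eq_one (zeroHom A.Alg k) (zeroHom A.Algᵐᵒᵖ k)
  obtain ⟨e, he⟩ := B.exists_critToCells hp (n := n)
    (x := B.baseDatum.diff (B.critToCells hp (n + 1) c))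
    (hs.diff_mem B.isMorseMatching hwM (boundary_baseWeight_sq k) (B.critToCells_mem hp c))
    (LinearMap.congr_fun B.baseDatum.eC_diff _)
  -- The inclusion of a Morse boundary is a boundary, so its homology class vanishes.
  have h2 : B.homMap hp hc e = 0 := by
    refine (B.homMap_eq_zero_iff hp hc e).2 ⟨-B.morseMap hp (n + 1) c, ?_⟩
    refine redToCells_injective hp n ?_
    rw [map_neg, map_neg, redToCells_redBoundary_morseMap, neg_neg, redToCells_morseMap, he]
  rw [← he, (injective_iff_map_eq_zero _).1 hinj e h2, map_zero]

end HomMap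

variable {B}

/-- In degree `n + 1` the map to homology exists only if the Morse chains are cycles, which is the
vanishing of the differential one degree lower; hence the induction. -/
theorem HomologyFreeOnCriticalCells.diffZero [IsNoetherianRing k]
    (h : B.HomologyFreeOnCriticalCells) (n : ℕ) : B.DiffZero hp n := by
  induction n with
  | zero =>
    obtain ⟨b⟩ := h v p hp 0
    exact B.diffZero_of_basis hp (B.morseMap_mem_zero hp) b
  | succ n ih =>
    obtain ⟨b⟩ := h v p hp (n + 1)
    exact B.diffZero_of_basis hp (B.morseMap_mem_succ hp ih) b

theorem HomologyFreeOnCriticalCells.total_eq_zero [IsNoetherianRing k]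
    (h : B.HomologyFreeOnCriticalCells) {n : ℕ} (η : CritCell B.matching (n + 1))
    (ω : CritCell B.matching n) :
    GradientPath.total B.matching (A.baseWeight k) η.1 ω.1 = 0 := by
  have hwM := B.isMorseMatching.stepWeight_eq_one (zeroHom A.Alg k) (zeroHom A.Algᵐᵒᵖ k)
  have h1 := B.isMorseMatching.diff_single (A.baseWeight k) hwM (boundary_baseWeight_sq k) η.2.2
    ω.2.2 1
  rw [one_mul] at h1
  rw [← h1]
  obtain ⟨η, hη, hcrit⟩ := η
  have hne : η.chain.Nonempty := Finset.card_pos.1 (by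
    have : η.chain.card = n + 1 := hη
    omega)
  obtain ⟨p, hp, σ, hσ, hcard⟩ := Cell.exists_cellOf hne
  have hn : σ.1.card = n := by omega
  have h2 : B.baseDatum.diff (Finsupp.single η 1) = 0 := by
    -- For `n = 0` the cell is `[e < p]`; its facets split off `p` and have weight 0.
    cases n with
    | zero =>
      refine (B.isGrading_interval hp k).diff_zero B.isMorseMatching hwM
        (boundary_baseWeight_sq k) ?_
      exact single_mem_supported (s := intervalCells p hp 0) ⟨σ, hn, hσ⟩ _
    | succ n =>
      have h3 := h.diffZero hp n (Finsupp.single ⟨⟨σ, hn⟩, hσ.symm ▸ hcrit⟩ 1)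
      have h4 : B.critToCells hp (n + 1) (Finsupp.single ⟨⟨σ, hn⟩, hσ.symm ▸ hcrit⟩ (1 : k)) =
          Finsupp.single η 1 := (extendMap_single _ _ _).trans (congrArg (Finsupp.single · 1) hσ)
      rwa [h4] at h3
  exact DFunLike.congr_fun h2 _

theorem dim_cellOf (σ : Simplex (Interval p)) : (cellOf p hp σ).dim = σ.1.card + 1 := by
  have hnot : p ∉ σ.1.map (Function.Embedding.subtype _) := by
    rw [Finset.mem_map]
    rintro ⟨y, -, h⟩
    exact y.2.2.ne h
  change (insert p (σ.1.map (Function.Embedding.subtype _))).card = _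
  rw [Finset.card_insert_of_notMem hnot, Finset.card_map]

/-- Critical cells of one interval have the same endpoints, so minimality makes the entries between
them vanish. Entries leading out of the interval are 0 because of the weights. -/
theorem diffZero_of_isMinimal (hmin : IsMinimal B.matching) (n : ℕ) : B.DiffZero hp n := by
  have hwM := B.isMorseMatching.stepWeight_eq_one (zeroHom A.Alg k) (zeroHom A.Algᵐᵒᵖ k)
  have h : B.baseDatum.diff ∘ₗ B.critToCells hp (n + 1) = 0 := by
    refine Finsupp.lhom_ext fun σ r => ?_
    rw [LinearMap.comp_apply, extendMap_single, LinearMap.zero_apply]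
    ext ω
    by_cases hω : ω ∈ intervalCells p hp n ∧ IsCritical B.matching ω
    · obtain ⟨⟨τ, hτ, rfl⟩, hcrit⟩ := hω
      have h1 := B.isMorseMatching.total_eq_zero hmin
        (⟨cellOf p hp σ.1.1, by rw [dim_cellOf, σ.1.2], σ.2⟩ : CritCell B.matching (n + 1 + 1))
        (⟨cellOf p hp τ, by rw [dim_cellOf, hτ], hcrit⟩ : CritCell B.matching (n + 1)) rfl
        (congrArg Under.head
          ((top_cellOf (hp := hp) σ.1.1).trans (top_cellOf (hp := hp) τ).symm))
      have h2 := B.isMorseMatching.diff_single (A.baseWeight k) hwM (boundary_baseWeight_sq k) σ.2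
        hcrit r
      refine h2.trans ?_
      rw [h1, mul_zero]
      rfl
    · by_cases h1 : ω ∈ intervalCells p hp n
      · exact B.isMorseMatching.diff_apply_eq_zero _ _ _ (fun h2 => hω ⟨h1, h2⟩) _
      · have h2 := (B.isGrading_interval hp k).diff_mem B.isMorseMatching hwM
          (boundary_baseWeight_sq k) (single_mem_supported (s := intervalCells p hp (n + 1))
            (η := B.critSimplexCell hp (n + 1) σ) ⟨σ.1.1, σ.1.2, rfl⟩ r)
        exact mem_supported_iff.1 h2 ω h1
  exact fun c => LinearMap.congr_fun h c

theorem criticalCellsFormBasis (h : ∀ (v : V) (p : A.Under v) (hp : p ≠ ⊥) (n : ℕ),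
    B.DiffZero hp n) : B.CriticalCellsFormBasis := by
  intro v p hp n
  have hc : ∀ c, B.morseMap hp n c ∈ redCycles k (Interval p) n := by
    cases n with
    | zero => exact B.morseMap_mem_zero hp
    | succ n => exact B.morseMap_mem_succ hp (h v p hp n)
  let b : Module.Basis (B.CritSimplex p hp n) k (RedHomology k (Interval p) n) :=
    ⟨(LinearEquiv.ofBijective (B.homMap hp hc)
      ⟨B.homMap_injective hp hc (h v p hp n), B.homMap_surjective hp hc⟩).symm⟩
  have hc' (σ : B.CritSimplex p hp n) :
      B.morseChain p hp n σ ∈ redCycles k (Interval p) n := by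
    rw [← morseMap_single]
    exact hc _
  refine ⟨Module.Free.of_basis b, hc', b, fun σ => ?_⟩
  have h1 : b σ = B.homMap hp hc (Finsupp.single σ 1) := rfl
  rw [h1]
  exact congrArg (Submodule.Quotient.mk (p := (LinearMap.range
    (redBoundary k (Interval p) n)).submoduleOf (redCycles k (Interval p) n)))
    (Subtype.ext (B.morseMap_single hp σ))

end BabsonHersh

end

end HPA

/-! ### Assembly of the two directions. -/

theorem mainTheorem5 {k V : Type*} [CommRing k] [IsNoetherianRing k] [Quiver V] [Fintype V]
    [∀ v w : V, Finite (v ⟶ w)] (A : HPA k V) (B : A.BabsonHersh) :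
    (B.HomologyFreeOnCriticalCells →
      HPA.IsProjectiveResolution B.matching ∧ HPA.IsMinimal B.matching ∧
        HPA.IsCellular B.matching) ∧
    (A.IsGradedByLength →
      HPA.IsProjectiveResolution B.matching → HPA.IsMinimal B.matching →
        B.CriticalCellsFormBasis) := by
  refine ⟨fun h => ⟨B.isMorseMatching.isProjectiveResolution,
    B.isMorseMatching.isMinimal fun _ η ω => h.total_eq_zero η ω,
    B.isMorseMatching.isCellular⟩, fun _ _ hmin => ?_⟩
  exact HPA.BabsonHersh.criticalCellsFormBasis fun _ _ hp n =>
    HPA.BabsonHersh.diffZero_of_isMinimal hp hmin n
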